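/- Let $K$ be a number field, $\nu$ a finite place, $K_\nu$ the completion, $p$ the residue characteristic, $q$ the cardinality of the residue field, $\mathcal O$ the ring of integers of $K_\nu$, $\pi$ a uniformizer, and $|\cdot|$ the absolute value of $K_\nu$ with $|\pi|=q^{-1}$. Let $\lambda(x)=\exp(2\pi i\{\mathrm{Tr}_{K_\nu/\mathbb Q_p}(x)\})$, where $\{\cdot\}$ is the $p$-adic fractional part, let $dx$ be the additive Haar measure on $K_\nu$ that is self-dual for $\lambda$, and let $\delta$ be the differential exponent, i.e. the largest integer $d$ such that $\mathrm{Tr}(\pi^{-d}\mathcal O)\subseteq\mathbb Z_p$ (it exists). On $\mathcal L=L^2(K_\nu,dx)$ there are the following (unique) unitary operators: the Fourier transform $\mathcal F$, with $\mathcal F\varphi(y)=\int\varphi(x)\lambda(xy)\,dx$ for $\varphi\in L^1\cap L^2$; the inversion $\mathcal I\varphi(x)=|x|^{-1}\varphi(1/x)$; and the rotations and dilations $\mathcal R(u)\varphi(x)=|u|^{1/2}\varphi(ux)$, $u\in K_\nu^\times$. Let $\mathcal L_0\subset\mathcal L$ be the null space of the averaging operator $\int_{|u|=1}\mathcal R(u)\,d^*u$;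 it is mapped onto itself by $\mathcal F$, $\mathcal I$ and all $\mathcal R(u)$. On the Hilbert space $\mathcal L_0$ let $A$ be multiplication by $\log|x|$, with domain $\{\varphi\in\mathcal L_0:\log|x|\,\varphi\in\mathcal L_0\}$, let $B=\mathcal FA\mathcal F^{-1}$, and let $H$ (the conductor operator) be the closure of $A+B$, where $A+B$ is defined on $D(A)\cap D(B)$. A unitary character $\chi$ of $K_\nu^\times$ is called ramified if it is non-trivial on $\{|u|=1\}$; its conductor exponent is then the smallest integer $f\ge1$ such that $|1-u|\le q^{-f}$ implies $\chi(u)=1$. Then: 1. $H$ is self-adjoint and positive ($\langle\varphi,H\varphi\rangle\ge0$ on its domain). 2. $H$ commutes with $\mathcal F$, with $\mathcal I$ and with every $\mathcal R(u)$ (that is, $UHU^{-1}=H$ with equality of domains for each of these unitary operators $U$). The operators $H$, $A$ and $B$ commute pairwise, in the sense that all their resolvents commute and that, for any two of them, the two products are defined and agree on a dense subspace of $\mathcal L_0$. 3. Let $f_0=2$ if $q=2$ and $f_0=1$ if $q>2$. The spectrum of $H$ is exactly $\{(f+\delta)\log q : f\in\mathbb Z,\ f\ge f_0\}$. Each of these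 values is an eigenvalue; its eigenspace is the closed linear span in $\mathcal L$ of the functions $g(|x|)\chi(x)$, where $g$ is a function with compact support in $(0,\infty)$ and $\chi$ is a ramified unitary character of $K_\nu^\times$ of conductor exponent $f$. The linear span of all these eigenspaces is dense in $\mathcal L_0$. -/

import Mathlib

open IsDedekindDomain NumberField MeasureTheory
open scoped ENNReal

namespace ConductorOperator

noncomputable section

/-! ### The completion `K_v`, its trace to `ℚ_p`, and the additive character -/

section Place

variable {K : Type*} [Field K] [NumberField K] (v : HeightOneSpectrum (𝓞 K))

/-- The residue characteristic `p` of the finite place `v`. -/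
def residueChar : ℕ := ringChar (𝓞 K ⧸ v.asIdeal)

instance residueChar_prime : Fact (residueChar v).Prime := by
  have : Finite (𝓞 K ⧸ v.asIdeal) := v.asIdeal.finiteQuotientOfFreeOfNeBot v.ne_bot
  have : v.asIdeal.IsPrime := v.isPrime
  exact ⟨(CharP.char_is_prime_or_zero (𝓞 K ⧸ v.asIdeal) (residueChar v)).resolve_right
    (CharP.char_ne_zero_of_finite (𝓞 K ⧸ v.asIdeal) (residueChar v))⟩

theorem natCast_mem_iff (n : ℕ) : (n : 𝓞 K) ∈ v.asIdeal ↔ residueChar v ∣ n := by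
  rw [residueChar, ← ringChar.spec, ← Ideal.Quotient.eq_zero_iff_mem, map_natCast]

theorem natCast_eq_embedding (n : ℕ) : (n : v.adicCompletion K) =
    FinitePlace.embedding v (algebraMap (𝓞 K) K n) := by
  simp

theorem norm_natCast_le_one (n : ℕ) : ‖(n : v.adicCompletion K)‖ ≤ 1 := by
  rw [natCast_eq_embedding]; exact FinitePlace.norm_le_one K v _

theorem norm_residueChar_lt_one : ‖(residueChar v : v.adicCompletion K)‖ < 1 := by
  rw [natCast_eq_embedding, FinitePlace.norm_lt_one_iff_mem, natCast_mem_iff]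

theorem norm_natCast_eq_one {n : ℕ} (hn : ¬ residueChar v ∣ n) :
    ‖(n : v.adicCompletion K)‖ = 1 := by
  rw [natCast_eq_embedding, FinitePlace.norm_eq_one_iff_notMem, natCast_mem_iff]; exact hn

theorem norm_algebraMap_le_one {x : ℚ} (hx : ‖(x : ℚ_[residueChar v])‖ ≤ 1) :
    ‖algebraMap ℚ (v.adicCompletion K) x‖ ≤ 1 := by
  have h : ¬ residueChar v ∣ x.den := by
    rw [Padic.norm_rat_le_one_iff_padicValuation_le_one, Rat.padicValuation_le_one_iff] at hx
    exact hx
  rw [← Rat.num_div_den x, map_div₀, norm_div, map_natCast, norm_natCast_eq_one v h, div_one,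
    map_intCast]
  obtain ⟨n, h | h⟩ := Int.eq_nat_or_neg x.num <;> rw [h] <;>
    simpa using norm_natCast_le_one v n

/-- The inclusion `ℚ → K_v` is continuous for the `p`-adic topology on `ℚ`. -/
theorem continuous_ratHom : Continuous ((algebraMap ℚ (v.adicCompletion K)).comp
    (WithVal.equiv (Rat.padicValuation (residueChar v))).toRingHom) := by
  refine continuous_of_continuousAt_zero _ ?_
  rw [ContinuousAt, map_zero,
    (Padic.isUniformInducing_cast_withVal (p := residueChar v)).isInducing.nhds_eq_comap, map_zero,
    (Metric.nhds_basis_closedBall.comap _).tendsto_iff Metric.nhds_basis_ball]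
  intro ε hε
  obtain ⟨n, hn⟩ := exists_pow_lt_of_lt_one hε (norm_residueChar_lt_one v)
  have hp : (0 : ℝ) < residueChar v := by exact_mod_cast (residueChar_prime v).out.pos
  have hp0 : (residueChar v : ℚ) ≠ 0 := by exact_mod_cast (residueChar_prime v).out.ne_zero
  refine ⟨((residueChar v : ℝ) ^ n)⁻¹, by positivity, fun x hx ↦ ?_⟩
  set y : ℚ := WithVal.equiv _ x with hy
  have hx' : ‖(y : ℚ_[residueChar v])‖ ≤ ((residueChar v : ℝ) ^ n)⁻¹ := by simpa [hy] using hx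
  have h1 := norm_algebraMap_le_one v (x := y / (residueChar v : ℚ) ^ n) (by
    push_cast
    rw [norm_div, norm_pow, Padic.norm_p, inv_pow]
    exact div_le_one_of_le₀ hx' (by positivity))
  have h2 : algebraMap ℚ (v.adicCompletion K) y = algebraMap ℚ (v.adicCompletion K)
      (y / (residueChar v : ℚ) ^ n) * (residueChar v : v.adicCompletion K) ^ n := by
    rw [← map_natCast (algebraMap ℚ (v.adicCompletion K)), ← map_pow, ← map_mul,
      div_mul_cancel₀ _ (pow_ne_zero _ hp0)]
  have : ‖algebraMap ℚ (v.adicCompletion K) y‖ < ε := by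
    rw [h2, norm_mul, norm_pow]
    calc _ ≤ 1 * ‖(residueChar v : v.adicCompletion K)‖ ^ n := by gcongr
      _ < ε := by simpa using hn
  simpa [hy] using this

/-- The canonical (continuous) embedding `ℚ_p → K_v`, the continuous extension of `ℚ → K_v`. -/
def padicEmbedding : ℚ_[residueChar v] →+* v.adicCompletion K :=
  (UniformSpace.Completion.extensionHom _ (continuous_ratHom v)).comp
    (Padic.withValRingEquiv (p := residueChar v)).symm.toRingHom

theorem continuous_padicEmbedding : Continuous (padicEmbedding v) :=
  UniformSpace.Completion.continuous_extension.comp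
    (Padic.withValUniformEquiv (p := residueChar v)).symm.continuous

/-- `K_v` as a (finite) extension of `ℚ_p`. -/
instance padicAlgebra : Algebra ℚ_[residueChar v] (v.adicCompletion K) :=
  (padicEmbedding v).toAlgebra

/-- The trace `Tr : K_v → ℚ_p`. -/
def localTrace (x : v.adicCompletion K) : ℚ_[residueChar v] :=
  Algebra.trace ℚ_[residueChar v] (v.adicCompletion K) x

/-- `x * p ^ n` is a `p`-adic integer as soon as `n ≥ -ord_p x`. -/
theorem norm_mul_pow_le_one {p : ℕ} [Fact p.Prime] (x : ℚ_[p]) :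
    ‖x * (p : ℚ_[p]) ^ (-x.valuation).toNat‖ ≤ 1 := by
  rcases eq_or_ne x 0 with rfl | hx
  · simp
  have hp : (1 : ℝ) < p := by exact_mod_cast (Fact.out : p.Prime).one_lt
  rw [norm_mul, norm_pow, Padic.norm_p, Padic.norm_eq_zpow_neg_valuation hx, inv_pow,
    ← zpow_natCast, ← zpow_neg, ← zpow_add₀ (by positivity)]
  refine (zpow_le_one_iff_right₀ hp).2 ?_
  have := Int.self_le_toNat (-x.valuation)
  omega

/-- The fractional part `{x}` of `x ∈ ℚ_p`: the unique `r ∈ ℤ[1/p] ∩ [0, 1)` with `x - r ∈ ℤ_p`.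
With `n = max (0, -ord_p x)` it is `m / p ^ n` where `0 ≤ m < p ^ n`, `m ≡ p ^ n x mod p ^ n`. -/
def padicFract {p : ℕ} [Fact p.Prime] (x : ℚ_[p]) : ℚ :=
  let n : ℕ := (-x.valuation).toNat
  (PadicInt.appr ⟨x * (p : ℚ_[p]) ^ n, norm_mul_pow_le_one x⟩ n : ℚ) / (p : ℚ) ^ n

theorem padicFract_nonneg {p : ℕ} [Fact p.Prime] (x : ℚ_[p]) : 0 ≤ padicFract x := by
  unfold padicFract; positivity

theorem padicFract_lt_one {p : ℕ} [Fact p.Prime] (x : ℚ_[p]) : padicFract x < 1 := by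
  have hp : (0 : ℚ) < p := by exact_mod_cast (Fact.out : p.Prime).pos
  unfold padicFract
  rw [div_lt_one (by positivity)]
  exact_mod_cast PadicInt.appr_lt _ _

theorem norm_sub_padicFract_le_one {p : ℕ} [Fact p.Prime] (x : ℚ_[p]) :
    ‖x - (padicFract x : ℚ_[p])‖ ≤ 1 := by
  have hp : (p : ℚ_[p]) ≠ 0 := by exact_mod_cast (Fact.out : p.Prime).ne_zero
  have hp' : (0 : ℝ) < p := by exact_mod_cast (Fact.out : p.Prime).pos
  set n : ℕ := (-x.valuation).toNat with hn
  set y : ℤ_[p] := ⟨x * (p : ℚ_[p]) ^ n, norm_mul_pow_le_one x⟩ with hy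
  have h := (PadicInt.norm_le_pow_iff_mem_span_pow _ n).2 (PadicInt.appr_spec n y)
  have e : x - (padicFract x : ℚ_[p]) =
      ((y - (y.appr n : ℤ_[p]) : ℤ_[p]) : ℚ_[p]) / (p : ℚ_[p]) ^ n := by
    have : (padicFract x : ℚ_[p]) = (y.appr n : ℚ_[p]) / (p : ℚ_[p]) ^ n := by
      unfold padicFract; push_cast; rfl
    rw [this, eq_div_iff (pow_ne_zero _ hp), sub_mul, div_mul_cancel₀ _ (pow_ne_zero _ hp)]
    push_cast
    rfl
  rw [e, norm_div, norm_pow, Padic.norm_p, inv_pow]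
  refine div_le_one_of_le₀ ?_ (by positivity)
  rw [← zpow_natCast, ← zpow_neg]
  exact h

/-- The additive character `λ(x) = exp(2πi {Tr x})` of `K_v`. -/
def addChar (x : v.adicCompletion K) : ℂ :=
  Complex.exp (2 * Real.pi * Complex.I * (padicFract (localTrace v x) : ℂ))

/-- `q`, the cardinality of the residue field of `v`. The norm of `K_v` is normalised so that a
uniformiser has norm `q⁻¹`; it is the module `|x|` of `K_v`. -/
def resCard : ℕ := Ideal.absNorm v.asIdeal

/-- The integers `d` such that `Tr x ∈ ℤ_p` for every `x ∈ π⁻ᵈ 𝓞`, i.e. for every `x` with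
`|x| ≤ q ^ d`. -/
def traceIntegralExponents : Set ℤ :=
  {d | ∀ x : v.adicCompletion K, ‖x‖ ≤ (resCard v : ℝ) ^ d → ‖localTrace v x‖ ≤ 1}

/-- The differential exponent `δ`: the largest integer `d` such that `Tr (π⁻ᵈ 𝓞) ⊆ ℤ_p`. -/
def diffExponent : ℤ := sSup (traceIntegralExponents v)

/-! ### Characters of `K_vˣ` and their conductor exponents -/

/-- A unitary character of `K_vˣ` is ramified if it is not trivial on `|u| = 1`. -/
def IsRamified (χ : (v.adicCompletion K)ˣ →ₜ* Circle) : Prop :=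
  ∃ u : (v.adicCompletion K)ˣ, ‖(u : v.adicCompletion K)‖ = 1 ∧ χ u ≠ 1

/-- The ramified unitary character `χ` has conductor exponent `f`: `f` is the smallest positive
integer such that `|1 - u| ≤ q⁻ᶠ` implies `χ u = 1`. -/
def HasConductorExponent (χ : (v.adicCompletion K)ˣ →ₜ* Circle) (f : ℕ) : Prop :=
  IsRamified v χ ∧
    IsLeast {m : ℕ | 1 ≤ m ∧ ∀ u : (v.adicCompletion K)ˣ,
      ‖1 - (u : v.adicCompletion K)‖ ≤ ((resCard v : ℝ) ^ m)⁻¹ → χ u = 1} f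

/-- A character of `K_vˣ` as a function on `K_v` (the value at `0` is irrelevant). -/
def charFun (χ : (v.adicCompletion K)ˣ →ₜ* Circle) (x : v.adicCompletion K) : ℂ :=
  open scoped Classical in if h : x = 0 then 0 else (χ (Units.mk0 x h) : ℂ)

end Place

/-! ### The Hilbert space `L²(K_v, dx)` and the unitary operators acting on it -/

section Operators

variable {K : Type*} [Field K] [NumberField K] (v : HeightOneSpectrum (𝓞 K))
  [MeasurableSpace (v.adicCompletion K)] (μ : Measure (v.adicCompletion K))

/-- The Fourier integral `y ↦ ∫ φ(x) λ(xy) dx`. -/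
def fourierIntegral (φ : v.adicCompletion K → ℂ) (y : v.adicCompletion K) : ℂ :=
  ∫ x, φ x * addChar v (x * y) ∂μ

/-- The measure `dx = μ` is self-dual for `λ`: Fourier inversion `𝓕 (𝓕 φ) (x) = φ (-x)` holds for
every locally constant compactly supported `φ`. -/
def IsSelfDual : Prop :=
  ∀ φ : v.adicCompletion K → ℂ, IsLocallyConstant φ → HasCompactSupport φ →
    ∀ x, fourierIntegral v μ (fourierIntegral v μ φ) x = φ (-x)

/-- The Hilbert space `L²(K_v, dx)`. -/
abbrev L2 : Type _ := Lp ℂ 2 μ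

/-- The unitary operator `U` is the Fourier transform: it is given by the Fourier integral on
`L¹ ∩ L²`. -/
def IsFourierTransform (U : L2 v μ ≃ₗᵢ[ℂ] L2 v μ) : Prop :=
  ∀ φ : L2 v μ, Integrable φ μ → U φ =ᵐ[μ] fourierIntegral v μ φ

/-- The unitary operator `U` is the inversion `φ(x) ↦ |x|⁻¹ φ(1/x)`. -/
def IsInversion (U : L2 v μ ≃ₗᵢ[ℂ] L2 v μ) : Prop :=
  ∀ φ : L2 v μ, U φ =ᵐ[μ] fun x ↦ ((‖x‖⁻¹ : ℝ) : ℂ) * φ x⁻¹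

/-- The unitary operators `U u`, `u ∈ K_vˣ`, are the rotations and dilations
`φ(x) ↦ |u|^{1/2} φ(ux)`. -/
def IsDilation (U : (v.adicCompletion K)ˣ → (L2 v μ ≃ₗᵢ[ℂ] L2 v μ)) : Prop :=
  ∀ (u : (v.adicCompletion K)ˣ) (φ : L2 v μ),
    U u φ =ᵐ[μ] fun x ↦ (√‖(u : v.adicCompletion K)‖ : ℂ) * φ (u * x)

variable {v μ} in
/-- The function `u ↦ R(u) φ` on `K_v` (the value at `u = 0` is irrelevant). -/
def orbit (R : (v.adicCompletion K)ˣ → (L2 v μ ≃ₗᵢ[ℂ] L2 v μ)) (φ : L2 v μ)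
    (u : v.adicCompletion K) : L2 v μ :=
  open scoped Classical in if h : u = 0 then 0 else R (Units.mk0 u h) φ

/-- The cuspidal subspace `L₀`: the null space of the averaging operator `∫_{|u| = 1} R(u) d*u` (a
Bochner integral in `L²`). On `|u| = 1` the multiplicative Haar measure `d*u` is a constant multiple
of the additive one. -/
def cuspidal (R : (v.adicCompletion K)ˣ → (L2 v μ ≃ₗᵢ[ℂ] L2 v μ)) : Submodule ℂ (L2 v μ) where
  carrier := {φ | IntegrableOn (orbit R φ) (Metric.sphere 0 1) μ ∧
    ∫ u in Metric.sphere 0 1, orbit R φ u ∂μ = 0}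
  zero_mem' := by
    have : orbit R (0 : L2 v μ) = 0 := by ext1 u; unfold orbit; split_ifs <;> simp
    simp only [Set.mem_ofPred_eq, this]
    exact ⟨integrableOn_zero, by simp⟩
  add_mem' := by
    rintro φ ψ ⟨h1, h2⟩ ⟨h3, h4⟩
    have : orbit R (φ + ψ) = orbit R φ + orbit R ψ := by
      ext1 u; simp only [Pi.add_apply]; unfold orbit; split_ifs <;> simp
    refine ⟨by rw [this]; exact h1.add h3, ?_⟩
    rw [this]
    simp only [Pi.add_apply]
    rw [integral_add h1 h3, h2, h4, add_zero]
  smul_mem' := by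
    rintro c φ ⟨h1, h2⟩
    have : orbit R (c • φ) = c • orbit R φ := by
      ext1 u; simp only [Pi.smul_apply]; unfold orbit; split_ifs <;> simp
    refine ⟨by rw [this]; exact h1.smul c, ?_⟩
    rw [this]
    simp only [Pi.smul_apply]
    rw [integral_smul, h2, smul_zero]

/-- `L₀` is closed, hence a Hilbert space. -/
theorem isClosed_cuspidal [BorelSpace (v.adicCompletion K)]
    (R : (v.adicCompletion K)ˣ → (L2 v μ ≃ₗᵢ[ℂ] L2 v μ)) :
    IsClosed (cuspidal v μ R : Set (L2 v μ)) := by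
  have hS : MeasurableSet (Metric.sphere (0 : v.adicCompletion K) 1) :=
    Metric.isClosed_sphere.measurableSet
  have hn : ∀ φ : L2 v μ, ∀ u ∈ Metric.sphere (0 : v.adicCompletion K) 1, ‖orbit R φ u‖ = ‖φ‖ := by
    intro φ u hu
    have hu0 : u ≠ 0 := by rintro rfl; simp at hu
    simp [orbit, hu0]
  have hd : ∀ φ ψ : L2 v μ, ∀ u, orbit R φ u - orbit R ψ u = orbit R (φ - ψ) u := by
    intro φ ψ u; unfold orbit; split_ifs <;> simp
  refine IsSeqClosed.isClosed fun φ ψ hφ hψ ↦ ?_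
  rcases eq_or_ne ψ 0 with rfl | hψ0
  · exact (cuspidal v μ R).zero_mem
  obtain ⟨n, hn0⟩ := (hψ.eventually_ne hψ0).exists
  have hfin : μ (Metric.sphere 0 1) < ∞ := by
    have h1 : IntegrableOn (fun _ ↦ ‖φ n‖) (Metric.sphere 0 1) μ :=
      IntegrableOn.congr_fun (hφ n).1.norm (fun u hu ↦ hn _ u hu) hS
    rw [integrableOn_const_iff (by simp)] at h1
    simpa [hn0] using h1
  have : IsFiniteMeasure (μ.restrict (Metric.sphere 0 1)) := ⟨by simpa using hfin⟩
  have hlim : Filter.Tendsto (fun k ↦ ‖φ k - ψ‖) Filter.atTop (nhds 0) :=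
    tendsto_iff_norm_sub_tendsto_zero.1 hψ
  have hmeas : AEStronglyMeasurable (orbit R ψ) (μ.restrict (Metric.sphere 0 1)) := by
    refine aestronglyMeasurable_of_tendsto_ae Filter.atTop (fun k ↦ (hφ k).1.1) ?_
    filter_upwards [ae_restrict_mem hS] with u hu
    rw [tendsto_iff_norm_sub_tendsto_zero]
    simpa [hd, hn _ u hu] using hlim
  have hint : IntegrableOn (orbit R ψ) (Metric.sphere 0 1) μ := by
    refine Integrable.of_bound hmeas ‖ψ‖ ?_
    filter_upwards [ae_restrict_mem hS] with u hu using (hn _ u hu).le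
  refine ⟨hint, ?_⟩
  have hb : ∀ k, ‖∫ u in Metric.sphere 0 1, orbit R ψ u ∂μ‖ ≤
      ‖φ k - ψ‖ * μ.real (Metric.sphere 0 1) := by
    intro k
    rw [← sub_zero (∫ u in Metric.sphere 0 1, orbit R ψ u ∂μ), ← (hφ k).2,
      ← integral_sub hint (hφ k).1, norm_sub_rev (φ k)]
    refine norm_setIntegral_le_of_norm_le_const hfin fun u hu ↦ ?_
    rw [hd, hn _ u hu]
  have h0 : Filter.Tendsto (fun k ↦ ‖φ k - ψ‖ * μ.real (Metric.sphere 0 1)) Filter.atTop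
      (nhds 0) := by simpa using hlim.mul_const (μ.real (Metric.sphere 0 1))
  exact norm_le_zero_iff.1 (ge_of_tendsto' h0 hb)

instance completeSpace_cuspidal [BorelSpace (v.adicCompletion K)]
    (R : (v.adicCompletion K)ˣ → (L2 v μ ≃ₗᵢ[ℂ] L2 v μ)) : CompleteSpace (cuspidal v μ R) :=
  (isClosed_cuspidal v μ R).completeSpace_coe

end Operators

/-! ### Unbounded operators -/

section Unbounded

variable {E : Type*} [NormedAddCommGroup E] [InnerProductSpace ℂ E]

/-- For an unbounded operator `T` on a subspace `S` of `E` and a unitary operator `U` of `E`, the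
operator `U T U⁻¹` on `S`: its graph consists of the pairs `(U x, U (T x))` in `S × S`. -/
def conj {S : Submodule ℂ E} (U : E ≃ₗᵢ[ℂ] E) (T : S →ₗ.[ℂ] S) : S →ₗ.[ℂ] S :=
  Submodule.toLinearPMap
    { carrier := {p | ∃ a ∈ T.graph, U a.1 = p.1 ∧ U a.2 = p.2}
      zero_mem' := ⟨0, T.graph.zero_mem, by simp⟩
      add_mem' := by
        rintro p p' ⟨a, ha, h1, h2⟩ ⟨a', ha', h1', h2'⟩
        exact ⟨a + a', T.graph.add_mem ha ha', by simp [h1, h1'], by simp [h2, h2']⟩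
      smul_mem' := by
        rintro c p ⟨a, ha, h1, h2⟩
        exact ⟨c • a, T.graph.smul_mem c ha, by simp [h1], by simp [h2]⟩ }

/-- The unbounded operator `T` on the subspace `S` commutes with the unitary operator `U`: `U`
restricts to a unitary operator of `S` and `U T U⁻¹ = T` (with equality of domains). -/
def CommutesWithUnitary {S : Submodule ℂ E} (T : S →ₗ.[ℂ] S) (U : E ≃ₗᵢ[ℂ] E) : Prop :=
  S.map (U.toLinearEquiv : E →ₗ[ℂ] E) = S ∧ conj U T = T

/-- The bounded operator `Q` is the resolvent `(z - T)⁻¹`. -/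
def IsResolventAt (T : E →ₗ.[ℂ] E) (z : ℂ) (Q : E →L[ℂ] E) : Prop :=
  (∀ y : E, ∃ x : T.domain, (x : E) = Q y ∧ z • (x : E) - T x = y) ∧
    ∀ x : T.domain, Q (z • (x : E) - T x) = x

/-- The spectrum of an unbounded operator: the `z` for which `z - T` has no bounded inverse. -/
def unboundedSpectrum (T : E →ₗ.[ℂ] E) : Set ℂ :=
  {z | ¬ ∃ Q : E →L[ℂ] E, IsResolventAt T z Q}

/-- The eigenspace `{x ∈ D(T) | T x = z x}`. -/
def unboundedEigenspace (T : E →ₗ.[ℂ] E) (z : ℂ) : Submodule ℂ E where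
  carrier := {x | ∃ y : T.domain, (y : E) = x ∧ T y = z • x}
  zero_mem' := ⟨0, by simp⟩
  add_mem' := by
    rintro _ _ ⟨y, rfl, h⟩ ⟨y', rfl, h'⟩
    exact ⟨y + y', by simp, by rw [LinearPMap.map_add, h, h', smul_add]⟩
  smul_mem' := by
    rintro c _ ⟨y, rfl, h⟩
    exact ⟨c • y, by simp, by rw [LinearPMap.map_smul, h, smul_comm]⟩

/-- The unbounded (self-adjoint) operators `S` and `T` commute: all their resolvents commute, and
`S T x` and `T S x` are both defined and equal for all `x` in a dense subspace. -/
def UnboundedCommute (S T : E →ₗ.[ℂ] E) : Prop :=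
  (∀ (z w : ℂ) (P Q : E →L[ℂ] E), IsResolventAt S z P → IsResolventAt T w Q →
    P ∘L Q = Q ∘L P) ∧
  ∃ D : Submodule ℂ E, Dense (D : Set E) ∧ ∀ x ∈ D,
    ∃ (a : S.domain) (b : T.domain) (c : T.domain) (d : S.domain),
      (a : E) = x ∧ (b : E) = x ∧ (c : E) = S a ∧ (d : E) = T b ∧ S d = T c

end Unbounded

/-! ### The conductor operator -/

section Conductor

variable {K : Type*} [Field K] [NumberField K] {v : HeightOneSpectrum (𝓞 K)}
  [MeasurableSpace (v.adicCompletion K)] {μ : Measure (v.adicCompletion K)}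

/-- The operator `A` of multiplication by `log |x|` on a subspace `S` of `L²`, with domain the `φ`
in `S` such that `log |x| φ` is in `S`. -/
def opA (S : Submodule ℂ (L2 v μ)) : S →ₗ.[ℂ] S :=
  Submodule.toLinearPMap
    { carrier := {p | (p.2 : L2 v μ) =ᵐ[μ] fun x ↦ (Real.log ‖x‖ : ℂ) * (p.1 : L2 v μ) x}
      zero_mem' := by
        filter_upwards [Lp.coeFn_zero ℂ 2 μ] with x hx
        simp only [Prod.fst_zero, Prod.snd_zero, Submodule.coe_zero]
        rw [hx, Pi.zero_apply, mul_zero]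
      add_mem' := by
        intro p p' h h'
        filter_upwards [h, h', Lp.coeFn_add (p.1 : L2 v μ) p'.1,
          Lp.coeFn_add (p.2 : L2 v μ) p'.2] with x h1 h2 h3 h4
        simp only [Prod.fst_add, Prod.snd_add, Submodule.coe_add, h3, h4, Pi.add_apply, h1, h2]
        ring
      smul_mem' := by
        intro c p h
        filter_upwards [h, Lp.coeFn_smul c (p.1 : L2 v μ),
          Lp.coeFn_smul c (p.2 : L2 v μ)] with x h1 h3 h4
        simp only [Prod.smul_fst, Prod.smul_snd, Submodule.coe_smul, h3, h4, Pi.smul_apply, h1,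
          smul_eq_mul]
        ring }

/-- The operator `B = 𝓕 A 𝓕⁻¹`. -/
def opB (F : L2 v μ ≃ₗᵢ[ℂ] L2 v μ) (S : Submodule ℂ (L2 v μ)) : S →ₗ.[ℂ] S :=
  conj F (opA S)

/-- The conductor operator `H = A + 𝓕 A 𝓕⁻¹`: the closure of the sum of `A` and `B` on
`D(A) ∩ D(B)`. -/
def conductorOp (F : L2 v μ ≃ₗᵢ[ℂ] L2 v μ) (S : Submodule ℂ (L2 v μ)) : S →ₗ.[ℂ] S :=
  (opA S + opB F S).closure

variable (v μ) in
/-- The functions `g(|x|) χ(x)` in `L²`, where `g` has compact support in `(0, ∞)` and `χ` is a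
unitary character of conductor exponent `f`. -/
def conductorFunctions (f : ℕ) : Set (L2 v μ) :=
  {φ | ∃ (g : ℝ → ℂ) (χ : (v.adicCompletion K)ˣ →ₜ* Circle), HasCompactSupport g ∧
    tsupport g ⊆ Set.Ioi 0 ∧ HasConductorExponent v χ f ∧
    φ =ᵐ[μ] fun x ↦ g ‖x‖ * charFun v χ x}

variable (v) in
/-- The smallest conductor exponent of a ramified character: `2` if `q = 2`, and `1` otherwise. -/
def minExponent : ℕ := if resCard v = 2 then 2 else 1

variable (v) in
/-- The real number `(f + δ) log q`. -/
def conductorValue (f : ℕ) : ℝ := (f + diffExponent v) * Real.log (resCard v)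

end Conductor

end

end ConductorOperator

set_option linter.unusedSectionVars false

namespace ConductorOperator

noncomputable section

/-! The operators A, B and H are diagonal in one common decomposition of L₀. For f ≥ 1 and an
integer j, let V(f, j) (`levelSpace`) consist of the functions supported on the sphere |x| = q^j
that are invariant under translation by the ball of radius q^(j-f) and whose averages over all balls
of the next radius q^(j-f+1) vanish. Different V(f, j) are orthogonal. They are total in L₀:
cuspidality means that the integral over every sphere vanishes (`integral_unitOrbit_eq_zero_iff`),
and orthogonality to all levels on a sphere carries this vanishing from the sphere down to ever
smaller balls (`ae_eq_zero_of_orthogonal_levelSpace`).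

On V(f, j) the operator A is the scalar j log q. The Fourier transform exchanges conditions of
support and of invariance, a radius r corresponding to q^δ / r, and so maps V(f, j) onto V(f, f+δ-j)
(`IsLevel.fourierInt`, `map_levelSpace_fourier`). Hence B is the scalar (f+δ-j) log q on V(f, j),
and the sum of the two is (f+δ) log q, in which j has cancelled. In a Hilbert basis adapted to the
V(f, j), both A and B are maximal diagonal operators, and the closure of their sum is the maximal
diagonal operator with the added eigenvalues (`closure_add_diagOp`). Self-adjointness, positivity
(as δ ≥ 0), commutation and spectrum are then facts about real sequences. The inversion sends V(f,
j) to V(f, -j), and R(u) with |u| = q^m sends it to V(f, j-m); like the Fourier transform they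
preserve f, so all of them commute with H.

The characters enter at the end: V(f, j) is spanned by the restrictions to the sphere of the
characters of conductor exponent f (`HasConductor.isLevel_sphereFun`, `levelSpace_le_span`), by
duality for a finite quotient of the multiplicative group. The spaces V(f, j) are nonzero except
when f = 1 and q = 2: then the sphere is a single ball of radius q^(j-1), and the two conditions
contradict each other. This accounts for f₀.

The unitary operators themselves come from computations with balls: inversion and dilations are
weighted compositions whose Jacobian is checked on balls that miss 0, and the Fourier transform
exists because indicators of balls and their transforms have the same Gram matrix
(`existsUnique_isFourier`). -/

theorem norm_sub_le_max_ultra {G : Type*} [SeminormedAddCommGroup G] [IsUltrametricDist G]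
    (x y : G) :
    ‖x - y‖ ≤ max ‖x‖ ‖y‖ := by
  simpa [sub_eq_add_neg] using IsUltrametricDist.norm_add_le_max x (-y)

theorem toNNReal_exp {e : NNReal} (he : e ≠ 0) (n : ℤ) :
    WithZeroMulInt.toNNReal he (WithZero.exp n) = e ^ n := by
  rw [WithZeroMulInt.toNNReal_neg_apply _ WithZero.exp_ne_zero]
  rfl

/-! ### Normalized local fields -/

/-- A nonarchimedean normed field whose residue field has `q` elements, with discrete value group
generated by `q`. -/
class NormalizedLocalField (k : Type*) [NormedField k] (q : outParam ℕ) : Prop where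
  one_lt_card : 1 < q
  norm_eq_zpow : ∀ x : k, x ≠ 0 → ∃ n : ℤ, ‖x‖ = (q : ℝ) ^ n
  exists_uniformizer : ∃ ϖ : k, ‖ϖ‖ = (q : ℝ)⁻¹
  exists_residues : ∃ s : Finset k, s.card = q ∧ (∀ x ∈ s, ‖x‖ ≤ 1) ∧
    (∀ x ∈ s, ∀ y ∈ s, ‖x - y‖ < 1 → x = y) ∧ ∀ x : k, ‖x‖ ≤ 1 → ∃ r ∈ s, ‖x - r‖ < 1

section LocalField

open Metric

variable {k : Type*} [NormedField k] {q : ℕ} [NormalizedLocalField k q]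

theorem one_lt_q (k : Type*) [NormedField k] {q : ℕ} [NormalizedLocalField k q] : (1 : ℝ) < q := by
  exact_mod_cast NormalizedLocalField.one_lt_card (k := k)

theorem q_pos (k : Type*) [NormedField k] {q : ℕ} [NormalizedLocalField k q] : (0 : ℝ) < q :=
    zero_lt_one.trans (one_lt_q k)

theorem q_ne_zero (k : Type*) [NormedField k] {q : ℕ} [NormalizedLocalField k q] : (q : ℝ) ≠ 0 :=
    (q_pos k).ne'

theorem zpow_q_pos (k : Type*) [NormedField k] {q : ℕ} [NormalizedLocalField k q] (n : ℤ) :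
    (0 : ℝ) < (q : ℝ) ^ n := zpow_pos (q_pos k) n

theorem zpow_q_le_iff (k : Type*) [NormedField k] {q : ℕ} [NormalizedLocalField k q] {m n : ℤ} :
    (q : ℝ) ^ m ≤ (q : ℝ) ^ n ↔ m ≤ n :=
  zpow_le_zpow_iff_right₀ (one_lt_q k)

theorem zpow_q_lt_iff (k : Type*) [NormedField k] {q : ℕ} [NormalizedLocalField k q] {m n : ℤ} :
    (q : ℝ) ^ m < (q : ℝ) ^ n ↔ m < n :=
  zpow_lt_zpow_iff_right₀ (one_lt_q k)

theorem zpow_q_inj (k : Type*) [NormedField k] {q : ℕ} [NormalizedLocalField k q] {m n : ℤ} :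
    (q : ℝ) ^ m = (q : ℝ) ^ n ↔ m = n :=
  zpow_right_inj₀ (q_pos k) (one_lt_q k).ne'

theorem exists_norm_eq_zpow (k : Type*) [NormedField k] {q : ℕ} [NormalizedLocalField k q]
    (n : ℤ) : ∃ x : k, ‖x‖ = (q : ℝ) ^ n := by
  obtain ⟨ϖ, h⟩ := NormalizedLocalField.exists_uniformizer (k := k)
  exact ⟨ϖ ^ (-n), by rw [norm_zpow, h, inv_zpow, zpow_neg, inv_inv]⟩

theorem norm_lt_zpow_iff (x : k) (n : ℤ) : ‖x‖ < (q : ℝ) ^ n ↔ ‖x‖ ≤ (q : ℝ) ^ (n - 1) := by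
  rcases eq_or_ne x 0 with rfl | hx
  · simp [zpow_q_pos k, (zpow_q_pos k _).le]
  · obtain ⟨m, hm⟩ := NormalizedLocalField.norm_eq_zpow x hx
    rw [hm, zpow_q_lt_iff k, zpow_q_le_iff k]; lia

theorem exists_zpow_lt (k : Type*) [NormedField k] {q : ℕ} [NormalizedLocalField k q] {ε : ℝ}
    (hε : 0 < ε) : ∃ m : ℕ, (q : ℝ) ^ (-m : ℤ) < ε := by
  obtain ⟨n, hn⟩ := exists_pow_lt_of_lt_one hε (inv_lt_one_of_one_lt₀ (one_lt_q k))
  exact ⟨n, by rwa [zpow_neg, zpow_natCast, ← inv_pow]⟩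

theorem exists_lt_zpow (k : Type*) [NormedField k] {q : ℕ} [NormalizedLocalField k q] (r : ℝ) :
    ∃ m : ℕ, r < (q : ℝ) ^ (m : ℤ) := by
  obtain ⟨n, hn⟩ := pow_unbounded_of_one_lt r (one_lt_q k)
  exact ⟨n, by rwa [zpow_natCast]⟩

/-- The residue classes of the unit ball, rescaled by an element of norm q^n and translated. -/
theorem exists_finset_cover (a : k) (n : ℤ) :
    ∃ s : Finset k, closedBall a ((q : ℝ) ^ n) ⊆ ⋃ b ∈ s, closedBall b ((q : ℝ) ^ (n - 1)) := by
  classical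
  obtain ⟨s, -, -, -, hs⟩ := NormalizedLocalField.exists_residues (k := k)
  obtain ⟨c, hc⟩ := exists_norm_eq_zpow k n
  have hc0 : c ≠ 0 := by rw [← norm_pos_iff, hc]; exact zpow_q_pos k n
  refine ⟨s.image fun r ↦ a + c * r, fun x hx ↦ ?_⟩
  rw [mem_closedBall, dist_eq_norm] at hx
  obtain ⟨r, hr, hxr⟩ := hs ((x - a) / c) (by
    rw [norm_div, hc]; exact div_le_one_of_le₀ hx (zpow_q_pos k n).le)
  simp only [Finset.mem_image, Set.mem_iUnion, exists_prop, exists_exists_and_eq_and]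
  refine ⟨r, hr, ?_⟩
  rw [mem_closedBall, dist_eq_norm, ← norm_lt_zpow_iff]
  have : x - (a + c * r) = c * ((x - a) / c - r) := by field_simp; ring
  rw [this, norm_mul, hc]
  exact mul_lt_of_lt_one_right (zpow_q_pos k n) hxr

theorem exists_finset_cover_of_le (a : k) (n : ℤ) (m : ℕ) :
    ∃ s : Finset k, closedBall a ((q : ℝ) ^ n) ⊆ ⋃ b ∈ s, closedBall b ((q : ℝ) ^ (n - m)) := by
  classical
  induction m with
  | zero => exact ⟨{a}, by simp⟩
  | succ m ih =>
    obtain ⟨s, hs⟩ := ih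
    choose t ht using fun b : k ↦ exists_finset_cover b (n - m)
    refine ⟨s.biUnion t, fun x hx ↦ ?_⟩
    obtain ⟨b, hb, hxb⟩ := Set.mem_iUnion₂.1 (hs hx)
    obtain ⟨c, hc, hxc⟩ := Set.mem_iUnion₂.1 (ht b hxb)
    refine Set.mem_iUnion₂.2 ⟨c, Finset.mem_biUnion.2 ⟨b, hb, hc⟩, ?_⟩
    convert hxc using 3
    push_cast; ring

/-- Iterating the finite covers makes every ball totally bounded, and completeness does the rest. -/
theorem properSpace_of_normalizedLocalField {k : Type*} [NormedField k] {q : ℕ}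
    [NormalizedLocalField k q] [CompleteSpace k] : ProperSpace k := by
  refine .of_isCompact_closedBall_of_le 0 fun a r _ ↦ ?_
  obtain ⟨n, hn⟩ := exists_lt_zpow k r
  have : IsCompact (closedBall a ((q : ℝ) ^ (n : ℤ))) := by
    refine isCompact_iff_totallyBounded_isComplete.2 ⟨?_, isClosed_closedBall.isComplete⟩
    refine Metric.totallyBounded_iff.2 fun ε hε ↦ ?_
    obtain ⟨m, hm⟩ := exists_zpow_lt k hε
    obtain ⟨s, hs⟩ := exists_finset_cover_of_le a (n : ℤ) (n + m)
    refine ⟨s, s.finite_toSet, hs.trans (Set.iUnion₂_mono fun b _ ↦ ?_)⟩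
    refine closedBall_subset_ball ?_
    convert hm using 2
    push_cast; ring
  exact this.of_isClosed_subset isClosed_closedBall (closedBall_subset_closedBall hn.le)

end LocalField

/-! ### The completion of a number field at a finite place -/

section Place

variable {K : Type*} [Field K] [NumberField K] (v : HeightOneSpectrum (𝓞 K))

theorem one_lt_resCard : (1 : ℝ) < resCard v := by
  exact_mod_cast HeightOneSpectrum.one_lt_absNorm v

theorem exists_norm_sub_embedding_lt {x : v.adicCompletion K} (hx : ‖x‖ ≤ 1) {ε : ℝ} (hε : 0 < ε) :
    ∃ a : 𝓞 K, ‖x - FinitePlace.embedding v (algebraMap (𝓞 K) K a)‖ < ε := by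
  -- Distance less than 1 forces the approximant y into the unit ball, so that it is v-integral and
  -- can itself be approximated by elements of 𝓞 K.
  obtain ⟨y, hy⟩ := (HeightOneSpectrum.denseRange_algebraMap K v).exists_dist_lt x
    (lt_min hε one_pos)
  rw [dist_eq_norm] at hy
  have he : algebraMap K (v.adicCompletion K) y = FinitePlace.embedding v y := rfl
  rw [he] at hy
  have hy1 : ‖FinitePlace.embedding v y‖ ≤ 1 := by
    have h := norm_sub_le_max_ultra x (x - FinitePlace.embedding v y)
    rw [sub_sub_cancel] at h
    exact h.trans (max_le hx (hy.le.trans (min_le_right _ _)))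
  obtain ⟨n, hn⟩ := exists_pow_lt_of_lt_one hε (inv_lt_one_of_one_lt₀ (one_lt_resCard v))
  have hv : v.valuation K y ≤ 1 := by
    rw [FinitePlace.embedding_apply, Valued.toNormedField.norm_le_one_iff] at hy1
    simpa using hy1
  obtain ⟨a, ha⟩ := v.exists_valuation_sub_lt_of_integer hv
    (Units.mk0 (WithZero.exp (-(n : ℤ))) WithZero.exp_ne_zero)
  refine ⟨a, ?_⟩
  have hle : ‖FinitePlace.embedding v (algebraMap (𝓞 K) K a - y)‖ < ε := by
    refine lt_of_le_of_lt ?_ hn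
    rw [FinitePlace.norm_embedding']
    have h2 :=
    (WithZeroMulInt.toNNReal_strictMono (HeightOneSpectrum.one_lt_absNorm_nnreal v)).monotone ha.le
    have h3 := NNReal.coe_le_coe.2 h2
    refine h3.trans (le_of_eq ?_)
    rw [Units.val_mk0, toNNReal_exp]
    simp [resCard]
  have : x - FinitePlace.embedding v (algebraMap (𝓞 K) K a) = (x - FinitePlace.embedding v y) -
      FinitePlace.embedding v (algebraMap (𝓞 K) K a - y) := by rw [map_sub]; ring
  rw [this]
  exact (norm_sub_le_max_ultra _ _).trans_lt (max_lt (hy.trans_le (min_le_left _ _)) hle)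

instance normalizedLocalField_adicCompletion :
    NormalizedLocalField (v.adicCompletion K) (resCard v) where
  one_lt_card := HeightOneSpectrum.one_lt_absNorm v
  norm_eq_zpow x hx := by
    have h : Valued.v x ≠ (0 : WithZero (Multiplicative ℤ)) := by simpa using hx
    refine ⟨Multiplicative.toAdd (WithZero.unzero h), ?_⟩
    rw [FinitePlace.norm_def, WithZeroMulInt.toNNReal_neg_apply _ h]
    push_cast
    rfl
  exists_uniformizer := by
    obtain ⟨ϖ, h⟩ := v.valuation_exists_uniformizer K
    refine ⟨FinitePlace.embedding v ϖ, ?_⟩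
    rw [FinitePlace.norm_embedding', h, toNNReal_exp]
    simp [resCard]
  exists_residues := by
    classical
    have : Finite (𝓞 K ⧸ v.asIdeal) := v.asIdeal.finiteQuotientOfFreeOfNeBot v.ne_bot
    have := Fintype.ofFinite (𝓞 K ⧸ v.asIdeal)
    let e (c : 𝓞 K ⧸ v.asIdeal) : v.adicCompletion K :=
      FinitePlace.embedding v (algebraMap (𝓞 K) K (Quotient.out c))
    have hmk : ∀ c : 𝓞 K ⧸ v.asIdeal, Ideal.Quotient.mk v.asIdeal (Quotient.out c) = c :=
      fun c ↦ Quotient.out_eq c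
    have he : ∀ c d, ‖e c - e d‖ < 1 → c = d := by
      intro c d h
      rw [← map_sub, ← map_sub, FinitePlace.norm_lt_one_iff_mem, ← Ideal.Quotient.mk_eq_mk_iff_sub_mem,
        hmk, hmk] at h
      exact h
    have hinj : Function.Injective e := fun c d h ↦ he c d (by simp [h])
    refine ⟨Finset.univ.image e, ?_, ?_, ?_, fun x hx ↦ ?_⟩
    · rw [Finset.card_image_of_injective _ hinj, Finset.card_univ, ← Nat.card_eq_fintype_card]
      rfl
    · simp only [Finset.mem_image, Finset.mem_univ, true_and, forall_exists_index,
        forall_apply_eq_imp_iff]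
      exact fun c ↦ FinitePlace.norm_le_one K v _
    · simp only [Finset.mem_image, Finset.mem_univ, true_and, forall_exists_index,
        forall_apply_eq_imp_iff]
      exact fun c d h ↦ congrArg e (he c d h)
    · obtain ⟨a, ha⟩ := exists_norm_sub_embedding_lt v hx one_pos
      refine ⟨e (Ideal.Quotient.mk _ a), by simp, ?_⟩
      have h2 : ‖FinitePlace.embedding v (algebraMap (𝓞 K) K a) - e (Ideal.Quotient.mk _ a)‖ < 1 :=
      by
        rw [← map_sub, ← map_sub, FinitePlace.norm_lt_one_iff_mem,
          ← Ideal.Quotient.mk_eq_mk_iff_sub_mem, hmk]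
      have := IsUltrametricDist.norm_add_le_max (x - FinitePlace.embedding v (algebraMap (𝓞 K) K a))
        (FinitePlace.embedding v (algebraMap (𝓞 K) K a) - e (Ideal.Quotient.mk _ a))
      rw [sub_add_sub_cancel] at this
      exact this.trans_lt (max_lt ha h2)

instance properSpace_adicCompletion : ProperSpace (v.adicCompletion K) :=
  properSpace_of_normalizedLocalField

instance continuousSMul_padic : ContinuousSMul ℚ_[residueChar v] (v.adicCompletion K) :=
  continuousSMul_of_algebraMap _ _ (continuous_padicEmbedding v)

/-- A locally compact vector space over ℚ_p has finite dimension. This guarantees that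
`Algebra.trace` is the genuine trace and not its default value 0. -/
instance finiteDimensional_padic : FiniteDimensional ℚ_[residueChar v] (v.adicCompletion K) :=
  .of_locallyCompactSpace _

theorem continuous_localTrace : Continuous (localTrace v) :=
  LinearMap.continuous_of_finiteDimensional (Algebra.trace ℚ_[residueChar v] (v.adicCompletion K))

theorem norm_localTrace_embedding_le_one (a : 𝓞 K) :
    ‖localTrace v (FinitePlace.embedding v (algebraMap (𝓞 K) K a))‖ ≤ 1 := by
  have h : IsIntegral ℤ (FinitePlace.embedding v (algebraMap (𝓞 K) K a)) := by
    obtain ⟨P, hm, hP⟩ := map_isIntegral_int (FinitePlace.embedding (K := K) v) a.isIntegral_coe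
    exact ⟨P, hm, by convert hP using 2; exact Subsingleton.elim _ _⟩
  have h1 : IsIntegral ℤ (localTrace v (FinitePlace.embedding v (algebraMap (𝓞 K) K a))) :=
    Algebra.isIntegral_trace h
  obtain ⟨y, hy⟩ := IsIntegrallyClosed.isIntegral_iff.1 (h1.tower_top (A := ℤ_[residueChar v]))
  rw [← hy]
  exact y.2

/-- Traces of elements of 𝓞 K are integral over ℤ, hence p-adic integers; 𝓞 K is dense in the unit
ball and the trace is continuous. -/
theorem norm_localTrace_le_one {x : v.adicCompletion K} (hx : ‖x‖ ≤ 1) : ‖localTrace v x‖ ≤ 1 := by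
  have hc : IsClosed {y : v.adicCompletion K | ‖localTrace v y‖ ≤ 1} :=
    isClosed_le (continuous_localTrace v).norm continuous_const
  refine (hc.closure_subset_iff (s := Set.range fun a : 𝓞 K ↦
    FinitePlace.embedding v (algebraMap (𝓞 K) K a))).2 ?_ ?_
  · rintro _ ⟨a, rfl⟩; exact norm_localTrace_embedding_le_one v a
  · refine Metric.mem_closure_iff.2 fun ε hε ↦ ?_
    obtain ⟨a, ha⟩ := exists_norm_sub_embedding_lt v hx hε
    exact ⟨_, ⟨a, rfl⟩, by rwa [dist_eq_norm]⟩

theorem zero_mem_traceIntegralExponents : 0 ∈ traceIntegralExponents v :=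
  fun _ hx ↦ norm_localTrace_le_one v (by simpa using hx)

theorem bddAbove_traceIntegralExponents : BddAbove (traceIntegralExponents v) := by
  set p := residueChar v
  set N := Module.finrank ℚ_[p] (v.adicCompletion K)
  have hN : (N : ℚ_[p]) ≠ 0 := by exact_mod_cast Module.finrank_pos.ne'
  have hp : (1 : ℝ) < p := by exact_mod_cast (residueChar_prime v).out.one_lt
  -- The trace of p^(-m) is N p^(-m) with N the degree, and N ≠ 0 in characteristic zero; this m
  -- makes it non-integral.
  obtain ⟨m, hm⟩ := pow_unbounded_of_one_lt (‖(N : ℚ_[p])‖⁻¹) hp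
  set x : v.adicCompletion K := algebraMap ℚ_[p] _ ((p : ℚ_[p]) ^ m)⁻¹
  have hx : 1 < ‖localTrace v x‖ := by
    rw [localTrace, Algebra.trace_algebraMap, nsmul_eq_mul, norm_mul, norm_inv, norm_pow,
      Padic.norm_p, inv_pow, inv_inv]
    rwa [inv_lt_iff_one_lt_mul₀' (norm_pos_iff.2 hN)] at hm
  obtain ⟨n, hn⟩ := exists_lt_zpow (v.adicCompletion K) ‖x‖
  refine ⟨n, fun d hd ↦ ?_⟩
  by_contra! hnd
  refine hx.not_ge (hd x (hn.le.trans ?_))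
  exact (zpow_q_le_iff (v.adicCompletion K)).2 hnd.le

theorem isGreatest_diffExponent : IsGreatest (traceIntegralExponents v) (diffExponent v) :=
  ⟨Int.csSup_mem ⟨0, zero_mem_traceIntegralExponents v⟩ (bddAbove_traceIntegralExponents v),
    fun _ h ↦ le_csSup (bddAbove_traceIntegralExponents v) h⟩

theorem diffExponent_nonneg : 0 ≤ diffExponent v :=
  (isGreatest_diffExponent v).2 (zero_mem_traceIntegralExponents v)

end Place

/-! ### The additive character -/

section AdditiveCharacter

theorem padicFract_eq_div {p : ℕ} [Fact p.Prime] (x : ℚ_[p]) :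
    ∃ m n : ℕ, padicFract x = m / (p : ℚ) ^ n := ⟨_, _, rfl⟩

/-- ℤ[1/p] ∩ ℤ_p = ℤ: the reduced denominator is prime to p and divides a power of p. -/
theorem exists_intCast_eq_of_norm_le_one {p : ℕ} [Fact p.Prime] {r : ℚ} {z : ℤ} {n : ℕ}
    (hr : r = z / (p : ℚ) ^ n) (h : ‖(r : ℚ_[p])‖ ≤ 1) : ∃ m : ℤ, r = m := by
  have h1 : ¬ p ∣ r.den := by
    rwa [Padic.norm_rat_le_one_iff_padicValuation_le_one, Rat.padicValuation_le_one_iff] at h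
  have h2 : r.den ∣ p ^ n := by
    have := Rat.den_dvd z ((p ^ n : ℕ) : ℤ)
    push_cast at this
    rw [Rat.divInt_eq_div] at this
    push_cast at this
    rw [← hr] at this
    exact_mod_cast this
  have h3 : r.den = 1 := Nat.Coprime.eq_one_of_dvd
    (((Nat.Prime.coprime_iff_not_dvd Fact.out).2 h1).symm.pow_right n) h2
  exact ⟨r.num, (Rat.coe_int_num_of_den_eq_one h3).symm⟩

theorem padicFract_add {p : ℕ} [Fact p.Prime] (x y : ℚ_[p]) :
    ∃ z : ℤ, padicFract (x + y) = padicFract x + padicFract y + z := by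
  obtain ⟨m₁, n₁, h₁⟩ := padicFract_eq_div x
  obtain ⟨m₂, n₂, h₂⟩ := padicFract_eq_div y
  obtain ⟨m₃, n₃, h₃⟩ := padicFract_eq_div (x + y)
  have hp : (p : ℚ) ≠ 0 := by exact_mod_cast (Fact.out : p.Prime).ne_zero
  obtain ⟨z, hz⟩ := exists_intCast_eq_of_norm_le_one (p := p)
    (r := padicFract (x + y) - padicFract x - padicFract y)
    (z := m₃ * p ^ (n₁ + n₂) - m₁ * p ^ (n₂ + n₃) - m₂ * p ^ (n₁ + n₃)) (n := n₁ + n₂ + n₃)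
    (by rw [h₁, h₂, h₃]; push_cast; field_simp; ring) (by
      have e : ((padicFract (x + y) - padicFract x - padicFract y : ℚ) : ℚ_[p]) =
          ((x - padicFract x) + (y - padicFract y)) - ((x + y) - padicFract (x + y)) := by
        push_cast; ring
      rw [e]
      refine (norm_sub_le_max_ultra _ _).trans (max_le ?_ (norm_sub_padicFract_le_one _))
      exact (IsUltrametricDist.norm_add_le_max _ _).trans
        (max_le (norm_sub_padicFract_le_one _) (norm_sub_padicFract_le_one _)))
  exact ⟨z, by rw [← hz]; ring⟩

theorem padicFract_eq_zero_iff {p : ℕ} [Fact p.Prime] (x : ℚ_[p]) :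
    padicFract x = 0 ↔ ‖x‖ ≤ 1 := by
  refine ⟨fun h ↦ by simpa [h] using norm_sub_padicFract_le_one x, fun h ↦ ?_⟩
  obtain ⟨m, n, hmn⟩ := padicFract_eq_div x
  obtain ⟨z, hz⟩ := exists_intCast_eq_of_norm_le_one (p := p) (r := padicFract x) (z := m) (n := n)
    (by simpa using hmn) (by
      have := norm_sub_le_max_ultra x (x - padicFract x)
      rw [sub_sub_cancel] at this
      exact this.trans (max_le h (norm_sub_padicFract_le_one x)))
  have h0 := padicFract_nonneg x
  have h1 := padicFract_lt_one x
  rw [hz] at h0 h1 ⊢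
  have h0' : 0 ≤ z := by exact_mod_cast h0
  have h1' : z < 1 := by exact_mod_cast h1
  have : z = 0 := by lia
  simp [this]

variable {K : Type*} [Field K] [NumberField K] (v : HeightOneSpectrum (𝓞 K))

/-- The exponential is 1 only when the fractional part is an integer, and the only integer in [0, 1)
is 0. -/
theorem addChar_eq_one_iff (x : v.adicCompletion K) : addChar v x = 1 ↔ ‖localTrace v x‖ ≤ 1 := by
  rw [← padicFract_eq_zero_iff, addChar, Complex.exp_eq_one_iff]
  refine ⟨fun ⟨n, hn⟩ ↦ ?_, fun h ↦ ⟨0, by simp [h]⟩⟩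
  rw [mul_comm, mul_left_inj' Complex.two_pi_I_ne_zero] at hn
  have hz : padicFract (localTrace v x) = n := by exact_mod_cast hn
  have h0 := padicFract_nonneg (localTrace v x)
  have h1 := padicFract_lt_one (localTrace v x)
  rw [hz] at h0 h1 ⊢
  have h0' : 0 ≤ n := by exact_mod_cast h0
  have h1' : n < 1 := by exact_mod_cast h1
  have : n = 0 := by lia
  simp [this]

theorem addChar_add (x y : v.adicCompletion K) : addChar v (x + y) = addChar v x * addChar v y := by
  have : localTrace v (x + y) = localTrace v x + localTrace v y := map_add _ _ _
  obtain ⟨z, hz⟩ := padicFract_add (localTrace v x) (localTrace v y)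
  rw [addChar, addChar, addChar, this, hz, ← Complex.exp_add]
  push_cast
  rw [mul_add, Complex.exp_add, mul_comm _ (z : ℂ), Complex.exp_int_mul_two_pi_mul_I, mul_one,
    mul_add]

theorem addChar_zero : addChar v 0 = 1 := by
  rw [addChar_eq_one_iff]; simp [localTrace]

theorem norm_addChar (x : v.adicCompletion K) : ‖addChar v x‖ = 1 := by
  have : 2 * Real.pi * Complex.I * (padicFract (localTrace v x) : ℂ) =
    ((2 * Real.pi * padicFract (localTrace v x) : ℝ) : ℂ) * Complex.I := by push_cast; ring
  rw [addChar, this, Complex.norm_exp_ofReal_mul_I]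

/-- The character `λ` as an additive character with values in the unit circle. -/
def circleAddChar : AddChar (v.adicCompletion K) Circle where
  toFun x := ⟨addChar v x, mem_sphere_zero_iff_norm.2 (norm_addChar v x)⟩
  map_zero_eq_one' := Subtype.ext (addChar_zero v)
  map_add_eq_mul' x y := Subtype.ext (addChar_add v x y)

theorem coe_circleAddChar (x : v.adicCompletion K) : (circleAddChar v x : ℂ) = addChar v x := rfl

end AdditiveCharacter

/-- The additive character `ψ` is trivial on the ball of radius `q ^ δ` and on no larger ball. -/
def HasAddConductor {k : Type*} [NormedField k] {q : ℕ} [NormalizedLocalField k q]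
    (ψ : AddChar k Circle) (δ : ℤ) : Prop :=
  (∀ x, ‖x‖ ≤ (q : ℝ) ^ δ → ψ x = 1) ∧ ∃ x, ‖x‖ ≤ (q : ℝ) ^ (δ + 1) ∧ ψ x ≠ 1

theorem hasAddConductor_circleAddChar {K : Type*} [Field K] [NumberField K]
    (v : HeightOneSpectrum (𝓞 K)) : HasAddConductor (circleAddChar v) (diffExponent v) := by
  have key : ∀ x, circleAddChar v x = 1 ↔ ‖localTrace v x‖ ≤ 1 := fun x ↦ by
    rw [← addChar_eq_one_iff, ← coe_circleAddChar, Circle.coe_eq_one]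
  refine ⟨fun x hx ↦ (key x).2 ((isGreatest_diffExponent v).1 x hx), ?_⟩
  by_contra! h
  have : diffExponent v + 1 ∈ traceIntegralExponents v := fun x hx ↦ (key x).1 (h x hx)
  have := (isGreatest_diffExponent v).2 this
  lia

/-! ### Measures of balls -/

section Balls

open Metric

variable {k : Type*} [NormedField k] [IsUltrametricDist k] {q : ℕ} [NormalizedLocalField k q]

/-- The closed ball of radius `q ^ n` and centre `a`. -/
def qBall {k : Type*} [NormedField k] {q : ℕ} [NormalizedLocalField k q] (a : k) (n : ℤ) : Set k :=
  closedBall a ((q : ℝ) ^ n)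

theorem mem_qBall {a x : k} {n : ℤ} : x ∈ qBall a n ↔ ‖x - a‖ ≤ (q : ℝ) ^ n := by
  rw [qBall, mem_closedBall, dist_eq_norm]

theorem mem_qBall_zero {x : k} {n : ℤ} : x ∈ qBall 0 n ↔ ‖x‖ ≤ (q : ℝ) ^ n := by
  rw [mem_qBall, sub_zero]

theorem mem_qBall_self (a : k) (n : ℤ) : a ∈ qBall a n := by
  rw [mem_qBall]; simpa using (zpow_q_pos k n).le

theorem isClopen_qBall (a : k) (n : ℤ) : IsClopen (qBall a n) :=
  IsUltrametricDist.isClopen_closedBall a (zpow_q_pos k n).ne'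

theorem isCompact_qBall [ProperSpace k] (a : k) (n : ℤ) : IsCompact (qBall a n) :=
  isCompact_closedBall _ _

theorem qBall_eq_of_mem {a b : k} {n : ℤ} (h : b ∈ qBall a n) : qBall a n = qBall b n :=
  IsUltrametricDist.closedBall_eq_of_mem h

theorem qBall_subset {a : k} {m n : ℤ} (h : m ≤ n) : qBall a m ⊆ qBall a n :=
  closedBall_subset_closedBall ((zpow_q_le_iff k).2 h)

theorem mem_qBall_comm {a b : k} {n : ℤ} : a ∈ qBall b n ↔ b ∈ qBall a n := by
  rw [mem_qBall, mem_qBall, norm_sub_rev]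

theorem disjoint_qBall {a b : k} {n : ℤ} (h : b ∉ qBall a n) : Disjoint (qBall a n) (qBall b n) :=
    by
  refine Set.disjoint_left.2 fun x h1 h2 ↦ h ?_
  rw [qBall_eq_of_mem h1, ← qBall_eq_of_mem h2]
  exact mem_qBall_self b n

open scoped Classical in
theorem qBall_inter {a b : k} {m n : ℤ} (h : m ≤ n) :
    qBall a m ∩ qBall b n = if a ∈ qBall b n then qBall a m else ∅ := by
  split_ifs with hab
  · rw [Set.inter_eq_left, qBall_eq_of_mem hab]; exact qBall_subset h
  · refine Set.disjoint_iff_inter_eq_empty.1 (Disjoint.mono_left (qBall_subset h) ?_)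
    exact (disjoint_qBall hab).symm

theorem norm_eq_of_mem_qBall {a x : k} {n : ℤ} (ha : (q : ℝ) ^ n < ‖a‖) (hx : x ∈ qBall a n) :
    ‖x‖ = ‖a‖ := by
  rw [mem_qBall] at hx
  have : x = (x - a) + a := by ring
  rw [this, IsUltrametricDist.norm_add_eq_max_of_norm_ne_norm (hx.trans_lt ha).ne,
    max_eq_right (hx.trans ha.le)]

theorem add_mem_qBall_iff {a x t : k} {n : ℤ} (ht : ‖t‖ ≤ (q : ℝ) ^ n) :
    x + t ∈ qBall a n ↔ x ∈ qBall a n := by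
  have h : x + t ∈ qBall x n := by rw [mem_qBall]; simpa using ht
  rw [mem_qBall_comm, mem_qBall_comm (b := a), qBall_eq_of_mem h]

theorem preimage_mul_qBall {u : k} {m : ℤ} (hu : ‖u‖ = (q : ℝ) ^ m) (a : k) (n : ℤ) :
    (u * ·) ⁻¹' qBall a n = qBall (u⁻¹ * a) (n - m) := by
  have hu0 : u ≠ 0 := by rw [← norm_pos_iff, hu]; exact zpow_q_pos k m
  ext x
  have : u * x - a = u * (x - u⁻¹ * a) := by field_simp
  rw [Set.mem_preimage, mem_qBall, mem_qBall, this, norm_mul, hu, zpow_sub₀ (q_ne_zero k),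
    le_div_iff₀' (zpow_q_pos k m)]

theorem preimage_inv_qBall {a : k} {m n : ℤ} (ha : ‖a‖ = (q : ℝ) ^ m) (hn : n < m) :
    (·⁻¹) ⁻¹' qBall a n = qBall a⁻¹ (n - 2 * m) := by
  have key : ∀ {a x : k} {m n : ℤ}, ‖a‖ = (q : ℝ) ^ m → n < m → x ∈ qBall a n →
      x⁻¹ ∈ qBall a⁻¹ (n - 2 * m) := by
    intro a x m n ha hn hx
    have hxn := norm_eq_of_mem_qBall (by rwa [ha, zpow_q_lt_iff k]) hx
    have ha0 : a ≠ 0 := by rw [← norm_pos_iff, ha]; exact zpow_q_pos k m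
    have hx0 : x ≠ 0 := by rw [← norm_pos_iff, hxn, ha]; exact zpow_q_pos k m
    rw [mem_qBall] at hx ⊢
    have : x⁻¹ - a⁻¹ = -((x - a) / (x * a)) := by field_simp; ring
    rw [this, norm_neg, norm_div, norm_mul, hxn, ha, zpow_sub₀ (q_ne_zero k), two_mul,
      zpow_add₀ (q_ne_zero k)]
    gcongr
  ext x
  rw [Set.mem_preimage]
  refine ⟨fun h ↦ by simpa using key ha hn h, fun h ↦ ?_⟩
  -- Inversion is an involution, so the reverse inclusion is the same statement at a⁻¹, whose ball
  -- again misses 0.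
  have := key (a := a⁻¹) (m := -m) (by rw [norm_inv, ha, zpow_neg]) (by lia) h
  rw [inv_inv] at this
  convert this using 2
  ring

theorem exists_mem_qBall_subset {U : Set k} (hU : IsOpen U) {x : k} (hx : x ∈ U) (m : ℤ) :
    ∃ n, n < m ∧ qBall x n ⊆ U := by
  obtain ⟨ε, hε, h⟩ := Metric.isOpen_iff.1 hU x hx
  obtain ⟨n, hn⟩ := exists_zpow_lt k hε
  refine ⟨min (-n) (m - 1), by lia, fun y hy ↦ h ?_⟩
  rw [mem_qBall] at hy
  rw [mem_ball, dist_eq_norm]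
  exact (hy.trans ((zpow_q_le_iff k).2 (min_le_left _ _))).trans_lt hn

/-- The balls that do not contain `0`, together with `{0}` and the empty set. -/
def puncturedBalls {k : Type*} [NormedField k] {q : ℕ} [NormalizedLocalField k q] : Set (Set k) :=
  {s | s = ∅ ∨ s = {0} ∨ ∃ (a : k) (n : ℤ), (q : ℝ) ^ n < ‖a‖ ∧ s = qBall a n}

theorem zero_notMem_qBall {a : k} {n : ℤ} (h : (q : ℝ) ^ n < ‖a‖) : (0 : k) ∉ qBall a n := by
  rw [mem_qBall, zero_sub, norm_neg]; exact h.not_ge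

theorem qBall_inter_mem_puncturedBalls {a b : k} {m n : ℤ} (ha : (q : ℝ) ^ m < ‖a‖)
    (h : m ≤ n) : qBall a m ∩ qBall b n ∈ puncturedBalls (k := k) := by
  classical
  rw [qBall_inter h]
  split_ifs
  · exact .inr (.inr ⟨a, m, ha, rfl⟩)
  · exact .inl rfl

theorem isPiSystem_puncturedBalls : IsPiSystem (puncturedBalls (k := k)) := by
  rintro s hs t ht hst
  rcases hs with rfl | rfl | ⟨a, m, ha, rfl⟩
  · simp at hst
  · refine .inr (.inl ?_)
    obtain ⟨x, hx, hxt⟩ := hst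
    rw [Set.mem_singleton_iff] at hx
    rw [Set.inter_eq_left]; simpa [← hx] using hxt
  rcases ht with rfl | rfl | ⟨b, n, hb, rfl⟩
  · simp at hst
  · obtain ⟨x, hx, hxt⟩ := hst
    rw [Set.mem_singleton_iff] at hxt
    exact absurd (hxt ▸ hx) (zero_notMem_qBall ha)
  · rcases le_total m n with h | h
    · exact qBall_inter_mem_puncturedBalls ha h
    · rw [Set.inter_comm]; exact qBall_inter_mem_puncturedBalls hb h

variable [ProperSpace k]

theorem exists_countable_qBall_cover {U : Set k} (hU : IsOpen U) (h0 : (0 : k) ∉ U) :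
    ∃ T : Set (Set k), T.Countable ∧ ⋃₀ T = U ∧
      ∀ s ∈ T, ∃ (a : k) (n : ℤ), (q : ℝ) ^ n < ‖a‖ ∧ s = qBall a n := by
  have hne : ∀ x ∈ U, x ≠ 0 := fun x hx h ↦ h0 (h ▸ hx)
  choose! m hm using fun x : k ↦ NormalizedLocalField.norm_eq_zpow x
  choose! n hn hnU using fun (x : k) (hx : x ∈ U) ↦ exists_mem_qBall_subset hU hx (m x)
  obtain ⟨T, hTU, hTc, hT⟩ := TopologicalSpace.countable_cover_nhdsWithin (s := U)
    (f := fun x ↦ qBall x (n x)) fun x hx ↦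
      mem_nhdsWithin_of_mem_nhds (closedBall_mem_nhds x (zpow_q_pos k _))
  refine ⟨(fun x ↦ qBall x (n x)) '' T, hTc.image _, ?_, ?_⟩
  · refine subset_antisymm ?_ (by rwa [Set.sUnion_image])
    rw [Set.sUnion_image]
    exact Set.iUnion₂_subset fun x hx ↦ hnU x (hTU hx)
  · rintro _ ⟨x, hx, rfl⟩
    exact ⟨x, n x, by rw [hm x (hne x (hTU hx)), zpow_q_lt_iff k]; exact hn x (hTU hx), rfl⟩

variable [MeasurableSpace k] [BorelSpace k]

theorem measurableSet_qBall {k : Type*} [NormedField k] {q : ℕ} [NormalizedLocalField k q]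
    [MeasurableSpace k] [BorelSpace k] (a : k) (n : ℤ) : MeasurableSet (qBall a n) :=
  isClosed_closedBall.measurableSet

/-- An open set without the origin is a countable union of balls that miss 0. On such balls the norm
is constant, and inversion and dilations pull them back to balls of the same kind, which makes them
the convenient generators. -/
theorem generateFrom_puncturedBalls :
    ‹MeasurableSpace k› = MeasurableSpace.generateFrom (puncturedBalls (k := k)) := by
  refine le_antisymm ?_ (MeasurableSpace.generateFrom_le ?_)
  · rw [BorelSpace.measurable_eq (α := k)]
    refine MeasurableSpace.generateFrom_le fun U hU ↦ ?_
    have h1 : MeasurableSet[MeasurableSpace.generateFrom (puncturedBalls (k := k))] (U \ {0}) := by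
      obtain ⟨T, hTc, hTU, hT⟩ := exists_countable_qBall_cover
        (IsOpen.sdiff hU (isClosed_singleton (x := (0 : k)))) (by simp)
      rw [← hTU]
      refine MeasurableSet.sUnion hTc fun s hs ↦ ?_
      exact MeasurableSpace.measurableSet_generateFrom (.inr (.inr (hT s hs)))
    have h2 : MeasurableSet[MeasurableSpace.generateFrom (puncturedBalls (k := k))] {(0 : k)} :=
      MeasurableSpace.measurableSet_generateFrom (.inr (.inl rfl))
    by_cases h0 : (0 : k) ∈ U
    · have := MeasurableSet.union h1 h2
      rwa [Set.sdiff_union_self, Set.union_eq_left.2 (by simpa using h0)] at this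
    · rwa [Set.sdiff_singleton_eq_self h0] at h1
  · rintro s (rfl | rfl | ⟨a, n, -, rfl⟩)
    · exact .empty
    · exact measurableSet_singleton 0
    · exact measurableSet_qBall a n

theorem measure_ext_of_qBall {μ ν : Measure k} (h0 : μ {0} = 0) (h0' : ν {0} = 0)
    (hfin : ∀ (a : k) (n : ℤ), (q : ℝ) ^ n < ‖a‖ → μ (qBall a n) ≠ ∞)
    (h : ∀ (a : k) (n : ℤ), (q : ℝ) ^ n < ‖a‖ → μ (qBall a n) = ν (qBall a n)) : μ = ν := by
  obtain ⟨T, hTc, hTU, hT⟩ := exists_countable_qBall_cover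
    (isOpen_compl_singleton (x := (0 : k))) (by simp)
  refine Measure.ext_of_generateFrom_of_cover_subset (S := puncturedBalls (k := k))
    (T := insert {0} T) generateFrom_puncturedBalls isPiSystem_puncturedBalls ?_
    (hTc.insert _) ?_ ?_ ?_
  · rintro s (rfl | hs)
    · exact .inr (.inl rfl)
    · exact .inr (.inr (hT s hs))
  · rw [Set.sUnion_insert, hTU, Set.union_compl_self]
  · rintro s (rfl | hs)
    · simp [h0]
    · obtain ⟨a, n, ha, rfl⟩ := hT s hs
      exact hfin a n ha
  · rintro s (rfl | rfl | ⟨a, n, ha, rfl⟩)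
    · simp
    · rw [h0, h0']
    · exact h a n ha

/-- A function whose integrals over all balls not containing `0` vanish is zero almost everywhere. -/
theorem ae_eq_zero_of_setIntegral_qBall {μ : Measure k} (hμ0 : μ {0} = 0) {f : k → ℂ}
    (hf : ∀ (a : k) (n : ℤ), (q : ℝ) ^ n < ‖a‖ → IntegrableOn f (qBall a n) μ)
    (h0 : ∀ (a : k) (n : ℤ), (q : ℝ) ^ n < ‖a‖ → ∫ x in qBall a n, f x ∂μ = 0) : f =ᵐ[μ] 0 := by
  have key : ∀ (a : k) (n : ℤ), (q : ℝ) ^ n < ‖a‖ → ∀ᵐ x ∂μ, x ∈ qBall a n → f x = 0 := by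
    intro a n ha
    rw [← ae_restrict_iff' (measurableSet_qBall a n)]
    suffices h : ∀ s, MeasurableSet s → ∫ x in s ∩ qBall a n, f x ∂μ = 0 from
      Integrable.ae_eq_zero_of_forall_setIntegral_eq_zero (hf a n ha) fun s hs _ ↦ by
        rw [Measure.restrict_restrict hs, h s hs]
    intro s hs
    -- Dynkin's π-λ argument: the measurable sets whose trace on the ball has zero integral are
    -- closed under complements and disjoint unions.
    refine MeasurableSpace.induction_on_inter (C := fun s _ ↦ ∫ x in s ∩ qBall a n, f x ∂μ = 0)
      (generateFrom_puncturedBalls (k := k)) isPiSystem_puncturedBalls ?_ ?_ ?_ ?_ s hs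
    · simp
    · intro t ht
      by_cases hne : (t ∩ qBall a n).Nonempty
      · rcases isPiSystem_puncturedBalls t ht (qBall a n) (.inr (.inr ⟨a, n, ha, rfl⟩)) hne with
          h | h | ⟨b, m, hb, h⟩
        · simp [h]
        · rw [h, Measure.restrict_zero_set hμ0, integral_zero_measure]
        · rw [h, h0 b m hb]
      · rw [Set.not_nonempty_iff_eq_empty.1 hne]; simp
    · intro t ht ih
      have : tᶜ ∩ qBall a n = qBall a n \ (t ∩ qBall a n) := by ext; simp; tauto
      rw [this, setIntegral_sdiff (ht.inter (measurableSet_qBall a n)) (hf a n ha)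
        Set.inter_subset_right, h0 a n ha, ih, sub_zero]
    · intro t hd ht ih
      rw [Set.iUnion_inter, integral_iUnion (fun i ↦ (ht i).inter (measurableSet_qBall a n))
        (fun i j hij ↦ (hd hij).mono Set.inter_subset_left Set.inter_subset_left)
        ((hf a n ha).mono_set (Set.iUnion_subset fun i ↦ Set.inter_subset_right))]
      simp [ih]
  obtain ⟨T, hTc, hTU, hT⟩ := exists_countable_qBall_cover
    (isOpen_compl_singleton (x := (0 : k))) (by simp)
  have h1 : ∀ᵐ x ∂μ, ∀ s ∈ T, x ∈ s → f x = 0 := by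
    rw [ae_ball_iff hTc]
    intro s hs
    obtain ⟨a, n, ha, rfl⟩ := hT s hs
    exact key a n ha
  have h2 : ∀ᵐ x ∂μ, x ≠ 0 := by rw [ae_iff]; simpa using hμ0
  filter_upwards [h1, h2] with x hx hx0
  have : x ∈ ⋃₀ T := by rw [hTU]; exact hx0
  obtain ⟨s, hs, hxs⟩ := this
  exact hx s hs hxs

/-! ### Haar measure of balls -/

variable (μ : Measure k) [μ.IsAddHaarMeasure]

variable {μ} in
theorem measure_qBall_lt_top (a : k) (n : ℤ) : μ (qBall a n) < ∞ :=
    (isCompact_qBall a n).measure_lt_top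

theorem measureReal_qBall_center (a : k) (n : ℤ) : μ.real (qBall a n) = μ.real (qBall 0 n) := by
  have : qBall a n = (fun x ↦ -a + x) ⁻¹' qBall 0 n := by
    ext x; simp [mem_qBall, sub_eq_neg_add]
  rw [this, measureReal_def, measure_preimage_add, measureReal_def]

/-- The ball is the disjoint union of q translates of the next smaller one, indexed by the residue
classes. -/
theorem measureReal_qBall_succ (n : ℤ) :
    μ.real (qBall 0 n) = q * μ.real (qBall (0 : k) (n - 1)) := by
  classical
  obtain ⟨s, hcard, hs1, hsd, hs⟩ := NormalizedLocalField.exists_residues (k := k)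
  obtain ⟨c, hc⟩ := exists_norm_eq_zpow k n
  have hc0 : c ≠ 0 := by rw [← norm_pos_iff, hc]; exact zpow_q_pos k n
  have hU : qBall 0 n = ⋃ r ∈ s, qBall (c * r) (n - 1) := by
    ext x
    simp only [Set.mem_iUnion, exists_prop]
    constructor
    · intro hx
      rw [mem_qBall_zero] at hx
      obtain ⟨r, hr, hxr⟩ := hs (x / c) (by
        rw [norm_div, hc]; exact div_le_one_of_le₀ hx (zpow_q_pos k n).le)
      refine ⟨r, hr, ?_⟩
      have : x - c * r = c * (x / c - r) := by field_simp
      rw [mem_qBall, ← norm_lt_zpow_iff, this, norm_mul, hc]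
      exact mul_lt_of_lt_one_right (zpow_q_pos k n) hxr
    · rintro ⟨r, hr, hx⟩
      have h1 : c * r ∈ qBall 0 n := by
        rw [mem_qBall_zero, norm_mul, hc]
        exact mul_le_of_le_one_right (zpow_q_pos k n).le (hs1 r hr)
      rw [qBall_eq_of_mem h1]
      exact qBall_subset (by lia) hx
  rw [hU, measureReal_biUnion_finset ?_ (fun r _ ↦ measurableSet_qBall _ _)
    (fun r _ ↦ (measure_qBall_lt_top _ _).ne)]
  · simp_rw [measureReal_qBall_center μ (c * _)]
    rw [Finset.sum_const, hcard, nsmul_eq_mul]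
  · intro x hx y hy hxy
    refine disjoint_qBall fun h ↦ hxy (hsd x hx y hy ?_)
    rw [mem_qBall, ← norm_lt_zpow_iff, ← mul_sub, norm_mul, hc] at h
    rw [norm_sub_rev]
    exact lt_of_mul_lt_mul_left (by simpa using h) (zpow_q_pos k n).le

theorem measureReal_qBall (a : k) (n : ℤ) :
    μ.real (qBall a n) = (q : ℝ) ^ n * μ.real (qBall (0 : k) 0) := by
  rw [measureReal_qBall_center]
  induction n using Int.induction_on with
  | zero => simp
  | succ n ih =>
    rw [measureReal_qBall_succ, add_sub_cancel_right, ih, zpow_add_one₀ (q_ne_zero k)]; ring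
  | pred n ih =>
    have := measureReal_qBall_succ μ (-n : ℤ)
    rw [ih] at this
    rw [zpow_sub_one₀ (q_ne_zero k)]
    field_simp [q_ne_zero k]
    linarith

theorem measureReal_qBall_pos (a : k) (n : ℤ) : 0 < μ.real (qBall a n) := by
  refine ENNReal.toReal_pos ?_ (measure_qBall_lt_top a n).ne
  exact (measure_closedBall_pos μ a (zpow_q_pos k n)).ne'

theorem measure_singleton_zero {k : Type*} [NormedField k] [IsUltrametricDist k] {q : ℕ}
    [NormalizedLocalField k q]
    [ProperSpace k] [MeasurableSpace k] [BorelSpace k] (μ : Measure k) [μ.IsAddHaarMeasure] : μ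
    {(0 : k)} = 0 := by
  have h : ∀ n : ℕ, μ.real {(0 : k)} ≤ (q : ℝ)⁻¹ ^ n * μ.real (qBall (0 : k) 0) := fun n ↦ by
    have := measureReal_qBall μ (0 : k) (-n)
    rw [zpow_neg, zpow_natCast, ← inv_pow] at this
    rw [← this]
    exact measureReal_mono (by simpa using mem_qBall_self (0 : k) _)
      (measure_qBall_lt_top _ _).ne
  have hl : Filter.Tendsto (fun n : ℕ ↦ (q : ℝ)⁻¹ ^ n * μ.real (qBall (0 : k) 0)) Filter.atTop
      (nhds 0) := by
    simpa using (tendsto_pow_atTop_nhds_zero_of_lt_one (inv_nonneg.2 (q_pos k).le)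
      (inv_lt_one_of_one_lt₀ (one_lt_q k))).mul_const (μ.real (qBall (0 : k) 0))
  have h1 := le_antisymm (ge_of_tendsto' hl h) measureReal_nonneg
  rwa [measureReal_eq_zero_iff isCompact_singleton.measure_lt_top.ne] at h1

theorem ae_ne_zero {k : Type*} [NormedField k] [IsUltrametricDist k] {q : ℕ}
    [NormalizedLocalField k q]
    [ProperSpace k] [MeasurableSpace k] [BorelSpace k] (μ : Measure k) [μ.IsAddHaarMeasure] :
    ∀ᵐ x ∂μ, x ≠ (0 : k) := by
  rw [ae_iff]; simpa using measure_singleton_zero μ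

theorem measure_qBall (a : k) (n : ℤ) :
    μ (qBall a n) = ENNReal.ofReal ((q : ℝ) ^ n * μ.real (qBall (0 : k) 0)) := by
  rw [← measureReal_qBall μ a, ofReal_measureReal (measure_qBall_lt_top _ _).ne]

end Balls

section HilbertSpace

open Metric

variable {k : Type*} [NormedField k] [IsUltrametricDist k] {q : ℕ} [NormalizedLocalField k q]
  [ProperSpace k] [MeasurableSpace k] [BorelSpace k] {μ : Measure k} [μ.IsAddHaarMeasure]

/-! ### Indicators of balls in `L²` -/

variable (μ) in
/-- The indicator function of a ball, as an element of `L²`. -/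
def ballInd (a : k) (n : ℤ) : Lp ℂ 2 μ :=
  indicatorConstLp 2 (measurableSet_qBall a n) (measure_qBall_lt_top a n).ne 1

theorem ballInd_ae (a : k) (n : ℤ) :
    ballInd μ a n =ᵐ[μ] (qBall a n).indicator fun _ ↦ (1 : ℂ) := indicatorConstLp_coeFn

theorem inner_ballInd (a : k) (n : ℤ) (φ : Lp ℂ 2 μ) :
    inner ℂ (ballInd μ a n) φ = ∫ x in qBall a n, φ x ∂μ :=
  L2.inner_indicatorConstLp_one _ _ φ

theorem integrableOn_of_isCompact (φ : Lp ℂ 2 μ) {s : Set k} (hs : IsCompact s) :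
    IntegrableOn φ s μ := by
  have : IsFiniteMeasure (μ.restrict s) := ⟨by simpa using hs.measure_lt_top⟩
  exact ((Lp.memLp φ).restrict s).integrable one_le_two

theorem Lp_eq_zero_of_setIntegral_qBall {φ : Lp ℂ 2 μ}
    (h : ∀ (a : k) (n : ℤ), (q : ℝ) ^ n < ‖a‖ → ∫ x in qBall a n, φ x ∂μ = 0) : φ = 0 := by
  rw [Lp.eq_zero_iff_ae_eq_zero]
  exact ae_eq_zero_of_setIntegral_qBall (measure_singleton_zero μ)
    (fun a n _ ↦ integrableOn_of_isCompact φ (isCompact_qBall a n)) h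

variable (μ) in
-- A vector orthogonal to these indicators has zero integral over every ball that misses 0, hence
-- vanishes.
theorem closure_span_ballInd_punctured :
    (Submodule.span ℂ {φ : Lp ℂ 2 μ | ∃ (a : k) (n : ℤ), (q : ℝ) ^ n < ‖a‖ ∧
      φ = ballInd μ a n}).topologicalClosure = ⊤ := by
  rw [Submodule.topologicalClosure_eq_top_iff, Submodule.eq_bot_iff]
  intro φ hφ
  refine Lp_eq_zero_of_setIntegral_qBall fun a n ha ↦ ?_
  rw [← inner_ballInd]
  exact hφ _ (Submodule.subset_span ⟨a, n, ha, rfl⟩)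

variable (μ) in
theorem closure_span_ballInd :
    (Submodule.span ℂ {φ : Lp ℂ 2 μ | ∃ (a : k) (n : ℤ),
      φ = ballInd μ a n}).topologicalClosure = ⊤ := by
  rw [eq_top_iff, ← closure_span_ballInd_punctured μ]
  refine Submodule.topologicalClosure_mono (Submodule.span_mono ?_)
  rintro _ ⟨a, n, -, rfl⟩
  exact ⟨a, n, rfl⟩

/-! ### Weighted composition operators -/

/-- The hypothesis `hmap` says that w² is the Jacobian of the substitution T, so φ ↦ w · (φ ∘ T)
preserves the L² norm. -/
theorem exists_weightedComp {w : k → ℝ} {T : k → k} (hw : Measurable w) (hT : Measurable T)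
    (hmap : (μ.withDensity fun x ↦ ENNReal.ofReal (w x ^ 2)).map T = μ)
    (hne : ∀ᵐ x ∂μ, w x ≠ 0) :
    ∃ U : Lp ℂ 2 μ →ₗᵢ[ℂ] Lp ℂ 2 μ, ∀ φ, U φ =ᵐ[μ] fun x ↦ (w x : ℂ) * φ (T x) := by
  have hd : Measurable fun x ↦ ENNReal.ofReal (w x ^ 2) := (hw.pow_const 2).ennreal_ofReal
  -- Composition with T is well defined on classes because T pulls null sets back to null sets; this
  -- uses that the density w² is nonzero almost everywhere.
  have hqmp : Measure.QuasiMeasurePreserving T μ μ := by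
    refine ⟨hT, ?_⟩
    have h1 : μ ≪ μ.withDensity fun x ↦ ENNReal.ofReal (w x ^ 2) := by
      refine withDensity_absolutelyContinuous' hd.aemeasurable ?_
      filter_upwards [hne] with x hx
      simpa using by positivity
    have h2 := h1.map hT
    rwa [hmap] at h2
  have hmeas : ∀ φ : Lp ℂ 2 μ, AEStronglyMeasurable (fun x ↦ (w x : ℂ) * φ (T x)) μ := fun φ ↦
    (Complex.measurable_ofReal.comp hw).aestronglyMeasurable.mul
      ((Lp.aestronglyMeasurable φ).comp_quasiMeasurePreserving hqmp)
  have key : ∀ g : k → ℝ≥0∞, AEMeasurable g μ →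
      ∫⁻ x, ENNReal.ofReal (w x ^ 2) * g (T x) ∂μ = ∫⁻ x, g x ∂μ := by
    intro g hg
    have hg' := hg
    rw [← hmap] at hg'
    conv_rhs => rw [← hmap]
    rw [lintegral_map' hg' hT.aemeasurable]
    exact (lintegral_withDensity_eq_lintegral_mul₀ hd.aemeasurable
      (hg.comp_quasiMeasurePreserving hqmp)).symm
  have hnorm : ∀ φ : Lp ℂ 2 μ, eLpNorm (fun x ↦ (w x : ℂ) * φ (T x)) 2 μ = eLpNorm φ 2 μ := by
    intro φ
    rw [eLpNorm_eq_lintegral_rpow_enorm_toReal (by simp) (by simp),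
      eLpNorm_eq_lintegral_rpow_enorm_toReal (by simp) (by simp)]
    congr 1
    have hm : AEMeasurable (fun x ↦ ‖φ x‖ₑ ^ (2 : ℝ≥0∞).toReal) μ :=
      (Lp.aestronglyMeasurable φ).enorm.pow_const _
    rw [← key _ hm]
    refine lintegral_congr fun x ↦ ?_
    simp only [enorm_mul]
    rw [ENNReal.mul_rpow_of_nonneg _ _ (by simp)]
    congr 1
    rw [← ofReal_norm, ENNReal.ofReal_rpow_of_nonneg (by positivity) (by simp)]
    simp
  have hLp : ∀ φ : Lp ℂ 2 μ, MemLp (fun x ↦ (w x : ℂ) * φ (T x)) 2 μ := fun φ ↦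
    ⟨hmeas φ, by rw [hnorm]; exact Lp.eLpNorm_lt_top φ⟩
  refine ⟨⟨{ toFun := fun φ ↦ (hLp φ).toLp, map_add' := fun φ ψ ↦ ?_, map_smul' := fun c φ ↦ ?_ },
    fun φ ↦ ?_⟩, fun φ ↦ (hLp φ).coeFn_toLp⟩
  · rw [← MemLp.toLp_add, MemLp.toLp_eq_toLp_iff]
    filter_upwards [hqmp.ae (Lp.coeFn_add φ ψ)] with x hx
    rw [hx, Pi.add_apply, Pi.add_apply, mul_add]
  · rw [RingHom.id_apply, ← MemLp.toLp_const_smul, MemLp.toLp_eq_toLp_iff]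
    filter_upwards [hqmp.ae (Lp.coeFn_smul c φ)] with x hx
    rw [hx, Pi.smul_apply, Pi.smul_apply, smul_eq_mul, smul_eq_mul]; ring
  · simp only [LinearMap.coe_mk, AddHom.coe_mk]
    rw [Lp.norm_toLp, hnorm, Lp.norm_def]

/-- The operator attached to (w', T') is a right inverse of the isometry attached to (w, T), which
gives surjectivity; the formula determines the class and gives uniqueness. -/
theorem existsUnique_weightedComp_equiv {w w' : k → ℝ} {T T' : k → k} (hw : Measurable w)
    (hT : Measurable T) (hmap : (μ.withDensity fun x ↦ ENNReal.ofReal (w x ^ 2)).map T = μ)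
    (hw' : Measurable w') (hT' : Measurable T')
    (hmap' : (μ.withDensity fun x ↦ ENNReal.ofReal (w' x ^ 2)).map T' = μ)
    (h : ∀ᵐ x ∂μ, w x * w' (T x) = 1 ∧ T' (T x) = x) (hne' : ∀ᵐ x ∂μ, w' x ≠ 0) :
    ∃! U : Lp ℂ 2 μ ≃ₗᵢ[ℂ] Lp ℂ 2 μ, ∀ φ, U φ =ᵐ[μ] fun x ↦ (w x : ℂ) * φ (T x) := by
  have hne : ∀ᵐ x ∂μ, w x ≠ 0 := h.mono fun x hx h0 ↦ by simp [h0] at hx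
  obtain ⟨U, hU⟩ := exists_weightedComp hw hT hmap hne
  obtain ⟨U', hU'⟩ := exists_weightedComp hw' hT' hmap' hne'
  have hqmp : Measure.QuasiMeasurePreserving T μ μ := by
    refine ⟨hT, ?_⟩
    have h1 : μ ≪ μ.withDensity fun x ↦ ENNReal.ofReal (w x ^ 2) := by
      refine withDensity_absolutelyContinuous' (hw.pow_const 2).ennreal_ofReal.aemeasurable ?_
      filter_upwards [hne] with x hx
      simpa using by positivity
    have h2 := h1.map hT
    rwa [hmap] at h2
  refine ⟨LinearIsometryEquiv.ofSurjective U fun φ ↦ ⟨U' φ, ?_⟩, fun φ ↦ hU φ, fun V hV ↦ ?_⟩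
  · refine Lp.ext ?_
    filter_upwards [hU (U' φ), hqmp.ae (hU' φ), h] with x h1 h2 h3
    rw [h1, h2, h3.2, ← mul_assoc, ← Complex.ofReal_mul, h3.1, Complex.ofReal_one, one_mul]
  · ext1 φ
    exact Lp.ext ((hV φ).trans (hU φ).symm)

theorem map_withDensity_eq_of_qBall {w : k → ℝ} {T : k → k} (hT : Measurable T)
    (hT0 : T ⁻¹' {0} ⊆ {0})
    (h : ∀ (a : k) (n : ℤ), (q : ℝ) ^ n < ‖a‖ → ∃ (b : k) (m : ℤ) (c : ℝ),
      T ⁻¹' qBall a n = qBall b m ∧ (∀ x ∈ qBall b m, w x = c) ∧ c ^ 2 * (q : ℝ) ^ m =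
      (q : ℝ) ^ n) :
    (μ.withDensity fun x ↦ ENNReal.ofReal (w x ^ 2)).map T = μ := by
  refine (measure_ext_of_qBall (measure_singleton_zero μ) ?_
    (fun a n _ ↦ (measure_qBall_lt_top a n).ne) fun a n ha ↦ ?_).symm
  · rw [Measure.map_apply hT (measurableSet_singleton 0)]
    exact measure_mono_null hT0 (withDensity_absolutelyContinuous _ _ (measure_singleton_zero μ))
  · obtain ⟨b, m, c, h1, h2, h3⟩ := h a n ha
    rw [Measure.map_apply hT (measurableSet_qBall a n), h1,
      withDensity_apply _ (measurableSet_qBall b m),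
      setLIntegral_congr_fun (g := fun _ ↦ ENNReal.ofReal (c ^ 2)) (measurableSet_qBall b m)
        (fun x hx ↦ by simp only [h2 x hx]), lintegral_const, Measure.restrict_apply_univ,
      measure_qBall, measure_qBall, ← ENNReal.ofReal_mul (by positivity), ← mul_assoc, h3]

theorem map_withDensity_inv {k : Type*} [NormedField k] [IsUltrametricDist k] {q : ℕ}
    [NormalizedLocalField k q] [ProperSpace k] [MeasurableSpace k] [BorelSpace k] (μ : Measure k)
    [μ.IsAddHaarMeasure] :
    (μ.withDensity fun x ↦ ENNReal.ofReal (‖x‖⁻¹ ^ 2)).map (·⁻¹) = μ := by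
  refine map_withDensity_eq_of_qBall measurable_inv (by intro x; simp) fun a n ha ↦ ?_
  have ha0 : a ≠ 0 := by rw [← norm_pos_iff]; exact (zpow_q_pos k n).trans ha
  obtain ⟨m, hm⟩ := NormalizedLocalField.norm_eq_zpow a ha0
  rw [hm, zpow_q_lt_iff k] at ha
  -- The preimage has radius q^(n-2m) and the weight |x|⁻¹ is constantly q^m on it; its square
  -- restores q^n.
  refine ⟨a⁻¹, n - 2 * m, (q : ℝ) ^ m, preimage_inv_qBall hm ha, fun x hx ↦ ?_, ?_⟩
  · rw [norm_eq_of_mem_qBall (by rw [norm_inv, hm, ← zpow_neg, zpow_q_lt_iff k]; lia) hx,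
      norm_inv, hm, inv_inv]
  · rw [pow_two, ← zpow_add₀ (q_ne_zero k), ← zpow_add₀ (q_ne_zero k)]; congr 1; ring

theorem map_withDensity_mul {k : Type*} [NormedField k] [IsUltrametricDist k] {q : ℕ}
    [NormalizedLocalField k q] [ProperSpace k] [MeasurableSpace k] [BorelSpace k] (μ : Measure k)
    [μ.IsAddHaarMeasure] (u : kˣ) :
    (μ.withDensity fun _ ↦ ENNReal.ofReal (√‖(u : k)‖ ^ 2)).map ((u : k) * ·) = μ := by
  refine map_withDensity_eq_of_qBall (measurable_const_mul _) (by intro x; simp) fun a n ha ↦ ?_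
  obtain ⟨m, hm⟩ := NormalizedLocalField.norm_eq_zpow (u : k) u.ne_zero
  refine ⟨_, _, _, preimage_mul_qBall hm a n, fun x hx ↦ rfl, ?_⟩
  rw [Real.sq_sqrt (norm_nonneg _), hm, ← zpow_add₀ (q_ne_zero k)]; congr 1; ring

theorem existsUnique_inversion {k : Type*} [NormedField k] [IsUltrametricDist k] {q : ℕ}
    [NormalizedLocalField k q] [ProperSpace k] [MeasurableSpace k] [BorelSpace k] (μ : Measure k)
    [μ.IsAddHaarMeasure] :
    ∃! U : Lp ℂ 2 μ ≃ₗᵢ[ℂ] Lp ℂ 2 μ, ∀ φ, U φ =ᵐ[μ] fun x ↦ ((‖x‖⁻¹ : ℝ) : ℂ) * φ x⁻¹ := by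
  refine existsUnique_weightedComp_equiv measurable_norm.inv measurable_inv
    (map_withDensity_inv μ) measurable_norm.inv measurable_inv (map_withDensity_inv μ) ?_ ?_
  · filter_upwards [ae_ne_zero μ] with x hx
    have : ‖x‖ ≠ 0 := by simpa using hx
    simp [this]
  · filter_upwards [ae_ne_zero μ] with x hx
    simpa using hx

theorem existsUnique_dilation {k : Type*} [NormedField k] [IsUltrametricDist k] {q : ℕ}
    [NormalizedLocalField k q] [ProperSpace k] [MeasurableSpace k] [BorelSpace k] (μ : Measure k)
    [μ.IsAddHaarMeasure] (u : kˣ) :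
    ∃! U : Lp ℂ 2 μ ≃ₗᵢ[ℂ] Lp ℂ 2 μ, ∀ φ, U φ =ᵐ[μ] fun x ↦ (√‖(u : k)‖ : ℂ) * φ (u * x) := by
  refine existsUnique_weightedComp_equiv measurable_const (measurable_const_mul _)
    (map_withDensity_mul μ u)
    measurable_const (measurable_const_mul _) (map_withDensity_mul μ u⁻¹) ?_ ?_
  · refine .of_forall fun x ↦ ⟨?_, by simp⟩
    rw [Units.val_inv_eq_inv_val, norm_inv, Real.sqrt_inv, mul_inv_cancel₀]
    exact (Real.sqrt_pos.2 (norm_pos_iff.2 u.ne_zero)).ne'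
  · exact .of_forall fun x ↦ (Real.sqrt_pos.2 (norm_pos_iff.2 (u⁻¹).ne_zero)).ne'

end HilbertSpace

/-! ### The Fourier transform on `L²` -/

/-- Vectors with the same Gram matrix as a total family are its images under an isometry. -/
theorem exists_linearIsometry_of_gram {E ι : Type*} [NormedAddCommGroup E] [InnerProductSpace ℂ E]
    [CompleteSpace E] {e g : ι → E}
    (hd : (Submodule.span ℂ (Set.range e)).topologicalClosure = ⊤)
    (h : ∀ i j, inner ℂ (g i) (g j) = inner ℂ (e i) (e j)) :
    ∃ U : E →ₗᵢ[ℂ] E, ∀ i, U (e i) = g i := by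
  let L := Finsupp.linearCombination ℂ e
  let G := Finsupp.linearCombination ℂ g
  have hin : ∀ c d, inner ℂ (G c) (G d) = inner ℂ (L c) (L d) := by
    intro c d
    simp only [L, G, Finsupp.linearCombination_apply, Finsupp.sum_inner, Finsupp.inner_sum,
      inner_smul_left, inner_smul_right, h]
  have hnorm : ∀ c, ‖G c‖ = ‖L c‖ := fun c ↦ by
    rw [@norm_eq_sqrt_re_inner ℂ, @norm_eq_sqrt_re_inner ℂ, hin]
  have hdense : DenseRange L := by
    rw [DenseRange, ← LinearMap.coe_range, Finsupp.range_linearCombination,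
      Submodule.dense_iff_topologicalClosure_eq_top, hd]
  have hbd : ∃ C : ℝ, ∀ x, ‖G x‖ ≤ C * ‖L x‖ := ⟨1, fun x ↦ by rw [hnorm, one_mul]⟩
  -- Equality of norms lets `G` factor through `L` even when the family `e` is linearly dependent,
  -- as the indicators of balls are.
  let U := G.extendOfNorm L
  have hU : ∀ c, U (L c) = G c := LinearMap.extendOfNorm_eq hdense hbd
  refine ⟨⟨U.toLinearMap, fun x ↦ ?_⟩, fun i ↦ ?_⟩
  · refine hdense.induction_on (p := fun x ↦ ‖U x‖ = ‖x‖) x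
      (isClosed_eq U.continuous.norm continuous_norm) fun c ↦ ?_
    rw [hU, hnorm]
  · have := hU (Finsupp.single i 1)
    simpa [L, G] using this

section Fourier

variable {k : Type*} [NormedField k] [IsUltrametricDist k] {q : ℕ} [NormalizedLocalField k q]
  [ProperSpace k] [MeasurableSpace k] [BorelSpace k] {μ : Measure k} [μ.IsAddHaarMeasure]
  {ψ : AddChar k Circle} {δ : ℤ}

/-- The Fourier integral for the additive character `ψ`. -/
def fourierInt {k : Type*} [NormedField k] [MeasurableSpace k] (ψ : AddChar k Circle)
    (μ : Measure k) (φ : k → ℂ) (y : k) : ℂ := ∫ x, φ x * (ψ (x * y) : ℂ) ∂μ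

theorem fourierInt_congr_ae {φ φ' : k → ℂ} (h : φ =ᵐ[μ] φ') :
    fourierInt ψ μ φ = fourierInt ψ μ φ' := by
  ext y
  exact integral_congr_ae (h.mono fun x hx ↦ by simp only [hx])

theorem HasAddConductor.continuous (hψ : HasAddConductor ψ δ) : Continuous ψ := by
  refine IsLocallyConstant.continuous ((IsLocallyConstant.iff_eventually_eq _).2 fun x ↦ ?_)
  filter_upwards [(isClopen_qBall x δ).isOpen.mem_nhds (mem_qBall_self x δ)] with y hy
  rw [mem_qBall] at hy
  have : y = x + (y - x) := by ring
  rw [this, AddChar.map_add_eq_mul, hψ.1 _ hy, mul_one]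

/-- The bilinear form is negated to offset the sign in `VectorFourier.fourierIntegral`, which
integrates against ψ(-L(x, y)). -/
theorem fourierInt_eq_vectorFourier (φ : k → ℂ) :
    fourierInt ψ μ φ = VectorFourier.fourierIntegral ψ μ (-LinearMap.mul k k) φ := by
  ext y
  simp [VectorFourier.fourierIntegral, fourierInt, Circle.smul_def, mul_comm]

theorem integral_fourierInt_mul (hψ : HasAddConductor ψ δ) {f g : k → ℂ} (hf : Integrable f μ)
    (hg : Integrable g μ) :
    ∫ x, fourierInt ψ μ f x * g x ∂μ = ∫ x, f x * fourierInt ψ μ g x ∂μ := by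
  have h := VectorFourier.integral_fourierIntegral_smul_eq_flip (L := -LinearMap.mul k k)
    (μ := μ) (ν := μ) hψ.continuous (by
      simp only [LinearMap.neg_apply, LinearMap.mul_apply']; fun_prop) hf hg
  have e : (-LinearMap.mul k k).flip = -LinearMap.mul k k := by
    ext; simp
  rw [e, ← fourierInt_eq_vectorFourier, ← fourierInt_eq_vectorFourier] at h
  exact h

theorem continuous_fourierInt (hψ : HasAddConductor ψ δ) {φ : k → ℂ} (hφ : Integrable φ μ) :
    Continuous (fourierInt ψ μ φ) := by
  rw [fourierInt_eq_vectorFourier]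
  refine VectorFourier.fourierIntegral_continuous hψ.continuous ?_ hφ
  simp only [LinearMap.neg_apply, LinearMap.mul_apply']; fun_prop

/-- Dividing the point just beyond the conductor by y moves it into the ball of radius q^n. -/
theorem HasAddConductor.exists_ne_one (hψ : HasAddConductor ψ δ) {y : k} {n : ℤ}
    (hy : (q : ℝ) ^ (δ - n) < ‖y‖) : ∃ t, ‖t‖ ≤ (q : ℝ) ^ n ∧ ψ (t * y) ≠ 1 := by
  obtain ⟨x, hx, hx1⟩ := hψ.2
  have hy0 : y ≠ 0 := by rw [← norm_pos_iff]; exact (zpow_q_pos k _).trans hy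
  refine ⟨x / y, ?_, by rwa [div_mul_cancel₀ _ hy0]⟩
  obtain ⟨m, hm⟩ := NormalizedLocalField.norm_eq_zpow y hy0
  rw [hm, zpow_q_lt_iff k] at hy
  rw [norm_div, hm, div_le_iff₀ (zpow_q_pos k m), ← zpow_add₀ (q_ne_zero k)]
  exact hx.trans ((zpow_q_le_iff k).2 (by lia))

/-- Translating the variable by t multiplies the integral by ψ(ty), which differs from 1. -/
theorem fourierInt_eq_zero_of_invariant {k : Type*} [NormedField k] [MeasurableSpace k]
    [BorelSpace k] {μ : Measure k} [μ.IsAddHaarMeasure] {ψ : AddChar k Circle} {φ : k → ℂ}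
    {t y : k} (hφ : ∀ x, φ (x + t) = φ x)
    (ht : ψ (t * y) ≠ 1) : fourierInt ψ μ φ y = 0 := by
  have h : fourierInt ψ μ φ y = (ψ (t * y) : ℂ) * fourierInt ψ μ φ y := by
    conv_lhs => rw [fourierInt, ← integral_add_right_eq_self _ t]
    rw [fourierInt, ← integral_const_mul]
    refine integral_congr_ae (.of_forall fun x ↦ ?_)
    simp only [hφ, add_mul, AddChar.map_add_eq_mul, Circle.coe_mul]
    ring
  have h1 : (ψ (t * y) : ℂ) - 1 ≠ 0 := by
    rwa [sub_ne_zero, Ne, Circle.coe_eq_one]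
  have h2 : ((ψ (t * y) : ℂ) - 1) * fourierInt ψ μ φ y = 0 := by linear_combination -h
  exact (mul_eq_zero.1 h2).resolve_left h1

/-- For y in the dual ball, x ↦ ψ(xy) is constant on the ball; for other y, invariance of the
indicator under small translations kills the integral. -/
theorem fourierInt_indicator_qBall (hψ : HasAddConductor ψ δ) (a : k) (n : ℤ) :
    fourierInt ψ μ ((qBall a n).indicator 1) =
      (qBall 0 (δ - n)).indicator fun y ↦ (μ.real (qBall a n) : ℂ) * (ψ (a * y) : ℂ) := by
  ext y
  by_cases hy : y ∈ qBall 0 (δ - n)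
  · rw [Set.indicator_of_mem hy, fourierInt]
    have : ∀ x, (qBall a n).indicator 1 x * (ψ (x * y) : ℂ) =
        (qBall a n).indicator (fun _ ↦ (ψ (a * y) : ℂ)) x := by
      intro x
      by_cases hx : x ∈ qBall a n
      · rw [Set.indicator_of_mem hx, Set.indicator_of_mem hx, Pi.one_apply, one_mul]
        have e : x * y = a * y + (x - a) * y := by ring
        rw [e, AddChar.map_add_eq_mul, hψ.1 ((x - a) * y), mul_one]
        rw [mem_qBall] at hx
        rw [mem_qBall_zero] at hy
        rw [norm_mul]
        calc _ ≤ (q : ℝ) ^ n * (q : ℝ) ^ (δ - n) := by gcongr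
          _ = _ := by rw [← zpow_add₀ (q_ne_zero k)]; congr 1; ring
      · rw [Set.indicator_of_notMem hx, Set.indicator_of_notMem hx, zero_mul]
    simp_rw [this]
    rw [integral_indicator (measurableSet_qBall a n), setIntegral_const, Complex.real_smul]
  · rw [Set.indicator_of_notMem hy]
    rw [mem_qBall_zero, not_le] at hy
    obtain ⟨t, ht, ht1⟩ := hψ.exists_ne_one hy
    refine fourierInt_eq_zero_of_invariant (t := t) (fun x ↦ ?_) ht1
    by_cases hx : x ∈ qBall a n
    · rw [Set.indicator_of_mem hx, Set.indicator_of_mem ((add_mem_qBall_iff ht).2 hx)]; rfl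
    · rw [Set.indicator_of_notMem hx, Set.indicator_of_notMem (mt (add_mem_qBall_iff ht).1 hx)]

theorem integrable_indicator_qBall (a : k) (n : ℤ) :
    Integrable ((qBall a n).indicator (1 : k → ℂ)) μ :=
  (integrable_indicator_iff (measurableSet_qBall a n)).2
    (integrableOn_const (measure_qBall_lt_top a n).ne)

theorem memLp_fourierInt_indicator (hψ : HasAddConductor ψ δ) (p : ℝ≥0∞) (a : k) (n : ℤ) :
    MemLp (fourierInt ψ μ ((qBall a n).indicator 1)) p μ := by
  rw [fourierInt_indicator_qBall hψ, memLp_indicator_iff_restrict (measurableSet_qBall _ _)]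
  have : IsFiniteMeasure (μ.restrict (qBall 0 (δ - n))) :=
    ⟨by simpa using measure_qBall_lt_top (0 : k) (δ - n)⟩
  refine MemLp.of_bound (Continuous.aestronglyMeasurable ?_) (μ.real (qBall a n))
    (.of_forall fun y ↦ by simp [Circle.norm_coe, abs_of_nonneg measureReal_nonneg])
  have := hψ.continuous
  fun_prop

variable (μ) in
/-- The Fourier transform of the indicator function of a ball, as an element of `L²`. -/
def fourierBallInd (hψ : HasAddConductor ψ δ) (a : k) (n : ℤ) : Lp ℂ 2 μ :=
  (memLp_fourierInt_indicator (μ := μ) hψ 2 a n).toLp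

theorem fourierBallInd_ae (hψ : HasAddConductor ψ δ) (a : k) (n : ℤ) :
    fourierBallInd μ hψ a n =ᵐ[μ] fourierInt ψ μ ((qBall a n).indicator 1) :=
  (memLp_fourierInt_indicator (μ := μ) hψ 2 a n).coeFn_toLp

theorem setIntegral_qBall_fourierInt (hψ : HasAddConductor ψ δ) {φ : k → ℂ} (hφ : Integrable φ μ)
    (a : k) (n : ℤ) : ∫ x in qBall a n, fourierInt ψ μ φ x ∂μ =
      ∫ x, φ x * fourierInt ψ μ ((qBall a n).indicator 1) x ∂μ := by
  rw [← integral_fourierInt_mul hψ hφ (integrable_indicator_qBall a n),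
    ← integral_indicator (measurableSet_qBall a n)]
  refine integral_congr_ae (.of_forall fun x ↦ ?_)
  by_cases hx : x ∈ qBall a n <;> simp [hx]

/-- Conjugating the transform of the indicator of a ball replaces its centre by the opposite one;
then the transform is moved to the other factor by Fubini. -/
theorem inner_fourierBallInd (hψ : HasAddConductor ψ δ) {φ : Lp ℂ 2 μ} (hφ : Integrable φ μ)
    (a : k) (n : ℤ) : inner ℂ (fourierBallInd μ hψ a n) φ =
      ∫ x in qBall (-a) n, fourierInt ψ μ φ x ∂μ := by
  rw [setIntegral_qBall_fourierInt hψ hφ, L2.inner_def]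
  refine integral_congr_ae ?_
  filter_upwards [fourierBallInd_ae hψ a n (μ := μ)] with x hx
  rw [hx, fourierInt_indicator_qBall hψ, fourierInt_indicator_qBall hψ, RCLike.inner_apply]
  by_cases h : x ∈ qBall 0 (δ - n)
  · rw [Set.indicator_of_mem h, Set.indicator_of_mem h, measureReal_qBall μ a,
      measureReal_qBall μ (-a), map_mul, Complex.conj_ofReal, neg_mul, AddChar.map_neg_eq_inv,
      Circle.coe_inv_eq_conj]
  · simp [h]

theorem isLocallyConstant_indicator_qBall (a : k) (n : ℤ) :
    IsLocallyConstant ((qBall a n).indicator (1 : k → ℂ)) := by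
  rw [← LocallyConstant.coe_charFn ℂ (isClopen_qBall a n)]
  exact LocallyConstant.isLocallyConstant _

theorem hasCompactSupport_indicator_qBall (a : k) (n : ℤ) :
    HasCompactSupport ((qBall a n).indicator (1 : k → ℂ)) :=
  .intro (isCompact_qBall a n) fun _ hx ↦ Set.indicator_of_notMem hx _

theorem integrable_ballInd (a : k) (n : ℤ) : Integrable (ballInd μ a n) μ :=
  (integrable_indicator_qBall a n).congr (ballInd_ae a n).symm

/-- `U` is given by the Fourier integral on `L¹ ∩ L²`. -/
def IsFourier (ψ : AddChar k Circle) (U : Lp ℂ 2 μ → Lp ℂ 2 μ) : Prop :=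
  ∀ φ : Lp ℂ 2 μ, Integrable φ μ → U φ =ᵐ[μ] fourierInt ψ μ φ

/-- Self-duality makes the Gram matrix of the transformed indicators equal to that of the
indicators, which are total; the resulting isometry is then identified with the Fourier integral by
testing on balls. -/
theorem existsUnique_isFourier (hψ : HasAddConductor ψ δ)
    (hsd : ∀ φ : k → ℂ, IsLocallyConstant φ → HasCompactSupport φ →
      ∀ x, fourierInt ψ μ (fourierInt ψ μ φ) x = φ (-x)) :
    ∃! U : Lp ℂ 2 μ ≃ₗᵢ[ℂ] Lp ℂ 2 μ, IsFourier ψ U := by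
  have hff : ∀ (a : k) (n : ℤ), fourierInt ψ μ (fourierBallInd μ hψ a n) =
      (qBall (-a) n).indicator 1 := by
    intro a n
    rw [fourierInt_congr_ae (fourierBallInd_ae hψ a n)]
    ext x
    rw [hsd _ (isLocallyConstant_indicator_qBall a n) (hasCompactSupport_indicator_qBall a n)]
    have : -x ∈ qBall a n ↔ x ∈ qBall (-a) n := by
      rw [mem_qBall, mem_qBall, ← norm_neg]; congr! 2; ring
    by_cases h : x ∈ qBall (-a) n <;> simp [h, this]
  have hint : ∀ (a : k) (n : ℤ), Integrable (fourierBallInd μ hψ a n) μ := fun a n ↦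
    (memLp_one_iff_integrable.1 (memLp_fourierInt_indicator hψ 1 a n)).congr
      (fourierBallInd_ae hψ a n).symm
  let e : k × ℤ → Lp ℂ 2 μ := fun i ↦ ballInd μ i.1 i.2
  let g : k × ℤ → Lp ℂ 2 μ := fun i ↦ fourierBallInd μ hψ i.1 i.2
  have hrange : Set.range e = {φ | ∃ (a : k) (n : ℤ), φ = ballInd μ a n} := by
    ext φ; simp [e, eq_comm]
  have hd : (Submodule.span ℂ (Set.range e)).topologicalClosure = ⊤ := by
    rw [hrange]; exact closure_span_ballInd μ
  have hgram : ∀ i j, inner ℂ (g i) (g j) = inner ℂ (e i) (e j) := by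
    rintro ⟨a, m⟩ ⟨b, n⟩
    simp only [e, g]
    -- The double transform of an indicator is that of the reflected ball, and x ↦ -x turns the
    -- overlap of the reflected balls into that of the original ones.
    rw [inner_fourierBallInd hψ (hint b n), inner_ballInd, hff,
      ← integral_indicator (measurableSet_qBall _ _),
      ← integral_indicator (measurableSet_qBall _ _), ← integral_neg_eq_self]
    refine integral_congr_ae ?_
    filter_upwards [ballInd_ae (μ := μ) b n] with x hx
    have e1 : ∀ (c : k) (l : ℤ), -x ∈ qBall (-c) l ↔ x ∈ qBall c l := by
      intro c l
      rw [mem_qBall, mem_qBall, ← norm_neg]; congr! 2; ring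
    simp only [Set.indicator, hx, Pi.one_apply]
    have ha := e1 a m
    have hb := e1 b n
    by_cases h1 : x ∈ qBall a m <;> by_cases h2 : x ∈ qBall b n <;> simp [ha, hb, h1, h2]
  obtain ⟨U, hU⟩ := exists_linearIsometry_of_gram hd hgram
  have hUF : IsFourier ψ U := by
    intro φ hφ
    -- The weak form of the Fourier integral: verified on indicators, then extended to all of L² by
    -- density and continuity.
    have h1 : ∀ (a : k) (n : ℤ) (φ : Lp ℂ 2 μ),
        inner ℂ (ballInd μ a n) (U φ) = inner ℂ (fourierBallInd μ hψ (-a) n) φ := by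
      intro a n φ
      have hdense : Dense (Submodule.span ℂ (Set.range e) : Set (Lp ℂ 2 μ)) := by
        rw [Submodule.dense_iff_topologicalClosure_eq_top, hd]
      refine hdense.induction (P := fun φ ↦ inner ℂ (ballInd μ a n) (U φ) =
        inner ℂ (fourierBallInd μ hψ (-a) n) φ) (fun φ hφ ↦ ?_)
        (isClosed_eq (by fun_prop) (by fun_prop)) φ
      induction hφ using Submodule.span_induction with
      | mem x hx =>
        obtain ⟨⟨b, m⟩, rfl⟩ := hx
        rw [hU, inner_fourierBallInd hψ (integrable_ballInd b m), inner_ballInd, neg_neg,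
          fourierInt_congr_ae (ballInd_ae b m)]
        exact integral_congr_ae (ae_restrict_of_ae (fourierBallInd_ae hψ b m))
      | zero => simp
      | add x y _ _ hx hy => rw [map_add, inner_add_right, inner_add_right, hx, hy]
      | smul c x _ hx => rw [map_smul, inner_smul_right, inner_smul_right, hx]
    have hb : ∀ y, ‖fourierInt ψ μ φ y‖ ≤ ∫ x, ‖φ x‖ ∂μ := fun y ↦
      (norm_integral_le_integral_norm _).trans (by simp [Circle.norm_coe])
    have hm : AEStronglyMeasurable (fourierInt ψ μ φ) μ :=
      (continuous_fourierInt hψ hφ).aestronglyMeasurable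
    have h2 : ∀ (a : k) (n : ℤ), IntegrableOn (fourierInt ψ μ φ) (qBall a n) μ := fun a n ↦
      Measure.integrableOn_of_bounded (measure_qBall_lt_top a n).ne hm (.of_forall hb)
    -- For integrable φ, the weak form says that U φ and the Fourier integral have equal integrals
    -- over every ball.
    have h3 := ae_eq_zero_of_setIntegral_qBall (measure_singleton_zero μ)
      (f := fun x ↦ U φ x - fourierInt ψ μ φ x)
      (fun a n _ ↦ (integrableOn_of_isCompact (U φ) (isCompact_qBall a n)).sub (h2 a n))
      fun a n _ ↦ by
        rw [integral_sub (integrableOn_of_isCompact (U φ) (isCompact_qBall a n)) (h2 a n),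
          ← inner_ballInd, h1, inner_fourierBallInd hψ hφ, neg_neg, sub_self]
    filter_upwards [h3] with x hx
    exact sub_eq_zero.1 hx
  have huniq : ∀ V : Lp ℂ 2 μ →ₗᵢ[ℂ] Lp ℂ 2 μ, IsFourier ψ V → V = U := by
    intro V hV
    have hdense : Dense (Submodule.span ℂ (Set.range e) : Set (Lp ℂ 2 μ)) := by
      rw [Submodule.dense_iff_topologicalClosure_eq_top, hd]
    have : V.toContinuousLinearMap = U.toContinuousLinearMap := by
      refine ContinuousLinearMap.ext_on hdense ?_
      rintro _ ⟨⟨a, n⟩, rfl⟩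
      exact Lp.ext ((hV _ (integrable_ballInd a n)).trans (hUF _ (integrable_ballInd a n)).symm)
    ext1 x
    exact congrArg (fun T ↦ T x) this
  -- The range of an isometry of a complete space is closed, and it contains every indicator because
  -- the double transform is the reflection.
  have hsurj : Function.Surjective U := by
    have hc : IsClosed (LinearMap.range U.toLinearMap : Set (Lp ℂ 2 μ)) := by
      rw [LinearMap.coe_range]
      exact U.isometry.isClosedEmbedding.isClosed_range
    have : LinearMap.range U.toLinearMap = ⊤ := by
      rw [eq_top_iff, ← hd]
      refine Submodule.topologicalClosure_minimal _ (Submodule.span_le.2 ?_) hc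
      rintro _ ⟨⟨a, n⟩, rfl⟩
      refine ⟨fourierBallInd μ hψ (-a) n, Lp.ext ?_⟩
      refine (hUF _ (hint (-a) n)).trans ?_
      rw [hff, neg_neg]
      exact (ballInd_ae a n).symm
    exact LinearMap.range_eq_top.1 this
  refine ⟨LinearIsometryEquiv.ofSurjective U hsurj, hUF, fun V hV ↦ ?_⟩
  ext1 x
  exact congrArg (fun T : Lp ℂ 2 μ →ₗᵢ[ℂ] Lp ℂ 2 μ ↦ T x) (huniq V.toLinearIsometry hV)

end Fourier

section Cuspidal

open Metric

variable {k : Type*} [NormedField k] [IsUltrametricDist k] {q : ℕ} [NormalizedLocalField k q]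
  [ProperSpace k] [MeasurableSpace k] [BorelSpace k] {μ : Measure k} [μ.IsAddHaarMeasure]

/-! ### The cuspidal subspace -/

/-- The sphere of radius `q ^ j` about `0`. -/
def qSphere {k : Type*} [NormedField k] {q : ℕ} [NormalizedLocalField k q] (j : ℤ) : Set k :=
  sphere 0 ((q : ℝ) ^ j)

theorem mem_qSphere {x : k} {j : ℤ} : x ∈ qSphere j ↔ ‖x‖ = (q : ℝ) ^ j := by
  rw [qSphere, mem_sphere_zero_iff_norm]

theorem isClosed_qSphere (j : ℤ) : IsClosed (qSphere j : Set k) := isClosed_sphere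

theorem isCompact_qSphere (j : ℤ) : IsCompact (qSphere j : Set k) := isCompact_sphere _ _

theorem measurableSet_qSphere (j : ℤ) : MeasurableSet (qSphere j : Set k) :=
  (isClosed_qSphere j).measurableSet

theorem qSphere_subset (j : ℤ) : (qSphere j : Set k) ⊆ qBall 0 j := sphere_subset_closedBall

theorem qBall_subset_qSphere {a : k} {n j : ℤ} (ha : ‖a‖ = (q : ℝ) ^ j) (h : n < j) :
    qBall a n ⊆ qSphere j := fun x hx ↦ by
  rw [mem_qSphere, norm_eq_of_mem_qBall (by rwa [ha, zpow_q_lt_iff k]) hx, ha]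

theorem sphere_one_eq : sphere (0 : k) 1 = qSphere 0 := by rw [qSphere, zpow_zero]

theorem dilation_ballInd {R : kˣ → (Lp ℂ 2 μ ≃ₗᵢ[ℂ] Lp ℂ 2 μ)}
    (hR : ∀ u φ, R u φ =ᵐ[μ] fun x ↦ (√‖(u : k)‖ : ℂ) * φ (u * x)) {u : kˣ} (hu : ‖(u : k)‖ = 1)
    (a : k) (n : ℤ) : R u (ballInd μ (u * a) n) = ballInd μ a n := by
  have hqmp : Measure.QuasiMeasurePreserving ((u : k) * ·) μ μ := by
    refine ⟨measurable_const_mul _, ?_⟩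
    have h := map_withDensity_mul μ u
    simp only [hu, Real.sqrt_one, one_pow, ENNReal.ofReal_one, withDensity_const, one_smul] at h
    rw [h]
  refine Lp.ext ?_
  filter_upwards [hR u (ballInd μ (u * a) n), ballInd_ae (μ := μ) a n,
    hqmp.ae (ballInd_ae (μ := μ) (u * a) n)] with x h1 h2 h3
  rw [h1, h2, h3, hu]
  have : (u : k) * x ∈ qBall ((u : k) * a) n ↔ x ∈ qBall a n := by
    rw [mem_qBall, mem_qBall, ← mul_sub, norm_mul, hu, one_mul]
  by_cases h : x ∈ qBall a n <;> simp [this, h]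

open scoped Classical in
/-- The function `u ↦ R u φ` on `k`, with value `0` at `u = 0`. -/
def unitOrbit (R : kˣ → (Lp ℂ 2 μ ≃ₗᵢ[ℂ] Lp ℂ 2 μ)) (φ : Lp ℂ 2 μ) (u : k) : Lp ℂ 2 μ :=
  if h : u = 0 then 0 else R (Units.mk0 u h) φ

theorem norm_unitOrbit_le (R : kˣ → (Lp ℂ 2 μ ≃ₗᵢ[ℂ] Lp ℂ 2 μ)) (φ : Lp ℂ 2 μ) (u : k) :
    ‖unitOrbit R φ u‖ ≤ ‖φ‖ := by
  unfold unitOrbit; split_ifs <;> simp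

theorem unitOrbit_sub (R : kˣ → (Lp ℂ 2 μ ≃ₗᵢ[ℂ] Lp ℂ 2 μ)) (φ φ' : Lp ℂ 2 μ) (u : k) :
    unitOrbit R (φ - φ') u = unitOrbit R φ u - unitOrbit R φ' u := by
  unfold unitOrbit; split_ifs <;> simp

/-! ### The averaging operator over the unit sphere -/

section Averaging

variable {R : kˣ → (Lp ℂ 2 μ ≃ₗᵢ[ℂ] Lp ℂ 2 μ)}
  (hR : ∀ u φ, R u φ =ᵐ[μ] fun x ↦ (√‖(u : k)‖ : ℂ) * φ (u * x))

include hR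

theorem unitOrbit_ballInd {u : k} (hu : ‖u‖ = 1) (a : k) (n : ℤ) :
    unitOrbit R (ballInd μ a n) u = ballInd μ (u⁻¹ * a) n := by
  have hu0 : u ≠ 0 := by rintro rfl; simp at hu
  have := dilation_ballInd hR (u := Units.mk0 u hu0) hu (u⁻¹ * a) n
  rw [Units.val_mk0, mul_inv_cancel_left₀ hu0] at this
  rw [unitOrbit, dif_neg hu0, this]

theorem continuousOn_unitOrbit_ballInd (a : k) (n : ℤ) :
    ContinuousOn (unitOrbit R (ballInd μ a n)) (qSphere 0) := by
  intro u hu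
  have hu0 : u ≠ 0 := by rintro rfl; simp [mem_qSphere] at hu
  refine (continuousWithinAt_const (b := ballInd μ (u⁻¹ * a) n)).congr_of_eventuallyEq ?_ ?_
  · have hc : ContinuousAt (fun w : k ↦ w⁻¹ * a) u := (continuousAt_inv₀ hu0).mul continuousAt_const
    have h1 := hc.eventually ((isClopen_qBall (u⁻¹ * a) n).isOpen.mem_nhds (mem_qBall_self _ n))
    filter_upwards [h1.filter_mono nhdsWithin_le_nhds, self_mem_nhdsWithin] with w hw hw1
    rw [unitOrbit_ballInd hR (by simpa [mem_qSphere] using hw1)]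
    have : qBall (w⁻¹ * a) n = qBall (u⁻¹ * a) n := (qBall_eq_of_mem hw).symm
    simp only [ballInd, this]
  · exact unitOrbit_ballInd hR (by simpa [mem_qSphere] using hu) a n

/-- The orbit of a ball indicator is locally constant on the unit sphere; approximating φ by
combinations of indicators is uniform in u, since the R(u) are isometries. -/
theorem aestronglyMeasurable_unitOrbit (φ : Lp ℂ 2 μ) :
    AEStronglyMeasurable (unitOrbit R φ) (μ.restrict (qSphere 0)) := by
  have hd := closure_span_ballInd μ
  have hφ : φ ∈ closure (Submodule.span ℂ {φ : Lp ℂ 2 μ | ∃ (a : k) (n : ℤ),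
      φ = ballInd μ a n} : Set (Lp ℂ 2 μ)) := by
    rw [← Submodule.topologicalClosure_coe, hd]; trivial
  obtain ⟨φs, hφs, hl⟩ := mem_closure_iff_seq_limit.1 hφ
  refine aestronglyMeasurable_of_tendsto_ae Filter.atTop (f := fun n ↦ unitOrbit R (φs n))
    (fun n ↦ ?_) (.of_forall fun u ↦ ?_)
  · have := hφs n
    generalize φs n = x at this
    induction this using Submodule.span_induction with
    | mem x hx =>
      obtain ⟨a, n, rfl⟩ := hx
      exact (continuousOn_unitOrbit_ballInd hR a n).aestronglyMeasurable (measurableSet_qSphere 0)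
    | zero =>
      have : unitOrbit R 0 = 0 := by ext1 u; unfold unitOrbit; split_ifs <;> simp
      rw [this]; exact aestronglyMeasurable_zero
    | add x y _ _ hx hy =>
      have : unitOrbit R (x + y) = unitOrbit R x + unitOrbit R y := by
        ext1 u; simp only [Pi.add_apply]; unfold unitOrbit; split_ifs <;> simp
      rw [this]; exact hx.add hy
    | smul c x _ hx =>
      have : unitOrbit R (c • x) = c • unitOrbit R x := by
        ext1 u; simp only [Pi.smul_apply]; unfold unitOrbit; split_ifs <;> simp
      rw [this]; exact hx.const_smul c
  · rw [tendsto_iff_norm_sub_tendsto_zero]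
    refine squeeze_zero (fun _ ↦ norm_nonneg _) (fun n ↦ ?_)
      (tendsto_iff_norm_sub_tendsto_zero.1 hl)
    rw [← unitOrbit_sub]
    exact norm_unitOrbit_le R _ u

theorem integrableOn_unitOrbit (φ : Lp ℂ 2 μ) : IntegrableOn (unitOrbit R φ) (qSphere 0) μ := by
  have : IsFiniteMeasure (μ.restrict (qSphere 0 : Set k)) :=
    ⟨by simpa using (isCompact_qSphere 0).measure_lt_top⟩
  exact Integrable.of_bound (aestronglyMeasurable_unitOrbit hR φ) ‖φ‖
    (.of_forall fun u ↦ norm_unitOrbit_le R φ u)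

/-- For |u| = 1 the pairing is the integral of φ over the ball of radius q^n about ua. By Fubini
each x on the sphere is weighted by the measure of the u with x in that ball, and these form the
ball of radius q^(n-j) about x/a. The weight is thus the same for all x. -/
theorem inner_ballInd_integral_unitOrbit {a : k} {n j : ℤ} (ha : ‖a‖ = (q : ℝ) ^ j) (hn : n < j)
    (φ : Lp ℂ 2 μ) : inner ℂ (ballInd μ a n) (∫ u in qSphere 0, unitOrbit R φ u ∂μ) =
      μ.real (qBall (0 : k) (n - j)) * ∫ x in qSphere j, φ x ∂μ := by
  have ha0 : a ≠ 0 := by rw [← norm_pos_iff, ha]; exact zpow_q_pos k j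
  have hfin : ∀ i : ℤ, IsFiniteMeasure (μ.restrict (qSphere i : Set k)) := fun i ↦
    ⟨by simpa using (isCompact_qSphere i).measure_lt_top⟩
  have := hfin 0
  have := hfin j
  have hstep : ∀ u ∈ (qSphere 0 : Set k), inner ℂ (ballInd μ a n) (unitOrbit R φ u) =
      ∫ x in qSphere j, {p : k × k | ‖p.2 - p.1 * a‖ ≤ (q : ℝ) ^ n}.indicator
        (fun p ↦ φ p.2) (u, x) ∂μ := by
    intro u hu
    have hu1 : ‖u‖ = 1 := by simpa [mem_qSphere] using hu
    have hu0 : u ≠ 0 := by rintro rfl; simp at hu1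
    rw [unitOrbit, dif_neg hu0, ← dilation_ballInd hR (u := Units.mk0 u hu0) hu1 a n,
      LinearIsometryEquiv.inner_map_map, inner_ballInd, Units.val_mk0]
    have hsub : qBall (u * a) n ⊆ qSphere j :=
      qBall_subset_qSphere (by rw [norm_mul, hu1, ha, one_mul]) hn
    rw [← Set.inter_eq_right.2 hsub, ← setIntegral_indicator (measurableSet_qBall _ _)]
    refine integral_congr_ae (.of_forall fun x ↦ ?_)
    simp only [Set.indicator, mem_qBall, Set.mem_ofPred_eq]
  rw [← integral_inner (integrableOn_unitOrbit hR φ),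
    setIntegral_congr_fun (measurableSet_qSphere 0) hstep, integral_integral_swap]
  · have hin : ∀ x ∈ (qSphere j : Set k),
        ∫ u in qSphere 0, {p : k × k | ‖p.2 - p.1 * a‖ ≤ (q : ℝ) ^ n}.indicator
          (fun p ↦ φ p.2) (u, x) ∂μ = μ.real (qBall (0 : k) (n - j)) * φ x := by
      intro x hx
      rw [mem_qSphere] at hx
      have hxa : ‖x / a‖ = (q : ℝ) ^ (0 : ℤ) := by
        rw [norm_div, hx, ha, div_self (zpow_q_pos k j).ne', zpow_zero]
      have hsub : qBall (x / a) (n - j) ⊆ qSphere 0 := qBall_subset_qSphere hxa (by lia)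
      have e : ∀ u, {p : k × k | ‖p.2 - p.1 * a‖ ≤ (q : ℝ) ^ n}.indicator
          (fun p ↦ φ p.2) (u, x) = (qBall (x / a) (n - j)).indicator (fun _ ↦ φ x) u := by
        intro u
        have : ‖x - u * a‖ ≤ (q : ℝ) ^ n ↔ u ∈ qBall (x / a) (n - j) := by
          have h : x - u * a = -(a * (u - x / a)) := by field_simp; ring
          rw [mem_qBall, h, norm_neg, norm_mul, ha, zpow_sub₀ (q_ne_zero k),
            le_div_iff₀' (zpow_q_pos k j)]
        by_cases h : u ∈ qBall (x / a) (n - j) <;>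
          simp only [Set.indicator, Set.mem_ofPred_eq, this, h, if_true, if_false]
      simp_rw [e]
      rw [setIntegral_indicator (measurableSet_qBall _ _), Set.inter_eq_right.2 hsub,
        setIntegral_const, measureReal_qBall_center, Complex.real_smul]
    rw [setIntegral_congr_fun (measurableSet_qSphere j) hin, integral_const_mul]
  · refine Integrable.indicator ?_ ?_
    · exact (integrableOn_of_isCompact φ (isCompact_qSphere j)).comp_snd _
    · refine IsClosed.measurableSet (isClosed_le ?_ continuous_const)
      fun_prop

/-- A function is cuspidal if and only if its integrals over all spheres vanish. -/
theorem integral_unitOrbit_eq_zero_iff (φ : Lp ℂ 2 μ) :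
    ∫ u in qSphere 0, unitOrbit R φ u ∂μ = 0 ↔ ∀ j : ℤ, ∫ x in qSphere j, φ x ∂μ = 0 := by
  constructor
  · intro h j
    obtain ⟨a, ha⟩ := exists_norm_eq_zpow k j
    have h1 := inner_ballInd_integral_unitOrbit hR ha (sub_one_lt j) φ
    rw [h, inner_zero_right, eq_comm, mul_eq_zero] at h1
    refine h1.resolve_left ?_
    exact_mod_cast (measureReal_qBall_pos μ _ _).ne'
  · intro h
    refine Lp_eq_zero_of_setIntegral_qBall fun a n ha ↦ ?_
    have ha0 : a ≠ 0 := by rw [← norm_pos_iff]; exact (zpow_q_pos k n).trans ha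
    obtain ⟨j, hj⟩ := NormalizedLocalField.norm_eq_zpow a ha0
    rw [← inner_ballInd, inner_ballInd_integral_unitOrbit hR hj
      (by rwa [hj, zpow_q_lt_iff k] at ha), h, mul_zero]

end Averaging

end Cuspidal

section Level

open Metric

variable {k : Type*} [NormedField k] [IsUltrametricDist k] {q : ℕ} [NormalizedLocalField k q]
  [ProperSpace k] [MeasurableSpace k] [BorelSpace k] {μ : Measure k} [μ.IsAddHaarMeasure]
  {ψ : AddChar k Circle} {δ : ℤ}

/-! ### Functions of a given level -/

/-- Functions invariant under translation by a ball are orthogonal to functions whose averages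
over the translates of that ball vanish. -/
theorem integral_mul_eq_zero_of_avg {h g : k → ℂ} {n : ℤ} (hc : Continuous h)
    (hs : HasCompactSupport h) (hg : Continuous g) (h0 : ∀ a, ∫ x in qBall a n, h x ∂μ = 0)
    (hgn : ∀ x t, ‖t‖ ≤ (q : ℝ) ^ n → g (x + t) = g x) : ∫ x, h x * g x ∂μ = 0 := by
  set B : k → ℂ := (qBall 0 n).indicator 1 with hB
  have hBc : Continuous B := (isLocallyConstant_indicator_qBall 0 n).continuous
  -- The average of h(x+t) g(x) over t in the ball is computed in both orders: the inner average of
  -- h vanishes, while shifting x shows that every t contributes the integral of h g.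
  have hsw : ∫ x, ∫ t, B t * h (x + t) * g x ∂μ ∂μ = ∫ t, ∫ x, B t * h (x + t) * g x ∂μ ∂μ := by
    refine integral_integral_swap_of_hasCompactSupport (f := fun x t ↦ B t * h (x + t) * g x)
      ?_ ?_
    · simp only [Function.uncurry_def]; fun_prop
    · refine HasCompactSupport.intro (((isCompact_qBall (0 : k) n).prod hs.isCompact).image
        (f := fun p : k × k ↦ (p.2 - p.1, p.1)) (by fun_prop)) fun p hp ↦ ?_
      have : p.2 ∉ qBall 0 n ∨ p.1 + p.2 ∉ tsupport h := by
        by_contra! hcon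
        exact hp ⟨(p.2, p.1 + p.2), ⟨hcon.1, hcon.2⟩, by simp⟩
      rcases this with h1 | h1
      · simp [Function.uncurry, hB, h1]
      · simp [Function.uncurry, image_eq_zero_of_notMem_tsupport h1]
  have hl : ∀ x, ∫ t, B t * h (x + t) * g x ∂μ = 0 := fun x ↦ by
    rw [integral_mul_const]
    have : ∀ t, B t * h (x + t) = (qBall x n).indicator h (x + t) := fun t ↦ by
      by_cases ht : t ∈ qBall 0 n
      · have : x + t ∈ qBall x n := by rw [mem_qBall]; simpa using mem_qBall_zero.1 ht
        simp [hB, ht, this]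
      · have : x + t ∉ qBall x n := by rw [mem_qBall]; simpa using fun h ↦ ht (mem_qBall_zero.2 h)
        simp [hB, ht, this]
    simp only [this]
    rw [integral_add_left_eq_self, integral_indicator (measurableSet_qBall x n), h0, zero_mul]
  have hr : ∀ t, ∫ x, B t * h (x + t) * g x ∂μ = B t * ∫ x, h x * g x ∂μ := fun t ↦ by
    by_cases ht : t ∈ qBall 0 n
    · simp only [mul_assoc]
      rw [integral_const_mul, ← integral_add_right_eq_self (fun x ↦ h x * g x) t]
      simp only [hgn _ t (mem_qBall_zero.1 ht)]
    · simp [hB, ht]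
  simp only [hl, hr, integral_zero] at hsw
  have hB1 : ∫ t, B t ∂μ = μ.real (qBall 0 n : Set k) := by
    rw [hB, integral_indicator (measurableSet_qBall _ _)]; simp
  rw [integral_mul_const, hB1] at hsw
  exact (mul_eq_zero.1 hsw.symm).resolve_left (by exact_mod_cast (measureReal_qBall_pos μ 0 n).ne')

variable (μ) in
/-- The functions of level `f` on the sphere of radius `q ^ j`: they are invariant under the
translations by the ball of radius `q ^ (j - f)`, and their averages over the balls of the next
larger radius vanish. -/
structure IsLevel (f : ℕ) (j : ℤ) (h : k → ℂ) : Prop where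
  supp : ∀ x, ‖x‖ ≠ (q : ℝ) ^ j → h x = 0
  inv : ∀ x t, ‖t‖ ≤ (q : ℝ) ^ (j - f) → h (x + t) = h x
  avg : ∀ a, ∫ x in qBall a (j - f + 1), h x ∂μ = 0

variable {f : ℕ} {j : ℤ} {h : k → ℂ}

theorem isLocallyConstant_of_invariant {Y : Type*} {h : k → Y} {n : ℤ}
    (hn : ∀ x t, ‖t‖ ≤ (q : ℝ) ^ n → h (x + t) = h x) : IsLocallyConstant h := by
  refine (IsLocallyConstant.iff_eventually_eq _).2 fun x ↦ ?_
  filter_upwards [(isClopen_qBall x n).isOpen.mem_nhds (mem_qBall_self x n)] with y hy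
  simpa using hn x (y - x) (mem_qBall.1 hy)

theorem IsLevel.isLocallyConstant (hh : IsLevel μ f j h) : IsLocallyConstant h :=
  isLocallyConstant_of_invariant hh.inv

theorem IsLevel.continuous (hh : IsLevel μ f j h) : Continuous h :=
  hh.isLocallyConstant.continuous

theorem IsLevel.eq_zero_of_notMem (hh : IsLevel μ f j h) {x : k} (hx : x ∉ qSphere j) : h x = 0 :=
  hh.supp x (by rwa [mem_qSphere] at hx)

theorem IsLevel.hasCompactSupport (hh : IsLevel μ f j h) : HasCompactSupport h :=
  .intro (isCompact_qSphere j) fun _ ↦ hh.eq_zero_of_notMem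

theorem IsLevel.integrable (hh : IsLevel μ f j h) : Integrable h μ :=
  hh.continuous.integrable_of_hasCompactSupport hh.hasCompactSupport

theorem IsLevel.memLp (hh : IsLevel μ f j h) : MemLp h 2 μ :=
  hh.continuous.memLp_of_hasCompactSupport hh.hasCompactSupport

theorem IsLevel.add {h' : k → ℂ} (hh : IsLevel μ f j h) (hh' : IsLevel μ f j h') :
    IsLevel μ f j (h + h') where
  supp x hx := by simp [hh.supp x hx, hh'.supp x hx]
  inv x t ht := by simp [hh.inv x t ht, hh'.inv x t ht]
  avg a := by
    simp only [Pi.add_apply]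
    rw [integral_add hh.integrable.integrableOn hh'.integrable.integrableOn, hh.avg, hh'.avg,
      add_zero]

theorem IsLevel.const_mul (hh : IsLevel μ f j h) (c : ℂ) : IsLevel μ f j fun x ↦ c * h x where
  supp x hx := by simp [hh.supp x hx]
  inv x t ht := by simp [hh.inv x t ht]
  avg a := by rw [integral_const_mul, hh.avg, mul_zero]

theorem IsLevel.comp_neg (hh : IsLevel μ f j h) : IsLevel μ f j fun x ↦ h (-x) where
  supp x hx := hh.supp _ (by rwa [norm_neg])
  inv x t ht := by rw [neg_add, hh.inv _ _ (by rwa [norm_neg])]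
  avg a := by
    have : ∀ x, (qBall a (j - f + 1)).indicator (fun x ↦ h (-x)) x =
        (qBall (-a) (j - f + 1)).indicator h (-x) := fun x ↦ by
      have : -x ∈ qBall (-a) (j - f + 1) ↔ x ∈ qBall a (j - f + 1) := by
        rw [mem_qBall, mem_qBall, ← norm_neg, neg_sub_neg, neg_sub]
      by_cases hx : x ∈ qBall a (j - f + 1)
      · simp [hx, this.2 hx]
      · simp [hx, mt this.1 hx]
    rw [← integral_indicator (measurableSet_qBall _ _)]
    simp only [this]
    rw [integral_neg_eq_self, integral_indicator (measurableSet_qBall _ _), hh.avg]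

theorem IsLevel.integral_mul_eq_zero (hh : IsLevel μ f j h) {g : k → ℂ}
    (hg : ∀ x t, ‖t‖ ≤ (q : ℝ) ^ (j - f + 1) → g (x + t) = g x) : ∫ x, h x * g x ∂μ = 0 :=
  integral_mul_eq_zero_of_avg hh.continuous hh.hasCompactSupport
    (isLocallyConstant_of_invariant hg).continuous hh.avg hg

/-- Each condition turns into a dual one. Vanishing averages kill the transform inside the new
sphere, and invariance kills it outside. The bound |x| ≤ q^j gives invariance under radius q^(δ-j),
and the absence of support in |x| < q^j gives vanishing averages at radius q^(δ-j+1). -/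
theorem IsLevel.fourierInt (hψ : HasAddConductor ψ δ) (hh : IsLevel μ f j h) :
    IsLevel μ f (f + δ - j) (fourierInt ψ μ h) where
  supp y hy := by
    rcases lt_or_gt_of_ne hy with hy | hy
    · rw [norm_lt_zpow_iff] at hy
      refine hh.integral_mul_eq_zero fun x t ht ↦ ?_
      have : ‖t * y‖ ≤ (q : ℝ) ^ δ := by
        rw [norm_mul]
        refine (mul_le_mul ht hy (norm_nonneg _) (zpow_q_pos k _).le).trans_eq ?_
        rw [← zpow_add₀ (q_ne_zero k)]; congr 1; ring
      rw [add_mul, AddChar.map_add_eq_mul, hψ.1 _ this, mul_one]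
    · obtain ⟨t, ht, ht1⟩ := hψ.exists_ne_one (y := y) (n := j - f) (by
        rwa [show δ - (j - f) = f + δ - j by ring])
      exact fourierInt_eq_zero_of_invariant (fun x ↦ hh.inv x t ht) ht1
  inv y t ht := by
    refine integral_congr_ae (.of_forall fun x ↦ ?_)
    by_cases hx : x ∈ qSphere j
    · have : ‖x * t‖ ≤ (q : ℝ) ^ δ := by
        rw [norm_mul, mem_qSphere.1 hx]
        refine (mul_le_mul_of_nonneg_left ht (zpow_q_pos k _).le).trans_eq ?_
        rw [← zpow_add₀ (q_ne_zero k)]; congr 1; ring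
      simp only [mul_add, AddChar.map_add_eq_mul, hψ.1 _ this, mul_one]
    · simp only [hh.eq_zero_of_notMem hx, zero_mul]
  avg a := by
    rw [setIntegral_qBall_fourierInt hψ hh.integrable, fourierInt_indicator_qBall hψ]
    refine integral_eq_zero_of_ae (.of_forall fun x ↦ ?_)
    by_cases hx : x ∈ qSphere j
    · have : x ∉ qBall 0 (δ - (f + δ - j - f + 1)) := by
        rw [mem_qBall_zero, mem_qSphere.1 hx, zpow_q_le_iff k]; lia
      simp only [Set.indicator_of_notMem this, mul_zero, Pi.zero_apply]
    · simp [hh.eq_zero_of_notMem hx]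

/-! ### Changes of variables -/

theorem setIntegral_comp_of_map_withDensity {w : k → ℝ} {T : k → k} (hw : Measurable w)
    (hT : Measurable T) (hmap : (μ.withDensity fun x ↦ ENNReal.ofReal (w x ^ 2)).map T = μ)
    {g : k → ℂ} (hg : Measurable g) {s : Set k} (hs : MeasurableSet s) :
    ∫ x in s, g x ∂μ = ∫ x in T ⁻¹' s, ((w x ^ 2 : ℝ) : ℂ) * g (T x) ∂μ := by
  conv_lhs => rw [← hmap]
  rw [setIntegral_map hs hg.aestronglyMeasurable hT.aemeasurable,
    restrict_withDensity (hT hs), integral_withDensity_eq_integral_toReal_smul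
      ((hw.pow_const 2).ennreal_ofReal) (.of_forall fun _ ↦ ENNReal.ofReal_lt_top)]
  refine integral_congr_ae (.of_forall fun x ↦ ?_)
  simp [ENNReal.toReal_ofReal (sq_nonneg (w x))]

/-- On the sphere the weight is constant, and inversion exchanges the balls of radius q^(j-f) and
q^(-j-f). The delicate condition is that on averages when f = 1, where the ball concerned is no
longer inside the sphere. -/
theorem IsLevel.inversion (hh : IsLevel μ f j h) (hf : 1 ≤ f) :
    IsLevel μ f (-j) fun x ↦ ((‖x‖⁻¹ : ℝ) : ℂ) * h x⁻¹ := by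
  have hsupp : ∀ x : k, ‖x‖ ≠ (q : ℝ) ^ (-j) → ((‖x‖⁻¹ : ℝ) : ℂ) * h x⁻¹ = 0 := fun x hx ↦ by
    rw [hh.supp _ fun h1 ↦ hx ?_, mul_zero]
    rw [zpow_neg, ← h1, norm_inv, inv_inv]
  -- The Jacobian is |x|⁻², of which only one factor |x|⁻¹ is part of the function; on the support
  -- the other one is the constant q^j, moved to the right as q^(-j).
  have hcv : ∀ s : Set k, MeasurableSet s → ∫ x in (·⁻¹) ⁻¹' s, ((‖x‖⁻¹ : ℝ) : ℂ) * h x⁻¹ ∂μ =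
      ((q : ℝ) ^ (-j) : ℝ) * ∫ x in s, h x ∂μ := fun s hs ↦ by
    rw [setIntegral_comp_of_map_withDensity measurable_norm.inv measurable_inv
      (map_withDensity_inv μ) hh.continuous.measurable hs, ← integral_const_mul]
    refine integral_congr_ae (.of_forall fun x ↦ ?_)
    by_cases hx : ‖x‖ = (q : ℝ) ^ (-j)
    · have hp := zpow_q_pos k (-j)
      simp only [Pi.inv_apply, hx]
      rw [← mul_assoc]; congr 1
      norm_cast
      field_simp
    · have := hsupp x hx
      simp only [this]
      rcases eq_or_ne x 0 with rfl | hx0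
      · simp
      · have : h x⁻¹ = 0 := by simpa [hx0] using this
        simp [this]
  refine ⟨hsupp, fun x t ht ↦ ?_, fun a ↦ ?_⟩
  · have ht' : ‖t‖ < (q : ℝ) ^ (-j) := ht.trans_lt ((zpow_q_lt_iff k).2 (by lia))
    by_cases hx : ‖x‖ = (q : ℝ) ^ (-j)
    · have hxt : ‖x + t‖ = (q : ℝ) ^ (-j) := by
        rw [IsUltrametricDist.norm_add_eq_max_of_norm_ne_norm (hx ▸ ht'.ne'), hx, max_eq_left ht'.le]
      have hx0 : x ≠ 0 := by rw [← norm_pos_iff, hx]; exact zpow_q_pos k _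
      have hxt0 : x + t ≠ 0 := by rw [← norm_pos_iff, hxt]; exact zpow_q_pos k _
      have e : (x + t)⁻¹ = x⁻¹ + -(t / (x * (x + t))) := by field_simp; ring
      rw [hx, hxt, e, hh.inv]
      rw [norm_neg, norm_div, norm_mul, hx, hxt, div_le_iff₀ (by positivity [zpow_q_pos k (-j)]),
        ← zpow_add₀ (q_ne_zero k), ← zpow_add₀ (q_ne_zero k)]
      refine ht.trans_eq ?_
      congr 1; ring
    · rw [hsupp x hx, hsupp]
      intro hxt
      refine hx ?_
      have : x = (x + t) + -t := by ring
      rw [this, IsUltrametricDist.norm_add_eq_max_of_norm_ne_norm (by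
        rw [hxt, norm_neg]; exact ht'.ne'), hxt, norm_neg, max_eq_left ht'.le]
  · by_cases ha : ‖a‖ = (q : ℝ) ^ (-j) ∧ 2 ≤ f
    · have ha' : ‖a⁻¹‖ = (q : ℝ) ^ j := by rw [norm_inv, ha.1, zpow_neg, inv_inv]
      have := preimage_inv_qBall ha' (n := j - f + 1) (by lia)
      rw [inv_inv] at this
      have e : -j - f + 1 = j - f + 1 - 2 * j := by ring
      rw [e, ← this, hcv _ (measurableSet_qBall _ _), hh.avg, mul_zero]
    -- For f = 1 and |a| ≤ q^(-j), the ball has the radius of the sphere and contains it, so the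
    -- average amounts to the total integral of h. In the remaining cases the ball misses the
    -- sphere.
    · by_cases ha2 : f = 1 ∧ ‖a‖ ≤ (q : ℝ) ^ (-j)
      · obtain ⟨rfl, ha2⟩ := ha2
        have h1 : qBall a (-j - (1 : ℕ) + 1) = qBall 0 (-j) := by
          rw [qBall_eq_of_mem (a := 0) (mem_qBall_zero.2 ha2)]; congr 1; lia
        have h2 : (∫ x, h x ∂μ) = 0 := by
          have := hh.avg 0
          rwa [setIntegral_eq_integral_of_forall_compl_eq_zero] at this
          intro x hx
          refine hh.eq_zero_of_notMem fun h ↦ hx ?_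
          have := qSphere_subset j h
          convert this using 2; push_cast; ring
        rw [h1, setIntegral_eq_integral_of_forall_compl_eq_zero]
        · have := hcv Set.univ .univ
          rwa [Set.preimage_univ, setIntegral_univ, setIntegral_univ, h2, mul_zero] at this
        · intro x hx
          refine hsupp x fun h ↦ hx ?_
          rw [mem_qBall_zero, h]
      · rw [setIntegral_eq_zero_of_forall_eq_zero]
        intro x hx
        refine hsupp x fun h ↦ ?_
        by_cases hf2 : 2 ≤ f
        · refine ha ⟨?_, hf2⟩
          rw [← h]
          refine norm_eq_of_mem_qBall ?_ (mem_qBall_comm.1 hx)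
          rw [h, zpow_q_lt_iff k]; lia
        · have hf1 : f = 1 := by lia
          subst hf1
          refine ha2 ⟨rfl, ?_⟩
          rw [← mem_qBall_zero (q := q), mem_qBall_comm,
            show (-j) = -j - (1 : ℕ) + 1 by push_cast; ring]
          rw [qBall_eq_of_mem hx, mem_qBall_comm, mem_qBall_zero, h, zpow_q_le_iff k]
          push_cast; lia

theorem IsLevel.dilation (hh : IsLevel μ f j h) {u : kˣ} {m : ℤ} (hu : ‖(u : k)‖ = (q : ℝ) ^ m) :
    IsLevel μ f (j - m) fun x ↦ (√‖(u : k)‖ : ℂ) * h (u * x) where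
  supp x hx := by
    rw [hh.supp _ fun h1 ↦ hx ?_, mul_zero]
    rw [norm_mul, hu] at h1
    rw [zpow_sub₀ (q_ne_zero k), ← h1, mul_div_cancel_left₀ _ (zpow_q_pos k m).ne']
  inv x t ht := by
    rw [mul_add, hh.inv]
    rw [norm_mul, hu]
    refine (mul_le_mul_of_nonneg_left ht (zpow_q_pos k m).le).trans_eq ?_
    rw [← zpow_add₀ (q_ne_zero k)]; congr 1; ring
  avg a := by
    have h2 := setIntegral_comp_of_map_withDensity (μ := μ) measurable_const
      (measurable_const_mul (u : k)) (map_withDensity_mul μ u) hh.continuous.measurable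
      (measurableSet_qBall (u * a) (j - f + 1))
    rw [hh.avg, preimage_mul_qBall hu, integral_const_mul] at h2
    have h3 := (mul_eq_zero.1 h2.symm).resolve_left (by simp)
    rw [integral_const_mul]
    convert mul_zero _ using 2
    convert h3 using 4
    · simp
    · ring

end Level

section LevelSpace

open Metric

variable {k : Type*} [NormedField k] [IsUltrametricDist k] {q : ℕ} [NormalizedLocalField k q]
  [ProperSpace k] [MeasurableSpace k] [BorelSpace k] {μ : Measure k} [μ.IsAddHaarMeasure]
  {ψ : AddChar k Circle} {δ : ℤ} {f : ℕ} {j : ℤ} {h : k → ℂ}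

/-! ### The spaces of functions of a given level -/

theorem IsLevel.conj (hh : IsLevel μ f j h) : IsLevel μ f j fun x ↦ starRingEnd ℂ (h x) where
  supp x hx := by simp [hh.supp x hx]
  inv x t ht := by simp [hh.inv x t ht]
  avg a := by rw [integral_conj, hh.avg, map_zero]

variable (μ) in
/-- The subspace of `L²` of the functions of level `f` on the sphere of radius `q ^ j`. -/
def levelSpace (f : ℕ) (j : ℤ) : Submodule ℂ (Lp ℂ 2 μ) where
  carrier := {φ | ∃ h, IsLevel μ f j h ∧ φ =ᵐ[μ] h}
  zero_mem' := ⟨0, ⟨by simp, by simp, by simp⟩, Lp.coeFn_zero ℂ 2 μ⟩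
  add_mem' := by
    rintro φ φ' ⟨h, hh, e⟩ ⟨h', hh', e'⟩
    exact ⟨h + h', hh.add hh', (Lp.coeFn_add φ φ').trans (e.add e')⟩
  smul_mem' := by
    rintro c φ ⟨h, hh, e⟩
    refine ⟨_, hh.const_mul c, (Lp.coeFn_smul c φ).trans ?_⟩
    filter_upwards [e] with x hx
    rw [Pi.smul_apply, hx, smul_eq_mul]

theorem IsLevel.toLp_mem (hh : IsLevel μ f j h) : hh.memLp.toLp ∈ levelSpace μ f j :=
  ⟨h, hh, hh.memLp.coeFn_toLp⟩

theorem inner_eq_integral_of_ae {φ φ' : Lp ℂ 2 μ} {h h' : k → ℂ} (e : φ =ᵐ[μ] h)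
    (e' : φ' =ᵐ[μ] h') : inner ℂ φ φ' = ∫ x, starRingEnd ℂ (h x) * h' x ∂μ := by
  rw [L2.inner_def]
  refine integral_congr_ae ?_
  filter_upwards [e, e'] with x h1 h2
  rw [RCLike.inner_apply, h1, h2, mul_comm]

/-- Different spheres are disjoint. On one sphere, the function of lower level is invariant under a
ball over which the averages of the other vanish. -/
theorem inner_eq_zero_of_mem_levelSpace {f' : ℕ} {j' : ℤ} (hne : ¬(f = f' ∧ j = j'))
    {φ φ' : Lp ℂ 2 μ} (hφ : φ ∈ levelSpace μ f j) (hφ' : φ' ∈ levelSpace μ f' j') :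
    inner ℂ φ φ' = 0 := by
  obtain ⟨h, hh, e⟩ := hφ
  obtain ⟨h', hh', e'⟩ := hφ'
  rw [inner_eq_integral_of_ae e e']
  by_cases hj : j = j'
  · subst hj
    rcases lt_trichotomy f f' with hf | hf | hf
    · simp_rw [mul_comm _ (h' _)]
      refine hh'.integral_mul_eq_zero fun x t ht ↦ hh.conj.inv x t (ht.trans ?_)
      rw [zpow_q_le_iff k]; lia
    · exact absurd ⟨hf, rfl⟩ hne
    · refine hh.conj.integral_mul_eq_zero fun x t ht ↦ hh'.inv x t (ht.trans ?_)
      rw [zpow_q_le_iff k]; lia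
  · refine integral_eq_zero_of_ae (.of_forall fun x ↦ ?_)
    by_cases hx : ‖x‖ = (q : ℝ) ^ j
    · have : ‖x‖ ≠ (q : ℝ) ^ j' := by rwa [hx, Ne, zpow_q_inj k]
      simp [hh'.supp x this]
    · simp [hh.supp x hx]

theorem setIntegral_qSphere_of_mem_levelSpace {φ : Lp ℂ 2 μ} (hφ : φ ∈ levelSpace μ f j) (i : ℤ) :
    ∫ x in qSphere i, φ x ∂μ = 0 := by
  obtain ⟨h, hh, e⟩ := hφ
  rw [setIntegral_congr_ae (g := h) (measurableSet_qSphere i) (e.mono fun x hx _ ↦ hx)]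
  by_cases hij : i = j
  · subst hij
    rw [setIntegral_eq_integral_of_forall_compl_eq_zero fun x ↦ hh.eq_zero_of_notMem]
    simpa using hh.integral_mul_eq_zero (g := 1) (by simp)
  · refine setIntegral_eq_zero_of_forall_eq_zero fun x hx ↦ hh.supp x ?_
    rwa [mem_qSphere.1 hx, Ne, zpow_q_inj k]

/-! ### Cells, and totality of the levels on a sphere -/

theorem add_mem_qSphere_iff {x t : k} {j : ℤ} (ht : ‖t‖ < (q : ℝ) ^ j) :
    x + t ∈ qSphere j ↔ x ∈ qSphere j := by
  have key : ∀ {x t : k}, ‖t‖ < (q : ℝ) ^ j → x ∈ qSphere j → x + t ∈ qSphere j := by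
    intro x t ht hx
    rw [mem_qSphere] at *
    rw [IsUltrametricDist.norm_add_eq_max_of_norm_ne_norm (hx ▸ ht.ne'), hx, max_eq_left ht.le]
  refine ⟨fun hx ↦ ?_, key ht⟩
  simpa using key (t := -t) (by rwa [norm_neg]) hx

/-- The intersection of the ball of radius `q ^ (j - f)` about `a` with the sphere of radius
`q ^ j`. -/
def qCell {k : Type*} [NormedField k] {q : ℕ} [NormalizedLocalField k q] (f : ℕ) (j : ℤ) (a : k) :
    Set k := qBall a (j - f) ∩ qSphere j

theorem measurableSet_qCell (a : k) : MeasurableSet (qCell f j a) :=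
  (measurableSet_qBall _ _).inter (measurableSet_qSphere j)

theorem measure_qCell_lt_top (a : k) : μ (qCell f j a) < ∞ :=
  (measure_mono Set.inter_subset_left).trans_lt (measure_qBall_lt_top a _)

/-- Cutting the ball with the sphere makes level 0 the whole sphere, so that the descent through the
levels starts from cuspidality. -/
theorem qCell_zero {a : k} (ha : a ∈ qSphere j) : qCell 0 j a = qSphere j := by
  refine Set.inter_eq_right.2 ?_
  rw [Nat.cast_zero, sub_zero, qBall_eq_of_mem (b := 0)]
  · exact qSphere_subset j
  · rw [mem_qBall_comm]; exact qSphere_subset j ha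

theorem qCell_of_pos {a : k} (ha : a ∈ qSphere j) (hf : 1 ≤ f) :
    qCell f j a = qBall a (j - f) :=
  Set.inter_eq_left.2 (qBall_subset_qSphere (mem_qSphere.1 ha) (by lia))

theorem measureReal_qSphere (j : ℤ) : μ.real (qSphere j : Set k) =
    ((q : ℝ) - 1) * ((q : ℝ) ^ (j - 1) * μ.real (qBall (0 : k) 0)) := by
  have : (qSphere j : Set k) = qBall 0 j \ qBall 0 (j - 1) := by
    ext x
    rw [Set.mem_sdiff, mem_qSphere, mem_qBall_zero, mem_qBall_zero, ← norm_lt_zpow_iff]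
    exact ⟨fun h ↦ ⟨h.le, h.not_lt⟩, fun h ↦ le_antisymm h.1 (not_lt.1 h.2)⟩
  rw [this, measureReal_sdiff (qBall_subset (by lia)) (measurableSet_qBall _ _)
    (measure_qBall_lt_top _ _).ne, measureReal_qBall μ, measureReal_qBall μ 0 (j - 1),
    zpow_sub_one₀ (q_ne_zero k)]
  have := q_ne_zero k
  field_simp

theorem measureReal_qCell_pos {a : k} (ha : a ∈ qSphere j) : 0 < μ.real (qCell f j a) := by
  rcases Nat.eq_zero_or_pos f with rfl | hf
  · rw [qCell_zero ha, measureReal_qSphere]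
    have h1 := one_lt_q k
    have h2 := zpow_q_pos k (j - 1)
    have h3 := measureReal_qBall_pos μ (0 : k) 0
    have : (0 : ℝ) < q - 1 := by linarith
    positivity
  · rw [qCell_of_pos ha hf]; exact measureReal_qBall_pos μ a _

variable (μ) in
/-- The basic function of level `f + 1` at `a`. -/
def cellFun (f : ℕ) (j : ℤ) (a : k) (x : k) : ℂ :=
  (qCell (f + 1) j a).indicator 1 x -
    ((μ.real (qCell (f + 1) j a) / μ.real (qCell f j a) : ℝ) : ℂ) * (qCell f j a).indicator 1 x

theorem integrable_indicator_qCell (a : k) :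
    Integrable ((qCell f j a).indicator (1 : k → ℂ)) μ :=
  (integrable_indicator_iff (measurableSet_qCell a)).2
    (integrableOn_const (measure_qCell_lt_top a).ne)

theorem add_mem_qCell_iff {m : ℕ} {a x t : k} (hm : m ≤ f + 1)
    (ht : ‖t‖ ≤ (q : ℝ) ^ (j - (f + 1 : ℕ))) : x + t ∈ qCell m j a ↔ x ∈ qCell m j a := by
  refine and_congr (add_mem_qBall_iff (ht.trans ?_)) (add_mem_qSphere_iff (ht.trans_lt ?_))
  · rw [zpow_q_le_iff k]; lia
  · rw [zpow_q_lt_iff k]; lia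

/-- The coefficient is chosen so that the integral over the larger cell is zero; a ball of radius
q^(j-f) either contains that cell or is disjoint from it. -/
theorem isLevel_cellFun {a : k} (ha : a ∈ qSphere j) : IsLevel μ (f + 1) j (cellFun μ f j a) where
  supp x hx := by
    have : ∀ m, x ∉ qCell m j a := fun m h ↦ hx (mem_qSphere.1 h.2)
    simp [cellFun, this]
  inv x t ht := by
    have h1 := add_mem_qCell_iff (x := x) (a := a) le_rfl ht
    have h2 := add_mem_qCell_iff (x := x) (a := a) f.le_succ ht
    by_cases h3 : x ∈ qCell (f + 1) j a <;> by_cases h4 : x ∈ qCell f j a <;>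
      simp [cellFun, h1, h2, h3, h4]
  avg b := by
    have e : j - (f + 1 : ℕ) + 1 = j - f := by push_cast; ring
    rw [e]
    by_cases hb : b ∈ qBall a (j - f)
    · have h1 : ∀ m, f ≤ m → qBall b (j - f) ∩ qCell m j a = qCell m j a := fun m hm ↦ by
        rw [← qBall_eq_of_mem hb]
        exact Set.inter_eq_right.2 (Set.inter_subset_left.trans (qBall_subset (by lia)))
      unfold cellFun
      rw [integral_sub (integrable_indicator_qCell a).integrableOn
        ((integrable_indicator_qCell a).const_mul _).integrableOn, integral_const_mul,
        setIntegral_indicator (measurableSet_qCell a), setIntegral_indicator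
        (measurableSet_qCell a),
        h1 _ f.le_succ, h1 _ le_rfl]
      simp only [Pi.one_apply, integral_const, measureReal_restrict_apply_univ, Complex.real_smul,
        mul_one]
      rw [← Complex.ofReal_mul, div_mul_cancel₀ _ (measureReal_qCell_pos ha).ne', sub_self]
    · refine setIntegral_eq_zero_of_forall_eq_zero fun x hx ↦ ?_
      have hxa := Set.disjoint_right.1 (disjoint_qBall hb) hx
      have : ∀ m, f ≤ m → x ∉ qCell m j a := fun m hm h ↦
        hxa (qBall_subset (by lia) h.1)
      simp [cellFun, this (f + 1) f.le_succ, this f le_rfl]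

theorem inner_toLp_cellFun {a : k} (ha : a ∈ qSphere j) (φ : Lp ℂ 2 μ) :
    inner ℂ (isLevel_cellFun (μ := μ) (f := f) ha).memLp.toLp φ = ∫ x in qCell (f + 1) j a, φ x ∂μ -
      ((μ.real (qCell (f + 1) j a) / μ.real (qCell f j a) : ℝ) : ℂ) *
        ∫ x in qCell f j a, φ x ∂μ := by
  rw [inner_eq_integral_of_ae (MemLp.coeFn_toLp _) (Filter.EventuallyEq.refl _ _)]
  have hi : ∀ m, Integrable ((qCell m j a).indicator φ) μ := fun m ↦
    (integrable_indicator_iff (measurableSet_qCell a)).2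
      ((integrableOn_of_isCompact φ (isCompact_qBall a _)).mono_set Set.inter_subset_left)
  rw [← integral_indicator (measurableSet_qCell a), ← integral_indicator (measurableSet_qCell a),
    ← integral_const_mul, ← integral_sub (hi _) ((hi _).const_mul _)]
  refine integral_congr_ae (.of_forall fun x ↦ ?_)
  by_cases h1 : x ∈ qCell (f + 1) j a <;> by_cases h2 : x ∈ qCell f j a <;>
    simp [cellFun, h1, h2, sub_mul]

/-- A square-integrable function with vanishing integral on a sphere that is orthogonal to all
functions of positive level on this sphere vanishes on it. -/
theorem ae_eq_zero_of_orthogonal_levelSpace {φ : Lp ℂ 2 μ} (h0 : ∫ x in qSphere j, φ x ∂μ = 0)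
    (hφ : ∀ f, 1 ≤ f → ∀ w ∈ levelSpace μ f j, inner ℂ w φ = 0) :
    ∀ᵐ x ∂μ, x ∈ qSphere j → φ x = 0 := by
  -- Orthogonality to `cellFun` expresses the integral over a cell through that over the next larger
  -- cell, and the largest cell is the sphere.
  have key : ∀ (f : ℕ) (a : k), a ∈ qSphere j → ∫ x in qCell f j a, φ x ∂μ = 0 := fun f ↦ by
    induction f with
    | zero => intro a ha; rwa [qCell_zero ha]
    | succ f ih =>
      intro a ha
      have := hφ (f + 1) (by lia) _ (isLevel_cellFun (μ := μ) (f := f) ha).toLp_mem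
      rwa [inner_toLp_cellFun ha, ih a ha, mul_zero, sub_zero] at this
  have hint : ∀ (a : k) (n : ℤ), IntegrableOn ((qSphere j).indicator φ) (qBall a n) μ := fun a n ↦
    (integrableOn_of_isCompact φ (isCompact_qBall a n)).indicator (measurableSet_qSphere j)
  have := ae_eq_zero_of_setIntegral_qBall (measure_singleton_zero μ) (fun a n _ ↦ hint a n)
    fun a n ha ↦ by
      by_cases haj : ‖a‖ = (q : ℝ) ^ j
      · rw [haj, zpow_q_lt_iff k] at ha
        rw [setIntegral_indicator (measurableSet_qSphere j)]
        have := key (j - n).toNat a (mem_qSphere.2 haj)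
        rwa [qCell, Int.toNat_of_nonneg (by lia), sub_sub_cancel] at this
      · refine setIntegral_eq_zero_of_forall_eq_zero fun x hx ↦ Set.indicator_of_notMem ?_ _
        rwa [mem_qSphere, norm_eq_of_mem_qBall ha hx]
  filter_upwards [this] with x hx hxj
  simpa [hxj] using hx

/-- The basic function takes at its centre the value 1 minus a ratio of cell measures. That ratio is
1/q, or 1/(q-1) when the larger cell is the sphere, and equals 1 only in the excluded case. -/
theorem levelSpace_ne_bot (hf : 1 ≤ f) (hq : 2 < q ∨ 2 ≤ f) : levelSpace μ f j ≠ ⊥ := by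
  obtain ⟨f, rfl⟩ := Nat.exists_eq_add_of_le' hf
  obtain ⟨a, ha'⟩ := exists_norm_eq_zpow k j
  have ha : a ∈ qSphere j := mem_qSphere.2 ha'
  intro hbot
  have hL := isLevel_cellFun (μ := μ) (f := f) ha
  have h0 : cellFun μ f j a =ᵐ[μ] 0 := by
    have := hL.toLp_mem
    rw [hbot, Submodule.mem_bot] at this
    refine hL.memLp.coeFn_toLp.symm.trans ?_
    rw [this]
    exact Lp.coeFn_zero ℂ 2 μ
  have h1 := congrFun ((hL.continuous.ae_eq_iff_eq μ continuous_zero).1 h0) a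
  have hm : ∀ m, a ∈ qCell m j a := fun m ↦ ⟨mem_qBall_self a _, ha⟩
  simp only [cellFun, Set.indicator_of_mem (hm _), Pi.one_apply, mul_one, Pi.zero_apply,
    sub_eq_zero] at h1
  norm_cast at h1
  rw [eq_comm, div_eq_one_iff_eq (measureReal_qCell_pos ha).ne', qCell_of_pos ha (by lia),
    measureReal_qBall μ] at h1
  have hp := measureReal_qBall_pos μ (0 : k) 0
  have hq1 := one_lt_q k
  rcases Nat.eq_zero_or_pos f with rfl | hf
  · rw [qCell_zero ha, measureReal_qSphere] at h1
    have hz := zpow_q_pos k (j - 1)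
    have h2 : (2 : ℝ) < q := by exact_mod_cast hq.resolve_right (by lia)
    have : (0 : ℝ) < (q : ℝ) ^ (j - 1) * μ.real (qBall (0 : k) 0) := by positivity
    simp only [zero_add, Nat.cast_one] at h1
    nlinarith
  · rw [qCell_of_pos ha hf, measureReal_qBall μ a (j - f)] at h1
    have := mul_right_cancel₀ hp.ne' h1
    rw [zpow_q_inj k] at this
    lia

/-- For q = 2 the sphere agrees up to a null set with one ball of radius q^(j-1). The function is
constant on that ball and has integral zero. -/
theorem levelSpace_one_eq_bot (hq : q = 2) : levelSpace μ 1 j = ⊥ := by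
  rw [Submodule.eq_bot_iff]
  rintro φ ⟨h, hh, e⟩
  rw [Lp.eq_zero_iff_ae_eq_zero]
  refine e.trans (.of_forall fun a ↦ ?_)
  by_cases ha : a ∈ qSphere j
  · have h1 : ∫ x in qSphere j, h x ∂μ = 0 := by
      rw [setIntegral_eq_integral_of_forall_compl_eq_zero fun x ↦ hh.eq_zero_of_notMem]
      simpa using hh.integral_mul_eq_zero (g := 1) (by simp)
    have hsub : qBall a (j - 1) ⊆ qSphere j := qBall_subset_qSphere (mem_qSphere.1 ha) (by lia)
    have h2 : qBall a (j - 1) =ᵐ[μ] qSphere j := by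
      refine ae_eq_of_subset_of_measure_ge hsub ?_ (measurableSet_qBall _ _).nullMeasurableSet
        (isCompact_qSphere j).measure_lt_top.ne
      rw [← ENNReal.toReal_le_toReal (isCompact_qSphere j).measure_lt_top.ne
        (measure_qBall_lt_top _ _).ne]
      change μ.real _ ≤ μ.real _
      have hq' : (q : ℝ) - 1 = 1 := by rw [hq]; norm_num
      rw [measureReal_qSphere, measureReal_qBall μ a, hq', one_mul]
    rw [← setIntegral_congr_set h2] at h1
    have h3 : ∫ x in qBall a (j - 1), h x ∂μ = ∫ x in qBall a (j - 1), h a ∂μ :=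
      setIntegral_congr_fun (measurableSet_qBall _ _) fun x hx ↦ by
        simpa using hh.inv a (x - a) (mem_qBall.1 hx)
    rw [h3, setIntegral_const, smul_eq_zero] at h1
    exact h1.resolve_left (measureReal_qBall_pos μ a _).ne'
  · exact hh.eq_zero_of_notMem ha

/-! ### The action of the unitary operators on the level spaces -/

theorem quasiMeasurePreserving_of_map_withDensity {w : k → ℝ} {T : k → k} (hw : Measurable w)
    (hT : Measurable T) (hmap : (μ.withDensity fun x ↦ ENNReal.ofReal (w x ^ 2)).map T = μ)
    (hne : ∀ᵐ x ∂μ, w x ≠ 0) : Measure.QuasiMeasurePreserving T μ μ := by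
  refine ⟨hT, ?_⟩
  have h1 : μ ≪ μ.withDensity fun x ↦ ENNReal.ofReal (w x ^ 2) := by
    refine withDensity_absolutelyContinuous' ((hw.pow_const 2).ennreal_ofReal).aemeasurable ?_
    filter_upwards [hne] with x hx
    simpa using by positivity
  have h2 := h1.map hT
  rwa [hmap] at h2

theorem map_levelSpace_inversion {U : Lp ℂ 2 μ ≃ₗᵢ[ℂ] Lp ℂ 2 μ}
    (hU : ∀ φ, U φ =ᵐ[μ] fun x ↦ ((‖x‖⁻¹ : ℝ) : ℂ) * φ x⁻¹) (hf : 1 ≤ f) :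
    (levelSpace μ f j).map (U.toLinearEquiv : Lp ℂ 2 μ →ₗ[ℂ] Lp ℂ 2 μ) = levelSpace μ f (-j) := by
  have hqmp : Measure.QuasiMeasurePreserving (·⁻¹ : k → k) μ μ :=
    quasiMeasurePreserving_of_map_withDensity measurable_norm.inv measurable_inv
      (map_withDensity_inv μ) ((ae_ne_zero μ).mono fun x hx ↦ by simpa using hx)
  have key : ∀ {φ : Lp ℂ 2 μ} {h : k → ℂ}, φ =ᵐ[μ] h →
      U φ =ᵐ[μ] fun x ↦ ((‖x‖⁻¹ : ℝ) : ℂ) * h x⁻¹ := fun {φ h} e ↦ by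
    filter_upwards [hU φ, hqmp.ae_eq_comp e] with x h1 h2
    rw [h1, ← Function.comp_apply (f := φ), ← Function.comp_apply (f := h)]
    exact congrArg _ h2
  refine le_antisymm ?_ fun φ ⟨h, hh, e⟩ ↦ ?_
  · rintro _ ⟨φ, ⟨h, hh, e⟩, rfl⟩
    exact ⟨_, hh.inversion hf, key e⟩
  · have h1 := hh.inversion hf
    rw [neg_neg] at h1
    refine ⟨_, h1.toLp_mem, ?_⟩
    refine Lp.ext ((key h1.memLp.coeFn_toLp).trans ?_)
    filter_upwards [e, ae_ne_zero μ] with x hx hx0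
    rw [hx, inv_inv, ← mul_assoc, ← Complex.ofReal_mul, norm_inv, inv_inv,
      inv_mul_cancel₀ (norm_ne_zero_iff.2 hx0), Complex.ofReal_one, one_mul]

theorem map_levelSpace_dilation {U : Lp ℂ 2 μ ≃ₗᵢ[ℂ] Lp ℂ 2 μ} {u : kˣ} {m : ℤ}
    (hU : ∀ φ, U φ =ᵐ[μ] fun x ↦ (√‖(u : k)‖ : ℂ) * φ (u * x)) (hu : ‖(u : k)‖ = (q : ℝ) ^ m) :
    (levelSpace μ f j).map (U.toLinearEquiv : Lp ℂ 2 μ →ₗ[ℂ] Lp ℂ 2 μ) =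
      levelSpace μ f (j - m) := by
  have hqmp : Measure.QuasiMeasurePreserving ((u : k) * ·) μ μ :=
    quasiMeasurePreserving_of_map_withDensity measurable_const (measurable_const_mul _)
      (map_withDensity_mul μ u) (.of_forall fun x ↦ by simp)
  have key : ∀ {φ : Lp ℂ 2 μ} {h : k → ℂ}, φ =ᵐ[μ] h →
      U φ =ᵐ[μ] fun x ↦ (√‖(u : k)‖ : ℂ) * h (u * x) := fun {φ h} e ↦ by
    filter_upwards [hU φ, hqmp.ae_eq_comp e] with x h1 h2
    rw [h1]
    exact congrArg _ h2
  refine le_antisymm ?_ fun φ ⟨h, hh, e⟩ ↦ ?_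
  · rintro _ ⟨φ, ⟨h, hh, e⟩, rfl⟩
    exact ⟨_, hh.dilation hu, key e⟩
  · have hu' : ‖((u⁻¹ : kˣ) : k)‖ = (q : ℝ) ^ (-m) := by
      rw [Units.val_inv_eq_inv_val, norm_inv, hu, zpow_neg]
    have h1 := hh.dilation hu'
    rw [sub_neg_eq_add, sub_add_cancel] at h1
    refine ⟨_, h1.toLp_mem, ?_⟩
    refine Lp.ext ((key h1.memLp.coeFn_toLp).trans ?_)
    filter_upwards [e] with x hx
    rw [hx, Units.inv_mul_cancel_left, ← mul_assoc, ← Complex.ofReal_mul, ← Real.sqrt_mul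
      (norm_nonneg _), ← norm_mul, Units.mul_inv, norm_one, Real.sqrt_one, Complex.ofReal_one,
      one_mul]

theorem map_levelSpace_fourier (hψ : HasAddConductor ψ δ)
    (hsd : ∀ φ : k → ℂ, IsLocallyConstant φ → HasCompactSupport φ →
      ∀ x, fourierInt ψ μ (fourierInt ψ μ φ) x = φ (-x))
    {U : Lp ℂ 2 μ ≃ₗᵢ[ℂ] Lp ℂ 2 μ} (hU : IsFourier ψ U) :
    (levelSpace μ f j).map (U.toLinearEquiv : Lp ℂ 2 μ →ₗ[ℂ] Lp ℂ 2 μ) =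
      levelSpace μ f (f + δ - j) := by
  have key : ∀ {φ : Lp ℂ 2 μ} {h : k → ℂ}, Integrable h μ → φ =ᵐ[μ] h →
      U φ =ᵐ[μ] fourierInt ψ μ h := fun {φ h} hh e ↦ by
    rw [← fourierInt_congr_ae e]
    exact hU φ (hh.congr e.symm)
  refine le_antisymm ?_ fun φ ⟨h, hh, e⟩ ↦ ?_
  · rintro _ ⟨φ, ⟨h, hh, e⟩, rfl⟩
    exact ⟨_, hh.fourierInt hψ, key hh.integrable e⟩
  -- By self-duality the preimage of h is the transform of its reflection, and applying j ↦ f+δ-j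
  -- twice gives j back.
  · have h1 := hh.comp_neg.fourierInt hψ
    rw [sub_sub_cancel] at h1
    refine ⟨_, h1.toLp_mem, ?_⟩
    refine Lp.ext ((key h1.integrable h1.memLp.coeFn_toLp).trans ?_)
    filter_upwards [e] with x hx
    rw [hx, hsd _ hh.comp_neg.isLocallyConstant hh.comp_neg.hasCompactSupport, neg_neg]

end LevelSpace

section DiagOp

variable {E : Type*} [NormedAddCommGroup E] [InnerProductSpace ℂ E] [CompleteSpace E] {κ : Type*}
  (b : HilbertBasis κ ℂ E) (a a' : κ → ℝ)

/-! ### Operators that are diagonal in a Hilbert basis -/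

theorem HilbertBasis.ext_inner {b : HilbertBasis κ ℂ E} {x y : E}
    (h : ∀ i, inner ℂ (b i) x = inner ℂ (b i) y) : x = y := by
  refine b.repr.injective (lp.ext (funext fun i ↦ ?_))
  rw [b.repr_apply_apply, b.repr_apply_apply, h]

open scoped Classical in
theorem HilbertBasis.inner_eq_ite (b : HilbertBasis κ ℂ E) (i j : κ) :
    inner ℂ (b i) (b j) = if i = j then (1 : ℂ) else 0 :=
  orthonormal_iff_ite.1 b.orthonormal i j

/-- The graph of the maximal operator with eigenvectors `b i` and eigenvalues `a i`. -/
def diagGraph : Submodule ℂ (E × E) where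
  carrier := {p | ∀ i, inner ℂ (b i) p.2 = a i * inner ℂ (b i) p.1}
  zero_mem' := by simp
  add_mem' := by
    intro p p' h h' i
    simp only [Prod.fst_add, Prod.snd_add, inner_add_right, h i, h' i]
    ring
  smul_mem' := by
    intro c p h i
    simp only [Prod.smul_fst, Prod.smul_snd, inner_smul_right, h i]
    ring

/-- The maximal operator with eigenvectors `b i` and eigenvalues `a i`. -/
def diagOp : E →ₗ.[ℂ] E := (diagGraph b a).toLinearPMap

theorem mem_diagGraph {p : E × E} :
    p ∈ diagGraph b a ↔ ∀ i, inner ℂ (b i) p.2 = a i * inner ℂ (b i) p.1 := Iff.rfl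

theorem graph_diagOp : (diagOp b a).graph = diagGraph b a := by
  refine Submodule.toLinearPMap_graph_eq _ fun p hp h0 ↦ HilbertBasis.ext_inner (b := b) fun i ↦ ?_
  rw [hp i, h0]; simp

theorem mem_graph_diagOp {p : E × E} :
    p ∈ (diagOp b a).graph ↔ ∀ i, inner ℂ (b i) p.2 = a i * inner ℂ (b i) p.1 := by
  rw [graph_diagOp, mem_diagGraph]

theorem inner_diagOp (x : (diagOp b a).domain) (i : κ) :
    inner ℂ (b i) (diagOp b a x) = a i * inner ℂ (b i) (x : E) :=
  (mem_graph_diagOp b a).1 ((diagOp b a).mem_graph x) i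

theorem exists_diagOp_eq {x y : E} (h : ∀ i, inner ℂ (b i) y = a i * inner ℂ (b i) x) :
    ∃ z : (diagOp b a).domain, (z : E) = x ∧ diagOp b a z = y :=
  (LinearPMap.mem_graph_iff _).1 ((mem_graph_diagOp b a (p := (x, y))).2 h)

theorem basis_mem_graph_diagOp (i : κ) : (b i, (a i : ℂ) • b i) ∈ (diagOp b a).graph := by
  rw [mem_graph_diagOp]
  intro j
  simp only [inner_smul_right, HilbertBasis.inner_eq_ite]
  split_ifs with h
  · rw [h]
  · simp

theorem isClosed_diagOp : (diagOp b a).IsClosed := by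
  rw [LinearPMap.IsClosed, graph_diagOp]
  have : (diagGraph b a : Set (E × E)) =
      ⋂ i, {p | inner ℂ (b i) p.2 = a i * inner ℂ (b i) p.1} := by ext p; simp [mem_diagGraph]
  rw [this]
  exact isClosed_iInter fun i ↦ isClosed_eq (by fun_prop) (by fun_prop)

theorem dense_domain_diagOp : Dense ((diagOp b a).domain : Set E) := by
  have h : Submodule.span ℂ (Set.range b) ≤ (diagOp b a).domain := by
    rw [Submodule.span_le]
    rintro _ ⟨i, rfl⟩
    exact LinearPMap.mem_domain_of_mem_graph (basis_mem_graph_diagOp b a i)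
  exact Dense.mono h (Submodule.dense_iff_topologicalClosure_eq_top.2 b.dense_span)

theorem isFormalAdjoint_diagOp : (diagOp b a).IsFormalAdjoint (diagOp b a) := fun x y ↦ by
  rw [← b.tsum_inner_mul_inner, ← b.tsum_inner_mul_inner]
  refine tsum_congr fun i ↦ ?_
  rw [inner_diagOp, ← inner_conj_symm, inner_diagOp, map_mul, inner_conj_symm, Complex.conj_ofReal]
  ring

/-- Pairing the adjoint with the eigenvector b i yields the coordinate relation that defines the
maximal graph, so the adjoint is no larger. -/
theorem isSelfAdjoint_diagOp : IsSelfAdjoint (diagOp b a) := by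
  rw [LinearPMap.isSelfAdjoint_def]
  have hd := dense_domain_diagOp b a
  refine le_antisymm (LinearPMap.le_of_le_graph fun p hp ↦ ?_)
    ((isFormalAdjoint_diagOp b a).le_adjoint hd)
  rw [LinearPMap.mem_graph_iff] at hp
  obtain ⟨y, h1, h2⟩ := hp
  rw [mem_graph_diagOp]
  intro i
  obtain ⟨z, hz, hz'⟩ := (LinearPMap.mem_graph_iff _).1 (basis_mem_graph_diagOp b a i)
  have h := LinearPMap.adjoint_isFormalAdjoint hd y z
  simp only [hz, hz', inner_smul_right, h1, h2] at h
  rw [← inner_conj_symm, h, map_mul, inner_conj_symm, Complex.conj_ofReal]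

theorem re_inner_diagOp_nonneg (ha : ∀ i, 0 ≤ a i) (x : (diagOp b a).domain) :
    0 ≤ RCLike.re (inner ℂ (x : E) (diagOp b a x)) := by
  have h := (b.hasSum_inner_mul_inner (x : E) (diagOp b a x)).mapL (RCLike.reCLM (K := ℂ))
  refine h.nonneg fun i ↦ ?_
  have : inner ℂ (x : E) (b i) * inner ℂ (b i) (diagOp b a x) =
      ((a i * ‖inner ℂ (b i) (x : E)‖ ^ 2 : ℝ) : ℂ) := by
    rw [inner_diagOp, ← inner_conj_symm, mul_left_comm, RCLike.conj_mul]
    push_cast; rfl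
  rw [RCLike.reCLM_apply, this]
  exact mul_nonneg (ha i) (sq_nonneg _)

/-- The eigenvectors form a core: a point of the maximal graph is the limit of its partial
expansions, whose terms are multiples of (b i, a i b i). -/
theorem closure_eq_diagOp {T : E →ₗ.[ℂ] E} (hT : T ≤ diagOp b a)
    (hb : ∀ i, (b i, (a i : ℂ) • b i) ∈ T.graph) : T.closure = diagOp b a := by
  have hc := (isClosed_diagOp b a).isClosable.leIsClosable hT
  refine LinearPMap.eq_of_eq_graph (le_antisymm ?_ fun p hp ↦ ?_)
  · rw [← hc.graph_closure_eq_closure_graph]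
    exact Submodule.topologicalClosure_minimal _ (LinearPMap.le_graph_of_le hT)
      (isClosed_diagOp b a)
  · rw [← hc.graph_closure_eq_closure_graph]
    rw [mem_graph_diagOp] at hp
    have h := (b.hasSum_repr p.1).prodMk (b.hasSum_repr p.2)
    refine mem_closure_of_tendsto h (.of_forall fun s ↦ sum_mem fun i _ ↦ ?_)
    have : (b.repr p.1 i • b i, b.repr p.2 i • b i) = b.repr p.1 i • (b i, (a i : ℂ) • b i) := by
      rw [b.repr_apply_apply, b.repr_apply_apply, hp i, Prod.smul_mk, smul_smul, mul_comm]
    rw [this]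
    exact T.graph.smul_mem _ (hb i)

theorem closure_add_diagOp {c : κ → ℝ} (hc : ∀ i, c i = a i + a' i) :
    (diagOp b a + diagOp b a').closure = diagOp b c := by
  refine closure_eq_diagOp b c (LinearPMap.le_of_le_graph fun p hp ↦ ?_) fun i ↦ ?_
  · obtain ⟨x, hx, hx'⟩ := (LinearPMap.mem_graph_iff _).1 hp
    rw [mem_graph_diagOp]
    intro i
    rw [← hx', ← hx, LinearPMap.add_apply, inner_add_right, inner_diagOp, inner_diagOp, hc]
    push_cast
    ring
  · obtain ⟨x, hx, hx'⟩ := (LinearPMap.mem_graph_iff _).1 (basis_mem_graph_diagOp b a i)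
    obtain ⟨y, hy, hy'⟩ := (LinearPMap.mem_graph_iff _).1 (basis_mem_graph_diagOp b a' i)
    have hx0 : b i ∈ (diagOp b a).domain := LinearPMap.mem_domain_of_mem_graph
      (basis_mem_graph_diagOp b a i)
    have hy0 : b i ∈ (diagOp b a').domain := LinearPMap.mem_domain_of_mem_graph
      (basis_mem_graph_diagOp b a' i)
    refine (LinearPMap.mem_graph_iff _).2 ⟨⟨b i, hx0, hy0⟩, rfl, ?_⟩
    have h1 : (⟨b i, hx0⟩ : (diagOp b a).domain) = x := Subtype.ext hx.symm
    have h2 : (⟨b i, hy0⟩ : (diagOp b a').domain) = y := Subtype.ext hy.symm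
    rw [LinearPMap.add_apply, h1, h2, hx', hy', ← add_smul, hc]
    push_cast
    rfl

theorem exists_bounded_diag {c : κ → ℂ} {C : ℝ} (hc : ∀ i, ‖c i‖ ≤ C) :
    ∃ Q : E →L[ℂ] E, ∀ x i, inner ℂ (b i) (Q x) = c i * inner ℂ (b i) x := by
  have hmem : ∀ x : E, Memℓp (fun i ↦ c i * b.repr x i) 2 := fun x ↦ by
    rw [memℓp_gen_iff (by norm_num)]
    have h := (memℓp_gen_iff (p := 2) (by norm_num)).1 (lp.memℓp (b.repr x))
    refine Summable.of_nonneg_of_le (fun i ↦ by positivity) (fun i ↦ ?_) (h.mul_left (C ^ 2))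
    simp only [ENNReal.toReal_ofNat, Real.rpow_ofNat, norm_mul, mul_pow]
    gcongr
    exact hc i
  choose Q hQ using fun x ↦ (⟨b.repr.symm ⟨_, hmem x⟩, fun i ↦ by
    rw [← b.repr_apply_apply, ← b.repr_apply_apply, LinearIsometryEquiv.apply_symm_apply]⟩ :
    ∃ y : E, ∀ i, inner ℂ (b i) y = c i * inner ℂ (b i) x)
  let L : E →ₗ[ℂ] E :=
    { toFun := Q
      map_add' := fun x y ↦ HilbertBasis.ext_inner (b := b) fun i ↦ by
        simp only [hQ, inner_add_right]; ring
      map_smul' := fun r x ↦ HilbertBasis.ext_inner (b := b) fun i ↦ by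
        simp only [hQ, inner_smul_right, RingHom.id_apply]; ring }
  -- Continuity comes from the closed graph theorem, the graph being cut out by continuous
  -- coordinate equations.
  refine ⟨⟨L, L.continuous_of_isClosed_graph ?_⟩, hQ⟩
  have : (L.graph : Set (E × E)) = ⋂ i, {p | inner ℂ (b i) p.2 = c i * inner ℂ (b i) p.1} := by
    ext p
    simp only [SetLike.mem_coe, LinearMap.mem_graph_iff, Set.mem_iInter, Set.mem_ofPred_eq, ← hQ]
    exact ⟨fun h i ↦ by rw [h]; rfl, fun h ↦ HilbertBasis.ext_inner (b := b) h⟩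
  rw [this]
  exact isClosed_iInter fun i ↦ isClosed_eq (by fun_prop) (by fun_prop)

variable {b a} in
-- A resolvent is forced to be diagonal with entries (z - a i)⁻¹; if z = a i, solving the resolvent
-- equation for b i would give 0 = 1.
theorem IsResolventAt.inner_basis {z : ℂ} {Q : E →L[ℂ] E} (hQ : IsResolventAt (diagOp b a) z Q)
    (y : E) (i : κ) : z ≠ a i ∧ inner ℂ (b i) (Q y) = (z - a i)⁻¹ * inner ℂ (b i) y := by
  have key : ∀ y, (z - a i) * inner ℂ (b i) (Q y) = inner ℂ (b i) y := fun y ↦ by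
    obtain ⟨x, hx, hxy⟩ := hQ.1 y
    have := congrArg (inner ℂ (b i)) hxy
    rwa [inner_sub_right, inner_smul_right, inner_diagOp, ← sub_mul, hx] at this
  have h0 : z - a i ≠ 0 := fun h0 ↦ by
    have := key (b i)
    rw [h0, zero_mul, HilbertBasis.inner_eq_ite, if_pos rfl] at this
    exact zero_ne_one this
  exact ⟨sub_ne_zero.1 h0, by rw [← key y, inv_mul_cancel_left₀ h0]⟩

theorem exists_isResolventAt_diagOp {z : ℂ} {ε : ℝ} (hε : 0 < ε) (hz : ∀ i, ε ≤ ‖z - a i‖) :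
    ∃ Q, IsResolventAt (diagOp b a) z Q := by
  have h0 : ∀ i, z - a i ≠ 0 := fun i ↦ norm_pos_iff.1 (hε.trans_le (hz i))
  obtain ⟨Q, hQ⟩ := exists_bounded_diag b (c := fun i ↦ (z - a i)⁻¹) (C := ε⁻¹) fun i ↦ by
    rw [norm_inv]; exact inv_anti₀ hε (hz i)
  refine ⟨Q, fun y ↦ ?_, fun x ↦ HilbertBasis.ext_inner (b := b) fun i ↦ ?_⟩
  -- Solving (z - T) x = y for T x shows that the value at x = Q y must be z Q y - y.
  · obtain ⟨x, hx, hxy⟩ := exists_diagOp_eq b a (x := Q y) (y := z • Q y - y) fun i ↦ by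
      rw [inner_sub_right, inner_smul_right, hQ]
      have := h0 i
      field_simp
      ring
    exact ⟨x, hx, by rw [hxy, hx, sub_sub_cancel]⟩
  · rw [hQ, inner_sub_right, inner_smul_right, inner_diagOp, ← sub_mul, inv_mul_cancel_left₀ (h0 i)]

/-- In general the spectrum is the closure of the set of eigenvalues; `hd` says that this set is
already closed. -/
theorem unboundedSpectrum_diagOp
    (hd : ∀ z : ℂ, (∀ i, z ≠ a i) → ∃ ε > 0, ∀ i, ε ≤ ‖z - a i‖) :
    unboundedSpectrum (diagOp b a) = {z : ℂ | ∃ i, z = a i} := by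
  ext z
  simp only [unboundedSpectrum, Set.mem_ofPred_eq]
  constructor
  · intro h
    by_contra! h'
    obtain ⟨ε, hε, hz⟩ := hd z h'
    exact h (exists_isResolventAt_diagOp b a hε hz)
  · rintro ⟨i, rfl⟩ ⟨Q, hQ⟩
    exact (hQ.inner_basis 0 i).1 rfl

theorem mem_unboundedEigenspace_diagOp {z : ℂ} {x : E} :
    x ∈ unboundedEigenspace (diagOp b a) z ↔ ∀ i, z ≠ a i → inner ℂ (b i) x = 0 := by
  have h1 : x ∈ unboundedEigenspace (diagOp b a) z ↔ (x, z • x) ∈ (diagOp b a).graph := by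
    rw [LinearPMap.mem_graph_iff]; rfl
  rw [h1, mem_graph_diagOp]
  refine forall_congr' fun i ↦ ?_
  rw [inner_smul_right, ← sub_eq_zero, ← sub_mul, mul_eq_zero, sub_eq_zero]
  tauto

theorem unboundedCommute_diagOp : UnboundedCommute (diagOp b a) (diagOp b a') := by
  refine ⟨fun z w P Q hP hQ ↦ ?_, Submodule.span ℂ (Set.range b),
    Submodule.dense_iff_topologicalClosure_eq_top.2 b.dense_span, fun x hx ↦ ?_⟩
  · ext x
    refine HilbertBasis.ext_inner (b := b) fun i ↦ ?_
    simp only [ContinuousLinearMap.comp_apply, (hP.inner_basis _ i).2, (hQ.inner_basis _ i).2]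
    ring
  -- Stated through graphs, the compatibility of the two products is linear in x and can be proved
  -- by induction over the span of the basis.
  · have key : ∃ y y' w, (x, y) ∈ (diagOp b a).graph ∧ (x, y') ∈ (diagOp b a').graph ∧
        (y, w) ∈ (diagOp b a').graph ∧ (y', w) ∈ (diagOp b a).graph := by
      induction hx using Submodule.span_induction with
      | mem x h =>
        obtain ⟨i, rfl⟩ := h
        refine ⟨_, _, (a i : ℂ) • (a' i : ℂ) • b i, basis_mem_graph_diagOp b a i,
          basis_mem_graph_diagOp b a' i, ?_, ?_⟩
        · exact Submodule.smul_mem _ (a i : ℂ) (basis_mem_graph_diagOp b a' i)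
        · rw [smul_comm]
          exact Submodule.smul_mem _ (a' i : ℂ) (basis_mem_graph_diagOp b a i)
      | zero => exact ⟨0, 0, 0, zero_mem _, zero_mem _, zero_mem _, zero_mem _⟩
      | add x₁ x₂ _ _ h₁ h₂ =>
        obtain ⟨y₁, y₁', w₁, p1, p2, p3, p4⟩ := h₁
        obtain ⟨y₂, y₂', w₂, q1, q2, q3, q4⟩ := h₂
        exact ⟨y₁ + y₂, y₁' + y₂', w₁ + w₂, add_mem p1 q1, add_mem p2 q2, add_mem p3 q3,
          add_mem p4 q4⟩
      | smul c x _ h =>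
        obtain ⟨y, y', w, p1, p2, p3, p4⟩ := h
        exact ⟨c • y, c • y', c • w, Submodule.smul_mem _ c p1, Submodule.smul_mem _ c p2,
          Submodule.smul_mem _ c p3, Submodule.smul_mem _ c p4⟩
    obtain ⟨y, y', w, p1, p2, p3, p4⟩ := key
    obtain ⟨s, hs, hs'⟩ := (LinearPMap.mem_graph_iff _).1 p1
    obtain ⟨t, ht, ht'⟩ := (LinearPMap.mem_graph_iff _).1 p2
    obtain ⟨r, hr, hr'⟩ := (LinearPMap.mem_graph_iff _).1 p3
    obtain ⟨u, hu, hu'⟩ := (LinearPMap.mem_graph_iff _).1 p4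
    exact ⟨s, t, r, u, hs, ht, hr.trans hs'.symm, hu.trans ht'.symm, hu'.trans hr'.symm⟩

end DiagOp

/-! ### Hilbert bases adapted to an orthogonal family of subspaces -/

section Adapted

universe u w

variable {E : Type u} [NormedAddCommGroup E] [InnerProductSpace ℂ E] {ι : Type w} {κ : Type*}

/-- The pairwise orthogonal subspaces `V i` of `S` span a dense subspace of `S`. -/
structure IsOrthogonalTotal (S : Submodule ℂ E) (V : ι → Submodule ℂ E) : Prop where
  le : ∀ i, V i ≤ S
  orthogonal : ∀ i j, i ≠ j → ∀ x ∈ V i, ∀ y ∈ V j, inner ℂ x y = 0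
  total : ∀ x ∈ S, (∀ i, ∀ w ∈ V i, inner ℂ w x = 0) → x = 0

variable {S : Submodule ℂ E} {V : ι → Submodule ℂ E}

theorem inner_eq_mul_inner_of_mem_closure {W : Submodule ℂ E} {x y : E} {c : ℂ}
    (h : ∀ w ∈ W, inner ℂ w y = c * inner ℂ w x) {w : E} (hw : w ∈ W.topologicalClosure) :
    inner ℂ w y = c * inner ℂ w x := by
  have hc : IsClosed {w : E | inner ℂ w y = c * inner ℂ w x} :=
    isClosed_eq (by fun_prop) (by fun_prop)
  exact closure_minimal (s := (W : Set E)) (fun w hw ↦ h w hw) hc hw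

theorem IsOrthogonalTotal.exists_hilbertBasis [CompleteSpace S] (h : IsOrthogonalTotal S V) :
    ∃ (κ : Type (max u w)) (b : HilbertBasis κ ℂ S) (idx : κ → ι),
      ∀ k, (b k : E) ∈ (V (idx k)).topologicalClosure := by
  classical
  -- The V i need not be complete, so Hilbert bases are chosen in their closures inside S.
  let W : ι → Submodule ℂ S := fun i ↦ ((V i).comap S.subtype).topologicalClosure
  have : ∀ i, CompleteSpace (W i) := fun i ↦
    (Submodule.isClosed_topologicalClosure _).completeSpace_coe
  choose s e he using fun i ↦ _root_.exists_hilbertBasis ℂ (W i)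
  have hW : ∀ i, ∀ w ∈ W i, (w : E) ∈ (V i).topologicalClosure := fun i w hw ↦ by
    have hc : IsClosed {w : S | (w : E) ∈ (V i).topologicalClosure} :=
      (Submodule.isClosed_topologicalClosure _).preimage continuous_subtype_val
    exact closure_minimal (s := ((V i).comap S.subtype : Set S))
      (fun w hw ↦ (V i).le_topologicalClosure hw) hc hw
  have hort : ∀ i j, i ≠ j → ∀ x ∈ (V i).topologicalClosure, ∀ y ∈ (V j).topologicalClosure,
      inner ℂ x y = 0 := by
    intro i j hij x hx y hy
    have h1 : ∀ w ∈ V i, inner ℂ w y = 0 := fun w hw ↦ by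
      rw [inner_eq_zero_symm]
      have := inner_eq_mul_inner_of_mem_closure (x := w) (y := w) (c := 0) (W := V j)
        (fun v hv ↦ by rw [h.orthogonal j i hij.symm v hv w hw, zero_mul]) hy
      simpa using this
    have := inner_eq_mul_inner_of_mem_closure (x := y) (y := y) (c := 0)
      (fun v hv ↦ by rw [h1 v hv, zero_mul]) hx
    simpa using this
  have hfam : OrthogonalFamily ℂ (fun i ↦ W i) fun i ↦ (W i).subtypeₗᵢ := by
    intro i j hij x y
    exact hort i j hij _ (hW i _ x.2) _ (hW j _ y.2)
  have hon := hfam.orthonormal_sigma_orthonormal fun i ↦ (e i).orthonormal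
  have hsp : ⊤ ≤ (Submodule.span ℂ (Set.range fun a : Σ i, s i ↦
      (W a.1).subtypeₗᵢ (e a.1 a.2))).topologicalClosure := by
    rw [top_le_iff, Submodule.topologicalClosure_eq_top_iff, Submodule.eq_bot_iff]
    intro x hx
    refine Subtype.ext (h.total x x.2 fun i w hw ↦ ?_)
    -- A vector orthogonal to the whole basis is orthogonal to each V i, by expanding w in the basis
    -- of the closure; totality then applies.
    have hx0 : ∀ k, inner ℂ ((e i k : W i) : S) x = 0 := fun k ↦
      hx _ (Submodule.subset_span ⟨⟨i, k⟩, rfl⟩)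
    have hw' : (⟨w, h.le i hw⟩ : S) ∈ W i := Submodule.le_topologicalClosure _ hw
    have hsum := ((e i).hasSum_repr ⟨_, hw'⟩).mapL (W i).subtypeL
    have h0 := hsum.mapL (innerSL ℂ x)
    have h1 : ∀ k, innerSL ℂ x ((W i).subtypeL ((e i).repr ⟨_, hw'⟩ k • e i k)) = 0 := fun k ↦ by
      have := inner_eq_zero_symm.1 (hx0 k)
      simp [this]
    simp only [h1] at h0
    have := h0.unique hasSum_zero
    rw [inner_eq_zero_symm]
    exact this
  refine ⟨Σ i, s i, HilbertBasis.mk hon hsp, Sigma.fst, fun k ↦ ?_⟩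
  rw [HilbertBasis.coe_mk]
  exact hW _ _ (e k.1 k.2).2

section

variable [CompleteSpace S] {b : HilbertBasis κ ℂ S} {idx : κ → ι}

theorem IsOrthogonalTotal.inner_basis_eq_zero (h : IsOrthogonalTotal S V)
    (hb : ∀ k, (b k : E) ∈ (V (idx k)).topologicalClosure) {k : κ} {i : ι} (hi : idx k ≠ i)
    {w : S} (hw : (w : E) ∈ V i) : inner ℂ (b k) w = 0 := by
  have := inner_eq_mul_inner_of_mem_closure (x := (w : E)) (y := w) (c := 0)
    (fun v hv ↦ by rw [h.orthogonal _ i hi v hv w hw, zero_mul]) (hb k)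
  rw [zero_mul] at this
  exact this

/-- The graph is described by testing against the V i instead of the basis. A unitary operator that
permutes the V i need not permute the basis, so this is the form in which conjugation can be
computed. -/
theorem IsOrthogonalTotal.mem_graph_diagOp_iff (h : IsOrthogonalTotal S V)
    (hb : ∀ k, (b k : E) ∈ (V (idx k)).topologicalClosure) (a : ι → ℝ) {p : S × S} :
    p ∈ (diagOp b fun k ↦ a (idx k)).graph ↔
      ∀ i, ∀ w ∈ V i, inner ℂ w (p.2 : E) = a i * inner ℂ w (p.1 : E) := by
  rw [mem_graph_diagOp]
  refine ⟨fun hp i w hw ↦ ?_, fun hp k ↦ inner_eq_mul_inner_of_mem_closure (hp (idx k)) (hb k)⟩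
  have e : ∀ y : S, inner ℂ w (y : E) = inner ℂ (⟨w, h.le i hw⟩ : S) y := fun y ↦ rfl
  rw [e, e, ← b.tsum_inner_mul_inner, ← b.tsum_inner_mul_inner, ← tsum_mul_left]
  refine tsum_congr fun k ↦ ?_
  by_cases hk : idx k = i
  · rw [hp k, hk]; ring
  · rw [inner_eq_zero_symm.1 (h.inner_basis_eq_zero hb hk (w := ⟨w, h.le i hw⟩) hw)]; ring

theorem IsOrthogonalTotal.exists_idx_eq_iff (h : IsOrthogonalTotal S V)
    (hb : ∀ k, (b k : E) ∈ (V (idx k)).topologicalClosure) {i : ι} :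
    (∃ k, idx k = i) ↔ V i ≠ ⊥ := by
  constructor
  · rintro ⟨k, rfl⟩ hbot
    have := hb k
    rw [hbot, (Submodule.closed_of_finiteDimensional ⊥).submodule_topologicalClosure_eq,
      Submodule.mem_bot] at this
    have h1 := b.orthonormal.ne_zero k
    exact h1 (Subtype.ext this)
  · intro hne
    by_contra! hcon
    refine hne ((Submodule.eq_bot_iff _).2 fun w hw ↦ ?_)
    have : (⟨w, h.le i hw⟩ : S) = 0 := HilbertBasis.ext_inner (b := b) fun k ↦ by
      rw [h.inner_basis_eq_zero hb (hcon k) (w := ⟨w, h.le i hw⟩) hw, inner_zero_right]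
    exact congrArg Subtype.val this

theorem isClosed_of_completeSpace (S : Submodule ℂ E) [CompleteSpace S] : IsClosed (S : Set E) :=
  (completeSpace_coe_iff_isComplete.1 ‹_›).isClosed

theorem IsOrthogonalTotal.map_unboundedEigenspace (h : IsOrthogonalTotal S V)
    (hb : ∀ k, (b k : E) ∈ (V (idx k)).topologicalClosure) (a : ι → ℝ) (c : ℂ) :
    (unboundedEigenspace (diagOp b fun k ↦ a (idx k)) c).map S.subtype =
      (⨆ i : {i // c = a i}, V i).topologicalClosure := by
  refine le_antisymm ?_ (Submodule.topologicalClosure_minimal _ (iSup_le fun i w hw ↦ ?_) ?_)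
  · rintro _ ⟨x, hx, rfl⟩
    have hx' := (mem_unboundedEigenspace_diagOp b _).1 hx
    have hs := (b.hasSum_repr x).mapL S.subtypeL
    refine (Submodule.isClosed_topologicalClosure _).mem_of_tendsto hs
      (.of_forall fun s ↦ sum_mem fun k _ ↦ ?_)
    rw [map_smul, b.repr_apply_apply]
    by_cases hk : c = a (idx k)
    · refine Submodule.smul_mem _ _ (Submodule.topologicalClosure_mono ?_ (hb k))
      exact le_iSup (fun i : {i // c = a i} ↦ V i) ⟨idx k, hk⟩
    · rw [hx' k hk, zero_smul]; exact zero_mem _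
  · refine ⟨⟨w, h.le _ hw⟩, (mem_unboundedEigenspace_diagOp b _).2 fun k hk ↦ ?_, rfl⟩
    refine h.inner_basis_eq_zero hb (i := (i : ι)) (fun hi ↦ hk ?_) hw
    rw [hi]; exact i.2
  · refine (isClosed_of_completeSpace S).isClosedEmbedding_subtypeVal.isClosedMap _ ?_
    have : (unboundedEigenspace (diagOp b fun k ↦ a (idx k)) c : Set S) =
        ⋂ (k) (_ : c ≠ a (idx k)), {x | inner ℂ (b k) x = 0} := by
      ext x; simp [mem_unboundedEigenspace_diagOp]
    rw [this]
    exact isClosed_iInter fun k ↦ isClosed_iInter fun _ ↦ isClosed_eq (by fun_prop) (by fun_prop)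

theorem IsOrthogonalTotal.topologicalClosure_iSup (h : IsOrthogonalTotal S V) :
    (⨆ i, V i).topologicalClosure = S := by
  obtain ⟨κ, b, idx, hb⟩ := h.exists_hilbertBasis
  refine le_antisymm (Submodule.topologicalClosure_minimal _ (iSup_le h.le)
    (isClosed_of_completeSpace S)) fun x hx ↦ ?_
  have hs := (b.hasSum_repr ⟨x, hx⟩).mapL S.subtypeL
  refine (Submodule.isClosed_topologicalClosure _).mem_of_tendsto hs
    (.of_forall fun s ↦ sum_mem fun k _ ↦ ?_)
  rw [map_smul]
  exact Submodule.smul_mem _ _ (Submodule.topologicalClosure_mono (le_iSup V _) (hb k))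

variable {U : E ≃ₗᵢ[ℂ] E} {σ : ι → ι}

/-- S is the closure of the sum of the V i, which U permutes; surjectivity of σ supplies the
inclusion for the inverse of U. -/
theorem IsOrthogonalTotal.map_eq (h : IsOrthogonalTotal S V) (hσ : Function.Surjective σ)
    (hU : ∀ i, (V i).map (U.toLinearEquiv : E →ₗ[ℂ] E) = V (σ i)) :
    S.map (U.toLinearEquiv : E →ₗ[ℂ] E) = S := by
  have hS := isClosed_of_completeSpace S
  refine le_antisymm ?_ fun x hx ↦ ⟨U.symm x, ?_, U.apply_symm_apply x⟩
  · rw [Submodule.map_le_iff_le_comap]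
    conv_lhs => rw [← h.topologicalClosure_iSup]
    refine Submodule.topologicalClosure_minimal _ (iSup_le fun i ↦ ?_) (hS.preimage U.continuous)
    rw [← Submodule.map_le_iff_le_comap, hU]
    exact h.le _
  · have : S ≤ S.comap (U.symm.toLinearEquiv : E →ₗ[ℂ] E) := by
      conv_lhs => rw [← h.topologicalClosure_iSup]
      refine Submodule.topologicalClosure_minimal _ (iSup_le fun j ↦ ?_)
        (hS.preimage U.symm.continuous)
      obtain ⟨i, rfl⟩ := hσ j
      rw [← hU]
      rintro _ ⟨w, hw, rfl⟩
      have : U.symm (U w) ∈ S := by rw [U.symm_apply_apply]; exact h.le i hw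
      exact this
    exact this hx

theorem mem_graph_conj {T : S →ₗ.[ℂ] S} {p : S × S} :
    p ∈ (conj U T).graph ↔ ∃ x ∈ T.graph, U x.1 = p.1 ∧ U x.2 = p.2 := by
  unfold conj
  rw [Submodule.toLinearPMap_graph_eq]
  · rfl
  · rintro p ⟨x, hx, h1, h2⟩ h0
    rw [h0, Submodule.coe_zero, U.map_eq_zero_iff, Submodule.coe_eq_zero] at h1
    have := LinearPMap.graph_fst_eq_zero_snd T hx h1
    rw [this, Submodule.coe_zero, map_zero] at h2
    exact Subtype.ext h2.symm

/-- Unitarity carries the test against w ∈ V i to the test against U w ∈ V (σ i), so conjugation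
relabels the eigenvalues along σ. -/
theorem IsOrthogonalTotal.conj_diagOp (h : IsOrthogonalTotal S V)
    (hb : ∀ k, (b k : E) ∈ (V (idx k)).topologicalClosure) (hσ : Function.Surjective σ)
    (hU : ∀ i, (V i).map (U.toLinearEquiv : E →ₗ[ℂ] E) = V (σ i)) {a a' : ι → ℝ}
    (ha : ∀ i, a' (σ i) = a i) :
    conj U (diagOp b fun k ↦ a (idx k)) = diagOp b fun k ↦ a' (idx k) := by
  have hS := h.map_eq hσ hU
  have hV : ∀ i w, w ∈ V i → U w ∈ V (σ i) := fun i w hw ↦ by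
    rw [← hU]; exact ⟨w, hw, rfl⟩
  refine LinearPMap.eq_of_eq_graph ?_
  ext p
  rw [mem_graph_conj, h.mem_graph_diagOp_iff hb a']
  constructor
  · rintro ⟨x, hx, h1, h2⟩ j w hw
    rw [h.mem_graph_diagOp_iff hb a] at hx
    obtain ⟨i, rfl⟩ := hσ j
    rw [← hU] at hw
    obtain ⟨w, hw, rfl⟩ := hw
    have := hx i w hw
    rw [← h1, ← h2, ha, ← U.inner_map_map w, ← U.inner_map_map w] at *
    exact this
  · intro hp
    have hpre : ∀ x : S, ∃ y : S, U y = x := fun x ↦ by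
      obtain ⟨y, hy, e⟩ := hS.ge x.2
      exact ⟨⟨y, hy⟩, e⟩
    obtain ⟨x₁, h1⟩ := hpre p.1
    obtain ⟨x₂, h2⟩ := hpre p.2
    refine ⟨(x₁, x₂), (h.mem_graph_diagOp_iff hb a).2 fun i w hw ↦ ?_, h1, h2⟩
    have := hp (σ i) (U w) (hV i w hw)
    rwa [← h1, ← h2, ha, U.inner_map_map, U.inner_map_map] at this

end

end Adapted

section Characters

universe u

variable {k : Type u} [NormedField k] [IsUltrametricDist k] {q : ℕ} [NormalizedLocalField k q]
  [ProperSpace k] [MeasurableSpace k] [BorelSpace k] {μ : Measure k} [μ.IsAddHaarMeasure]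
  {f : ℕ} {j : ℤ} {χ : kˣ →ₜ* Circle}

/-! ### Characters of the multiplicative group -/

/-- The character `χ` is trivial on the units congruent to `1` modulo the `f`-th power of the
maximal ideal. -/
def TrivialAt {k : Type*} [NormedField k] {q : ℕ} [NormalizedLocalField k q]
    (χ : kˣ →ₜ* Circle) (f : ℕ) : Prop :=
  ∀ u : kˣ, ‖1 - (u : k)‖ ≤ ((q : ℝ) ^ f)⁻¹ → χ u = 1

/-- The character `χ` is ramified and has conductor exponent `f`. -/
def HasConductor {k : Type*} [NormedField k] {q : ℕ} [NormalizedLocalField k q]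
    (χ : kˣ →ₜ* Circle) (f : ℕ) : Prop :=
  (∃ u : kˣ, ‖(u : k)‖ = 1 ∧ χ u ≠ 1) ∧ IsLeast {m | 1 ≤ m ∧ TrivialAt χ m} f

open scoped Classical in
/-- A character of `kˣ` as a function on `k`, extended by zero. -/
def unitsFun {k : Type*} [NormedField k] (χ : kˣ →ₜ* Circle) (x : k) : ℂ :=
  if h : x = 0 then 0 else (χ (Units.mk0 x h) : ℂ)

theorem unitsFun_coe (u : kˣ) : unitsFun χ (u : k) = χ u := by
  rw [unitsFun, dif_neg u.ne_zero, Units.mk0_val]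

theorem unitsFun_mul (u : kˣ) (x : k) : unitsFun χ (u * x) = χ u * unitsFun χ x := by
  rcases eq_or_ne x 0 with rfl | hx
  · simp [unitsFun]
  · lift x to kˣ using isUnit_iff_ne_zero.2 hx
    rw [← Units.val_mul, unitsFun_coe, unitsFun_coe, map_mul, Circle.coe_mul]

/-- The restriction of a character to the sphere of radius `q ^ j`. -/
def sphereFun {k : Type*} [NormedField k] {q : ℕ} [NormalizedLocalField k q] (χ : kˣ →ₜ* Circle)
    (j : ℤ) : k → ℂ :=
  (qSphere j).indicator (unitsFun χ)

theorem norm_eq_one_of_norm_one_sub_lt {u : k} (hu : ‖1 - u‖ < 1) : ‖u‖ = 1 := by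
  have : u = 1 + -(1 - u) := by ring
  rw [this, IsUltrametricDist.norm_add_eq_max_of_norm_ne_norm (by
    rw [norm_neg, norm_one]; exact hu.ne'), norm_neg, norm_one, max_eq_left hu.le]

theorem inv_q_pow_lt_one (k : Type*) [NormedField k] {q : ℕ} [NormalizedLocalField k q]
    (hf : 1 ≤ f) : ((q : ℝ) ^ f)⁻¹ < 1 :=
  inv_lt_one_of_one_lt₀ (one_lt_pow₀ (one_lt_q k) (by lia))

/-- x + t = (1 + t/x) x, and for x on the sphere the first factor is within q^(-f) of 1. -/
theorem TrivialAt.sphereFun_add (hχ : TrivialAt χ f) (hf : 1 ≤ f) (x t : k)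
    (ht : ‖t‖ ≤ (q : ℝ) ^ (j - f)) : sphereFun χ j (x + t) = sphereFun χ j x := by
  have hs := add_mem_qSphere_iff (x := x) (j := j) (ht.trans_lt ((zpow_q_lt_iff k).2 (by lia)))
  by_cases hx : x ∈ qSphere j
  · rw [sphereFun, Set.indicator_of_mem hx, Set.indicator_of_mem (hs.2 hx)]
    have hxn := mem_qSphere.1 hx
    have hx0 : x ≠ 0 := by rw [← norm_pos_iff, hxn]; exact zpow_q_pos k j
    have htx : ‖1 - (1 + t / x)‖ ≤ ((q : ℝ) ^ f)⁻¹ := by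
      rw [sub_add_cancel_left, norm_neg, norm_div, hxn, div_le_iff₀ (zpow_q_pos k j)]
      refine ht.trans_eq ?_
      rw [zpow_sub₀ (q_ne_zero k), zpow_natCast]; ring
    have h0 : 1 + t / x ≠ 0 := by
      rw [← norm_pos_iff, norm_eq_one_of_norm_one_sub_lt (htx.trans_lt (inv_q_pow_lt_one k hf))]
      exact one_pos
    have e : x + t = (Units.mk0 _ h0 : kˣ) * x := by rw [Units.val_mk0]; field_simp
    rw [e, unitsFun_mul, hχ _ htx, Circle.coe_one, one_mul]
  · rw [sphereFun, Set.indicator_of_notMem hx, Set.indicator_of_notMem (mt hs.1 hx)]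

theorem HasConductor.exists_ne_one (hχ : HasConductor χ f) :
    ∃ u : kˣ, ‖(u : k)‖ = 1 ∧ ‖1 - (u : k)‖ ≤ (q : ℝ) ^ (1 - f : ℤ) ∧ χ u ≠ 1 := by
  obtain ⟨⟨u, hu, hu1⟩, ⟨hf, -⟩, hmin⟩ := hχ
  rcases hf.eq_or_lt with rfl | hf
  -- For f = 1 minimality says nothing; ramification provides u, and |1 - u| ≤ 1 holds for every
  -- unit.
  · refine ⟨u, hu, ?_, hu1⟩
    have := norm_sub_le_max_ultra 1 (u : k)
    rw [hu, norm_one, max_self] at this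
    simpa using this
  · have h : ¬ TrivialAt χ (f - 1) := fun h ↦ by
      have : f ≤ f - 1 := hmin ⟨by lia, h⟩
      lia
    rw [TrivialAt] at h
    push Not at h
    obtain ⟨u, hu, hu1⟩ := h
    refine ⟨u, norm_eq_one_of_norm_one_sub_lt (hu.trans_lt (inv_q_pow_lt_one k (by lia))), ?_, hu1⟩
    refine hu.trans_eq ?_
    rw [← zpow_natCast, ← zpow_neg]; congr 1; lia

/-- A character that is trivial at level `f` but does not have conductor exponent `f`. -/
theorem trivial_of_not_hasConductor (hχ : TrivialAt χ f) (hf : 1 ≤ f) (h : ¬ HasConductor χ f) :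
    (2 ≤ f ∧ TrivialAt χ (f - 1)) ∨ ∀ u : kˣ, ‖(u : k)‖ = 1 → χ u = 1 := by
  by_contra! hcon
  obtain ⟨h1, u, hu, hu1⟩ := hcon
  refine h ⟨⟨u, hu, hu1⟩, ⟨hf, hχ⟩, fun m hm ↦ ?_⟩
  by_contra! hmf
  refine h1 (by have := hm.1; lia) fun u hu ↦ hm.2 u (hu.trans ?_)
  exact inv_anti₀ (pow_pos (q_pos k) _) (pow_le_pow_right₀ (one_lt_q k).le (by lia))

theorem TrivialAt.continuous_sphereFun (hχ : TrivialAt χ f) (hf : 1 ≤ f) :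
    Continuous (sphereFun χ j) :=
  (isLocallyConstant_of_invariant (hχ.sphereFun_add hf)).continuous

theorem TrivialAt.memLp_sphereFun (hχ : TrivialAt χ f) (hf : 1 ≤ f) :
    MemLp (sphereFun χ j) 2 μ :=
  (hχ.continuous_sphereFun hf).memLp_of_hasCompactSupport
    (.intro (isCompact_qSphere j) fun _ hx ↦ Set.indicator_of_notMem hx _)

/-- Some unit u within q^(1-f) of 1 has χ(u) ≠ 1. Multiplication by u preserves each ball of radius
q^(j-f+1) cut with the sphere, but multiplies the integral over it by χ(u), so that integral is
zero. -/
theorem HasConductor.isLevel_sphereFun (hχ : HasConductor χ f) :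
    IsLevel μ f j (sphereFun χ j) where
  supp x hx := Set.indicator_of_notMem (by rwa [mem_qSphere]) _
  inv := hχ.2.1.2.sphereFun_add hχ.2.1.1
  avg a := by
    obtain ⟨u, hu, hu1, hχu⟩ := hχ.exists_ne_one
    have hc : Continuous (sphereFun χ j) := hχ.2.1.2.continuous_sphereFun hχ.2.1.1
    have hw : ∀ x, (sphereFun χ j) (u * x) = χ u * sphereFun χ j x := fun x ↦ by
      have : (u : k) * x ∈ qSphere j ↔ x ∈ qSphere j := by
        rw [mem_qSphere, mem_qSphere, norm_mul, hu, one_mul]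
      by_cases hx : x ∈ qSphere j
      · rw [sphereFun, Set.indicator_of_mem hx, Set.indicator_of_mem (this.2 hx), unitsFun_mul]
      · rw [sphereFun, Set.indicator_of_notMem hx, Set.indicator_of_notMem (mt this.1 hx), mul_zero]
    have hpre : ((u : k) * ·) ⁻¹' (qBall a (j - f + 1) ∩ qSphere j) =
        qBall a (j - f + 1) ∩ qSphere j := by
      ext x
      have h1 : (u : k) * x ∈ qSphere j ↔ x ∈ qSphere j := by
        rw [mem_qSphere, mem_qSphere, norm_mul, hu, one_mul]
      rw [Set.mem_preimage, Set.mem_inter_iff, Set.mem_inter_iff, h1]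
      refine and_congr_left fun hx ↦ ?_
      have h2 : (u : k) * x = x + -((1 - u) * x) := by ring
      rw [h2]
      refine add_mem_qBall_iff ?_
      rw [norm_neg, norm_mul, mem_qSphere.1 hx]
      refine (mul_le_mul_of_nonneg_right hu1 (zpow_q_pos k j).le).trans_eq ?_
      rw [← zpow_add₀ (q_ne_zero k)]; congr 1; ring
    have hs : MeasurableSet (qBall a (j - f + 1) ∩ qSphere j) :=
      (measurableSet_qBall _ _).inter (measurableSet_qSphere j)
    have h := setIntegral_comp_of_map_withDensity (μ := μ) measurable_const
      (measurable_const_mul (u : k)) (map_withDensity_mul μ u) hc.measurable hs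
    rw [hpre] at h
    simp only [hu, Real.sqrt_one, one_pow, Complex.ofReal_one, one_mul, hw] at h
    rw [integral_const_mul] at h
    have e : ∫ x in qBall a (j - f + 1), sphereFun χ j x ∂μ =
        ∫ x in qBall a (j - f + 1) ∩ qSphere j, sphereFun χ j x ∂μ := by
      rw [← setIntegral_indicator (measurableSet_qSphere j)]
      simp only [sphereFun, Set.indicator_indicator, Set.inter_self]
    rw [e]
    have h' : ((χ u : ℂ) - 1) * ∫ x in qBall a (j - f + 1) ∩ qSphere j, sphereFun χ j x ∂μ = 0 := by
      rw [sub_mul, ← h, one_mul, sub_self]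
    refine (mul_eq_zero.1 h').resolve_left ?_
    exact sub_ne_zero.2 fun h1 ↦ hχu (Circle.ext h1)

/-- Such a character either has smaller conductor, and is then invariant under the ball of
averaging, or is unramified, and is then constant on the sphere. -/
theorem IsLevel.integral_mul_sphereFun {h : k → ℂ} (hh : IsLevel μ f j h) (hf : 1 ≤ f)
    (hχ : TrivialAt χ f) (hχf : ¬ HasConductor χ f) : ∫ x, h x * sphereFun χ j x ∂μ = 0 := by
  rcases trivial_of_not_hasConductor hχ hf hχf with ⟨hf2, h1⟩ | h1
  · refine hh.integral_mul_eq_zero fun x t ht ↦ h1.sphereFun_add (by lia) x t (ht.trans_eq ?_)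
    congr 1; push_cast [show 1 ≤ f by lia]; ring
  · obtain ⟨a, ha⟩ := exists_norm_eq_zpow k j
    have ha0 : a ≠ 0 := by rw [← norm_pos_iff, ha]; exact zpow_q_pos k j
    have e : ∀ x, h x * sphereFun χ j x = h x * unitsFun χ a := fun x ↦ by
      by_cases hx : x ∈ qSphere j
      · have hx0 : x / a ≠ 0 := by
          rw [← norm_pos_iff, norm_div, ha, mem_qSphere.1 hx, div_self (zpow_q_pos k j).ne']
          exact one_pos
        have e1 : x = (Units.mk0 _ hx0 : kˣ) * a := by rw [Units.val_mk0]; field_simp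
        have e2 : unitsFun χ x = unitsFun χ a := by
          conv_lhs => rw [e1]
          rw [unitsFun_mul, h1 _ (by
            rw [Units.val_mk0, norm_div, ha, mem_qSphere.1 hx, div_self (zpow_q_pos k j).ne']),
            Circle.coe_one, one_mul]
        rw [sphereFun, Set.indicator_of_mem hx, e2]
      · rw [hh.eq_zero_of_notMem hx, zero_mul, zero_mul]
    simp only [e]
    exact hh.integral_mul_eq_zero (g := fun _ ↦ unitsFun χ a) fun _ _ _ ↦ rfl

/-! ### Expansion into characters -/

/-- The group of the units congruent to `1` modulo the `f`-th power of the maximal ideal. -/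
def higherUnits (k : Type*) [NormedField k] [IsUltrametricDist k] {q : ℕ} [NormalizedLocalField k q]
    (f : ℕ) : Subgroup kˣ where
  carrier := {u | ‖(u : k)‖ = 1 ∧ ‖(u : k) - 1‖ ≤ ((q : ℝ) ^ f)⁻¹}
  one_mem' := by simp
  mul_mem' := by
    rintro u v ⟨hu, hu'⟩ ⟨hv, hv'⟩
    refine ⟨by rw [Units.val_mul, norm_mul, hu, hv, one_mul], ?_⟩
    have : ((u * v : kˣ) : k) - 1 = (u - 1) * v + (v - 1) := by push_cast; ring
    rw [this]
    refine (IsUltrametricDist.norm_add_le_max _ _).trans (max_le ?_ hv')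
    rwa [norm_mul, hv, mul_one]
  inv_mem' := by
    rintro u ⟨hu, hu'⟩
    rw [Set.mem_ofPred_eq, Units.val_inv_eq_inv_val, norm_inv, hu, inv_one]
    refine ⟨rfl, ?_⟩
    have : (u : k)⁻¹ - 1 = -((u - 1) / u) := by have := u.ne_zero; field_simp; ring
    rwa [this, norm_neg, norm_div, hu, div_one]

theorem mem_higherUnits {u : kˣ} :
    u ∈ higherUnits k f ↔ ‖(u : k)‖ = 1 ∧ ‖(u : k) - 1‖ ≤ ((q : ℝ) ^ f)⁻¹ := Iff.rfl

/-- A function on a sphere that is invariant under translations by a small ball is a linear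
combination of characters. -/
theorem exists_eq_sum_sphereFun (hf : 1 ≤ f) {h : k → ℂ} (hs : ∀ x, x ∉ qSphere j → h x = 0)
    (hi : ∀ x t, ‖t‖ ≤ (q : ℝ) ^ (j - f) → h (x + t) = h x) :
    ∃ (ι : Type u) (_ : Fintype ι) (χ : ι → (kˣ →ₜ* Circle)) (c : ι → ℂ),
      (∀ i, TrivialAt (χ i) f) ∧ h = fun x ↦ ∑ i, c i * sphereFun (χ i) j x := by
  obtain ⟨ϖ', hϖ'⟩ := NormalizedLocalField.exists_uniformizer (k := k)
  have hϖ0 : ϖ' ≠ 0 := by rw [← norm_pos_iff, hϖ']; exact inv_pos.2 (q_pos k)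
  obtain ⟨ϖ, rfl⟩ : ∃ ϖ : kˣ, (ϖ : k) = ϖ' := ⟨Units.mk0 _ hϖ0, rfl⟩
  have hϖ : ∀ n : ℤ, ‖((ϖ ^ n : kˣ) : k)‖ = (q : ℝ) ^ (-n) := fun n ↦ by
    rw [Units.val_zpow_eq_zpow_val, norm_zpow, hϖ', inv_zpow, zpow_neg]
  -- Adjoining a uniformizer makes the quotient finite; every sphere still maps onto it, and the
  -- fibres are the balls of radius q^(i-f).
  let N : Subgroup kˣ := higherUnits k f ⊔ Subgroup.zpowers ϖ
  have hN : ∀ u ∈ N, ‖(u : k)‖ = 1 → u ∈ higherUnits k f := fun u hu h1 ↦ by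
    obtain ⟨y, hy, z, ⟨n, rfl⟩, rfl⟩ := Subgroup.mem_sup.1 hu
    simp only [Units.val_mul, norm_mul, (mem_higherUnits.1 hy).1, one_mul, hϖ] at h1
    rw [← zpow_zero (q : ℝ), zpow_q_inj k, neg_eq_zero] at h1
    subst h1
    simpa using hy
  have hrep : ∀ (g : kˣ ⧸ N) (i : ℤ), ∃ x : kˣ, ‖(x : k)‖ = (q : ℝ) ^ i ∧ (x : kˣ ⧸ N) = g := by
    intro g i
    obtain ⟨x, rfl⟩ := QuotientGroup.mk_surjective g
    obtain ⟨m, hm⟩ := NormalizedLocalField.norm_eq_zpow (x : k) x.ne_zero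
    refine ⟨x * ϖ ^ (m - i), ?_, ?_⟩
    · rw [Units.val_mul, norm_mul, hm, hϖ, ← zpow_add₀ (q_ne_zero k)]; congr 1; ring
    · rw [eq_comm, QuotientGroup.eq, inv_mul_cancel_left]
      exact (le_sup_right : _ ≤ N) (Subgroup.zpow_mem_zpowers ϖ _)
  have hclose : ∀ {x y : kˣ} {i : ℤ}, ‖(x : k)‖ = (q : ℝ) ^ i → ‖(y : k)‖ = (q : ℝ) ^ i →
      ((x : kˣ ⧸ N) = y ↔ ‖(y : k) - x‖ ≤ (q : ℝ) ^ (i - f)) := by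
    intro x y i hx hy
    have h1 : ‖((x⁻¹ * y : kˣ) : k)‖ = 1 := by
      rw [Units.val_mul, norm_mul, Units.val_inv_eq_inv_val, norm_inv, hx, hy,
        inv_mul_cancel₀ (zpow_q_pos k i).ne']
    have h2 : ‖((x⁻¹ * y : kˣ) : k) - 1‖ ≤ ((q : ℝ) ^ f)⁻¹ ↔
        ‖(y : k) - x‖ ≤ (q : ℝ) ^ (i - f) := by
      have : ((x⁻¹ * y : kˣ) : k) - 1 = (y - x) / x := by
        have := x.ne_zero
        rw [Units.val_mul, Units.val_inv_eq_inv_val]; field_simp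
      rw [this, norm_div, hx, div_le_iff₀ (zpow_q_pos k i), zpow_sub₀ (q_ne_zero k), zpow_natCast,
        div_eq_inv_mul]
    rw [QuotientGroup.eq, ← h2]
    exact ⟨fun h ↦ (mem_higherUnits.1 (hN _ h h1)).2, fun h ↦ (le_sup_left : _ ≤ N) ⟨h1, h⟩⟩
  choose rep hrep1 hrep2 using hrep
  -- Classes have representatives in the unit ball, which finitely many balls of radius q^(-f)
  -- cover; two representatives in the same one are congruent.
  have hfin : Finite (kˣ ⧸ N) := by
    obtain ⟨s, hs⟩ := exists_finset_cover_of_le (0 : k) 0 f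
    have : ∀ g : kˣ ⧸ N, ∃ b : s, (rep g 0 : k) ∈ qBall (b : k) (0 - f) := fun g ↦ by
      have h1 : (rep g 0 : k) ∈ Metric.closedBall (0 : k) ((q : ℝ) ^ (0 : ℤ)) := by
        rw [mem_closedBall_zero_iff, hrep1]
      obtain ⟨b, hb, hb'⟩ := Set.mem_iUnion₂.1 (hs h1)
      exact ⟨⟨b, hb⟩, hb'⟩
    choose F hF using this
    refine Finite.of_injective F fun g g' hgg ↦ ?_
    rw [← hrep2 g 0, ← hrep2 g' 0, hclose (hrep1 _ _) (hrep1 _ _), ← mem_qBall]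
    have h1 := hF g
    rw [hgg] at h1
    rw [← qBall_eq_of_mem h1]
    exact hF g'
  -- The characters of a finite abelian group are a basis of its functions, and on the sphere h
  -- factors through the quotient as `G`.
  let b := AddChar.complexBasis (Additive (kˣ ⧸ N))
  let G : Additive (kˣ ⧸ N) → ℂ := fun g ↦ h (rep g.toMul j)
  have : Fintype (AddChar (Additive (kˣ ⧸ N)) ℂ) := FiniteDimensional.fintypeBasisIndex b
  let χ : AddChar (Additive (kˣ ⧸ N)) ℂ → (kˣ →* Circle) := fun ψ ↦
    { toFun := fun u ↦ AddChar.circleEquivComplex.symm ψ (Additive.ofMul (u : kˣ ⧸ N))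
      map_one' := AddChar.map_zero_eq_one _
      map_mul' := fun u v ↦ AddChar.map_add_eq_mul (AddChar.circleEquivComplex.symm ψ)
        (Additive.ofMul (u : kˣ ⧸ N)) (Additive.ofMul (v : kˣ ⧸ N)) }
  have hχ1 : ∀ ψ (u : kˣ), ‖1 - (u : k)‖ ≤ ((q : ℝ) ^ f)⁻¹ → χ ψ u = 1 := fun ψ u hu ↦ by
    have : (u : kˣ ⧸ N) = 1 := by
      rw [QuotientGroup.eq_one_iff]
      refine (le_sup_left : _ ≤ N) ⟨norm_eq_one_of_norm_one_sub_lt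
        (hu.trans_lt (inv_q_pow_lt_one k hf)), by rwa [norm_sub_rev]⟩
    change AddChar.circleEquivComplex.symm ψ (Additive.ofMul (u : kˣ ⧸ N)) = 1
    rw [this]
    exact AddChar.map_zero_eq_one _
  have hχc : ∀ ψ, Continuous (χ ψ) := fun ψ ↦ by
    refine continuous_of_continuousAt_one _ ?_
    have : χ ψ =ᶠ[nhds 1] fun _ ↦ 1 := by
      have hc : Continuous fun u : kˣ ↦ ‖1 - (u : k)‖ := by fun_prop
      have := hc.continuousAt.eventually_lt (x₀ := 1) (continuousAt_const (y := ((q : ℝ) ^ f)⁻¹))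
        (by simpa using pow_pos (q_pos k) f)
      exact this.mono fun u hu ↦ hχ1 ψ u hu.le
    exact (continuousAt_congr this).2 continuousAt_const
  refine ⟨_, this, fun ψ ↦ ⟨χ ψ, hχc ψ⟩, fun ψ ↦ b.repr G ψ, fun ψ u hu ↦ ?_, ?_⟩
  · exact hχ1 ψ u hu
  ext x
  by_cases hx : x ∈ qSphere j
  · have hx0 : x ≠ 0 := by rw [← norm_pos_iff, mem_qSphere.1 hx]; exact zpow_q_pos k j
    lift x to kˣ using isUnit_iff_ne_zero.2 hx0
    have h1 := congrFun (b.sum_repr G) (Additive.ofMul (x : kˣ ⧸ N))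
    have h2 : G (Additive.ofMul (x : kˣ ⧸ N)) = h x := by
      have := (hclose (hrep1 (x : kˣ ⧸ N) j) (mem_qSphere.1 hx)).1 (hrep2 _ _)
      rw [norm_sub_rev] at this
      have := hi x (rep (x : kˣ ⧸ N) j - x) this
      rwa [add_sub_cancel] at this
    rw [← h2, ← h1, Finset.sum_apply]
    refine Finset.sum_congr rfl fun ψ _ ↦ ?_
    rw [Pi.smul_apply, smul_eq_mul, sphereFun, Set.indicator_of_mem hx, unitsFun_coe]
    congr 1
    change _ = ((AddChar.circleEquivComplex.symm ψ (Additive.ofMul (x : kˣ ⧸ N)) : Circle) : ℂ)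
    rw [AddChar.complexBasis_apply]
    conv_lhs => rw [← AddChar.circleEquivComplex.apply_symm_apply ψ]
    rfl
  · simp [hs x hx, sphereFun, hx]

end Characters

/-! ### Level spaces and characters of given conductor exponent -/

section ConductorSpan

variable {k : Type*} [NormedField k] [IsUltrametricDist k] {q : ℕ} [NormalizedLocalField k q]
  [ProperSpace k] [MeasurableSpace k] [BorelSpace k] {μ : Measure k} [μ.IsAddHaarMeasure]
  {f : ℕ} {j : ℤ}

/-- Expand φ in characters and split the sum into the part P of conductor exponent f and the rest B.
Both lie in the level space, but B is a combination of characters orthogonal to that space, so B is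
orthogonal to itself. -/
theorem levelSpace_le_span (hf : 1 ≤ f) : levelSpace μ f j ≤
    Submodule.span ℂ {φ : Lp ℂ 2 μ | ∃ χ : kˣ →ₜ* Circle, HasConductor χ f ∧
      φ =ᵐ[μ] sphereFun χ j} := by
  classical
  intro φ hφ
  obtain ⟨h, hh, e⟩ := id hφ
  obtain ⟨ι, _, χ, c, hχ, hsum⟩ := exists_eq_sum_sphereFun hf (fun x ↦ hh.eq_zero_of_notMem) hh.inv
  let v : ι → Lp ℂ 2 μ := fun i ↦ ((hχ i).memLp_sphereFun (j := j) hf).toLp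
  have hv : ∀ i, v i =ᵐ[μ] sphereFun (χ i) j := fun i ↦ MemLp.coeFn_toLp _
  have hφv : φ = ∑ i, c i • v i := by
    refine Lp.ext (e.trans ?_)
    have h1 : ∀ᵐ x ∂μ, ∀ i, (c i • v i : Lp ℂ 2 μ) x = c i * sphereFun (χ i) j x := by
      rw [ae_all_iff]
      intro i
      filter_upwards [Lp.coeFn_smul (c i) (v i), hv i] with x h1 h2
      rw [h1, Pi.smul_apply, h2, smul_eq_mul]
    filter_upwards [Lp.coeFn_finsetSum Finset.univ fun i ↦ c i • v i, h1] with x h2 h3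
    rw [h2, hsum, Finset.sum_apply]
    exact Finset.sum_congr rfl fun i _ ↦ (h3 i).symm
  set P := ∑ i with HasConductor (χ i) f, c i • v i with hP
  set B := ∑ i with ¬ HasConductor (χ i) f, c i • v i with hB
  have hPB : φ = P + B := by rw [hφv, hP, hB, Finset.sum_filter_add_sum_filter_not]
  have hPm : P ∈ levelSpace μ f j := sum_mem fun i hi ↦ Submodule.smul_mem _ _
    ⟨_, (Finset.mem_filter.1 hi).2.isLevel_sphereFun, hv i⟩
  have hBm : B ∈ levelSpace μ f j := by
    rw [eq_sub_of_add_eq' hPB.symm]; exact sub_mem hφ hPm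
  have hB0 : B = 0 := by
    rw [← inner_self_eq_zero (𝕜 := ℂ)]
    conv_lhs => rw [hB, inner_sum]
    refine Finset.sum_eq_zero fun i hi ↦ ?_
    obtain ⟨b, hb, eb⟩ := hBm
    rw [inner_smul_right, inner_eq_integral_of_ae eb (hv i),
      hb.conj.integral_mul_sphereFun hf (hχ i) (Finset.mem_filter.1 hi).2, mul_zero]
  rw [hPB, hB0, add_zero, hP]
  exact sum_mem fun i hi ↦ Submodule.smul_mem _ _
    (Submodule.subset_span ⟨χ i, (Finset.mem_filter.1 hi).2, hv i⟩)

theorem mem_iSup_levelSpace {g : ℝ → ℂ} {χ : kˣ →ₜ* Circle} (hg : HasCompactSupport g)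
    (hg0 : tsupport g ⊆ Set.Ioi 0) (hχ : HasConductor χ f) {φ : Lp ℂ 2 μ}
    (hφ : φ =ᵐ[μ] fun x ↦ g ‖x‖ * unitsFun χ x) : φ ∈ ⨆ j, levelSpace μ f j := by
  classical
  -- A compact support inside (0, ∞) stays away from 0 and from infinity, so it meets only finitely
  -- many radii q^j.
  have hne : ∃ m : ℕ, ∀ j : ℤ, g ((q : ℝ) ^ j) ≠ 0 → j ∈ Finset.Icc (-m : ℤ) m := by
    obtain ⟨C, hC⟩ := hg.isCompact.bddAbove
    obtain ⟨m, hm⟩ := exists_lt_zpow k C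
    obtain ⟨ε, hε, hε'⟩ : ∃ ε > 0, ∀ r ∈ tsupport g, ε ≤ r := by
      rcases (tsupport g).eq_empty_or_nonempty with h0 | h0
      · exact ⟨1, one_pos, by simp [h0]⟩
      · obtain ⟨r, hr, hr'⟩ := hg.isCompact.exists_isLeast h0
        exact ⟨r, hg0 hr, fun s hs ↦ hr' hs⟩
    obtain ⟨n, hn⟩ := exists_zpow_lt k hε
    refine ⟨max m n, fun j hj ↦ ?_⟩
    have hjs := subset_tsupport g hj
    have h1 := (hC hjs).trans_lt hm
    have h2 := hn.trans_le (hε' _ hjs)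
    rw [zpow_q_lt_iff k] at h1 h2
    rw [Finset.mem_Icc]
    push_cast
    lia
  obtain ⟨m, hm⟩ := hne
  have hL : ∀ j, IsLevel μ f j (sphereFun χ j) := fun j ↦ hχ.isLevel_sphereFun
  have hsum : φ = ∑ j ∈ Finset.Icc (-m : ℤ) m, g ((q : ℝ) ^ j) • (hL j).memLp.toLp := by
    refine Lp.ext (hφ.trans ?_)
    have h1 : ∀ᵐ x ∂μ, ∀ j : ℤ, (g ((q : ℝ) ^ j) • (hL j).memLp.toLp : Lp ℂ 2 μ) x =
        g ((q : ℝ) ^ j) * sphereFun χ j x := by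
      rw [ae_all_iff]
      intro j
      filter_upwards [Lp.coeFn_smul (g ((q : ℝ) ^ j)) ((hL j).memLp.toLp),
        (hL j).memLp.coeFn_toLp] with x h1 h2
      rw [h1, Pi.smul_apply, h2, smul_eq_mul]
    filter_upwards [Lp.coeFn_finsetSum (Finset.Icc (-m : ℤ) m)
      fun j ↦ g ((q : ℝ) ^ j) • (hL j).memLp.toLp, h1, ae_ne_zero μ] with x h2 h3 h4
    obtain ⟨i, hi⟩ := NormalizedLocalField.norm_eq_zpow x h4
    rw [h2, Finset.sum_apply, Finset.sum_congr rfl fun j _ ↦ h3 j, Finset.sum_eq_single i, hi,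
      sphereFun, Set.indicator_of_mem (mem_qSphere.2 hi)]
    · intro j _ hji
      rw [(hL j).supp x (by rw [hi, Ne, zpow_q_inj k]; exact hji.symm), mul_zero]
    · intro hi'
      have : g ((q : ℝ) ^ i) = 0 := by by_contra h; exact hi' (hm i h)
      rw [this, zero_mul]
  rw [hsum]
  exact sum_mem fun j _ ↦ Submodule.smul_mem _ _ (Submodule.mem_iSup_of_mem j (hL j).toLp_mem)

end ConductorSpan

section Place

variable {K : Type*} [Field K] [NumberField K] (v : HeightOneSpectrum (𝓞 K))
  [MeasurableSpace (v.adicCompletion K)] [BorelSpace (v.adicCompletion K)]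
  (μ : Measure (v.adicCompletion K)) [μ.IsAddHaarMeasure]

theorem charFun_eq_unitsFun (χ : (v.adicCompletion K)ˣ →ₜ* Circle) :
    charFun v χ = unitsFun χ := rfl

theorem span_conductorFunctions {f : ℕ} (hf : 1 ≤ f) :
    Submodule.span ℂ (conductorFunctions v μ f) = ⨆ j, levelSpace μ f j := by
  refine le_antisymm ?_ (iSup_le fun j ↦ (levelSpace_le_span hf).trans (Submodule.span_mono ?_))
  · rw [Submodule.span_le]
    rintro φ ⟨g, χ, hg, hg0, hχ, hφ⟩
    exact mem_iSup_levelSpace hg hg0 hχ hφ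
  · rintro φ ⟨χ, hχ, hφ⟩
    have hpos := zpow_q_pos (v.adicCompletion K) j
    have hts : tsupport (Set.indicator {(resCard v : ℝ) ^ j} (1 : ℝ → ℂ)) ⊆
        {(resCard v : ℝ) ^ j} :=
      closure_minimal Set.support_indicator_subset isClosed_singleton
    -- No continuity is asked of g, so the indicator of the single radius q^j isolates the sphere.
    refine ⟨Set.indicator {(resCard v : ℝ) ^ j} 1, χ,
      isCompact_singleton.of_isClosed_subset (isClosed_tsupport _) hts,
      hts.trans (by simpa using hpos), hχ, hφ.trans (.of_forall fun x ↦ ?_)⟩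
    rw [charFun_eq_unitsFun]
    by_cases hx : ‖x‖ = (resCard v : ℝ) ^ j
    · simp [sphereFun, mem_qSphere, hx]
    · simp [sphereFun, mem_qSphere, hx]

end Place

section Assembly

variable {K : Type*} [Field K] [NumberField K] (v : HeightOneSpectrum (𝓞 K))
  [MeasurableSpace (v.adicCompletion K)] [BorelSpace (v.adicCompletion K)]
  (μ : Measure (v.adicCompletion K)) [μ.IsAddHaarMeasure]

/-! ### The conductor operator is diagonal -/

/-- The indices of the level spaces. -/
abbrev LevelIndex {K : Type*} [Field K] [NumberField K] (v : HeightOneSpectrum (𝓞 K)) : Type :=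
  {f : ℕ // minExponent v ≤ f} × ℤ

/-- The level spaces of positive dimension. -/
def levelFamily (i : LevelIndex v) : Submodule ℂ (L2 v μ) := levelSpace μ i.1 i.2

theorem one_le_minExponent {K : Type*} [Field K] [NumberField K] (v : HeightOneSpectrum (𝓞 K)) :
    1 ≤ minExponent v := by
  unfold minExponent; split_ifs <;> lia

theorem LevelIndex.one_le {K : Type*} [Field K] [NumberField K] {v : HeightOneSpectrum (𝓞 K)}
    (i : LevelIndex v) : 1 ≤ (i.1 : ℕ) :=
  (one_le_minExponent v).trans i.1.2

theorem levelSpace_ne_bot_of_minExponent_le {f : ℕ} (hf : minExponent v ≤ f) (j : ℤ) :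
    levelSpace μ f j ≠ ⊥ := by
  refine levelSpace_ne_bot ((one_le_minExponent v).trans hf) ?_
  have h := HeightOneSpectrum.one_lt_absNorm v
  change 1 < resCard v at h
  unfold minExponent at hf
  split_ifs at hf with h2
  · exact .inr hf
  · exact .inl (by lia)

variable {v μ}
variable {R : (v.adicCompletion K)ˣ → (L2 v μ ≃ₗᵢ[ℂ] L2 v μ)}
  {F : L2 v μ ≃ₗᵢ[ℂ] L2 v μ}

theorem mem_cuspidal_iff (hR : IsDilation v μ R) {φ : L2 v μ} :
    φ ∈ cuspidal v μ R ↔ ∀ j : ℤ, ∫ x in qSphere j, φ x ∂μ = 0 := by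
  rw [← integral_unitOrbit_eq_zero_iff hR φ, ← sphere_one_eq]
  refine and_iff_right ?_
  rw [sphere_one_eq]
  exact integrableOn_unitOrbit hR φ

theorem isOrthogonalTotal_cuspidal (hR : IsDilation v μ R) :
    IsOrthogonalTotal (cuspidal v μ R) (levelFamily v μ) where
  le i φ hφ := (mem_cuspidal_iff hR).2 fun j ↦ setIntegral_qSphere_of_mem_levelSpace hφ j
  orthogonal i i' hi φ hφ φ' hφ' := by
    refine inner_eq_zero_of_mem_levelSpace (fun h ↦ hi ?_) hφ hφ'
    exact Prod.ext (Subtype.ext h.1) h.2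
  total φ hφ h := by
    rw [mem_cuspidal_iff hR] at hφ
    have h0 : ∀ᵐ x ∂μ, ∀ j : ℤ, x ∈ qSphere j → φ x = 0 := by
      rw [ae_all_iff]
      intro j
      refine ae_eq_zero_of_orthogonal_levelSpace (hφ j) fun f hf w hw ↦ ?_
      by_cases hf' : minExponent v ≤ f
      · exact h (⟨f, hf'⟩, j) w hw
      -- The only positive level not in the family is f = 1 with q = 2, where the level space is
      -- zero.
      · unfold minExponent at hf'
        split_ifs at hf' with hq
        · obtain rfl : f = 1 := by lia
          rw [levelSpace_one_eq_bot hq, Submodule.mem_bot] at hw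
          rw [hw, inner_zero_left]
        · exact absurd hf hf'
    rw [Lp.eq_zero_iff_ae_eq_zero]
    filter_upwards [h0, ae_ne_zero μ] with x hx hx0
    obtain ⟨j, hj⟩ := NormalizedLocalField.norm_eq_zpow x hx0
    exact hx j (mem_qSphere.2 hj)

theorem mem_graph_opA {S : Submodule ℂ (L2 v μ)} {p : S × S} : p ∈ (opA S).graph ↔
    (p.2 : L2 v μ) =ᵐ[μ] fun x ↦ (Real.log ‖x‖ : ℂ) * (p.1 : L2 v μ) x := by
  unfold opA
  rw [Submodule.toLinearPMap_graph_eq]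
  · rfl
  · intro p hp h0
    refine Subtype.ext ?_
    rw [Submodule.coe_zero, Lp.eq_zero_iff_ae_eq_zero]
    have hp' : (p.2 : L2 v μ) =ᵐ[μ] fun x ↦ (Real.log ‖x‖ : ℂ) * (p.1 : L2 v μ) x := hp
    rw [h0] at hp'
    filter_upwards [hp', Lp.coeFn_zero ℂ 2 μ] with x h1 h2
    rw [h1, Submodule.coe_zero, h2, Pi.zero_apply, mul_zero]

variable {κ : Type*} {b : HilbertBasis κ ℂ (cuspidal v μ R)} {idx : κ → LevelIndex v}

/-- log |x| equals j log q on the sphere that carries V(f, j). Conversely, the coordinate relations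
recover the pointwise formula, because the levels determine a cuspidal function on each sphere; so A
has the full maximal domain. -/
theorem opA_eq_diagOp (hR : IsDilation v μ R)
    (hb : ∀ k, (b k : L2 v μ) ∈ (levelFamily v μ (idx k)).topologicalClosure) :
    opA (cuspidal v μ R) = diagOp b fun k ↦ ((idx k).2 : ℝ) * Real.log (resCard v) := by
  have h := isOrthogonalTotal_cuspidal hR
  refine LinearPMap.eq_of_eq_graph ?_
  ext p
  rw [mem_graph_opA, h.mem_graph_diagOp_iff hb fun i ↦ (i.2 : ℝ) * Real.log (resCard v)]
  constructor
  · rintro hp ⟨f, j⟩ w ⟨g, hg, e⟩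
    rw [inner_eq_integral_of_ae e hp, inner_eq_integral_of_ae e (Filter.EventuallyEq.refl _ _),
      ← integral_const_mul]
    refine integral_congr_ae (.of_forall fun x ↦ ?_)
    by_cases hx : ‖x‖ = (resCard v : ℝ) ^ j
    · simp only [hx, Real.log_zpow]
      push_cast
      ring
    · simp [hg.supp x hx]
  · intro hp
    have key : ∀ᵐ x ∂μ, ∀ j : ℤ, x ∈ qSphere j → (p.2 : L2 v μ) x =
        ((j * Real.log (resCard v) : ℝ) : ℂ) * (p.1 : L2 v μ) x := by
      rw [ae_all_iff]
      intro j
      -- The error term is cuspidal and, on the sphere of radius q^j, orthogonal to every level,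
      -- hence zero there.
      set φ : L2 v μ := p.2 - ((j * Real.log (resCard v) : ℝ) : ℂ) • (p.1 : L2 v μ) with hφ
      have hφS : φ ∈ cuspidal v μ R := sub_mem p.2.2 (Submodule.smul_mem _ _ p.1.2)
      have := ae_eq_zero_of_orthogonal_levelSpace ((mem_cuspidal_iff hR).1 hφS j)
        fun f hf w hw ↦ by
          by_cases hf' : minExponent v ≤ f
          · have := hp (⟨f, hf'⟩, j) w hw
            rw [hφ, inner_sub_right, inner_smul_right, this, sub_self]
          · unfold minExponent at hf'
            split_ifs at hf' with hq
            · obtain rfl : f = 1 := by lia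
              rw [levelSpace_one_eq_bot hq, Submodule.mem_bot] at hw
              rw [hw, inner_zero_left]
            · exact absurd hf hf'
      filter_upwards [this, Lp.coeFn_sub (p.2 : L2 v μ)
        (((j * Real.log (resCard v) : ℝ) : ℂ) • (p.1 : L2 v μ)), Lp.coeFn_smul
        ((j * Real.log (resCard v) : ℝ) : ℂ) (p.1 : L2 v μ)] with x h1 h2 h3 hx
      have := h1 hx
      rw [hφ, h2, Pi.sub_apply, h3, Pi.smul_apply, smul_eq_mul, sub_eq_zero] at this
      exact this
    filter_upwards [key, ae_ne_zero μ] with x hx hx0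
    obtain ⟨j, hj⟩ := NormalizedLocalField.norm_eq_zpow x hx0
    rw [hx j (mem_qSphere.2 hj), hj, Real.log_zpow]

theorem surjective_fourierIndex :
    Function.Surjective fun i : LevelIndex v ↦ ((i.1, i.1 + diffExponent v - i.2) : LevelIndex v) :=
  fun i ↦ ⟨(i.1, i.1 + diffExponent v - i.2), by simp⟩

theorem map_levelFamily_fourier (hμ : IsSelfDual v μ) (hF : IsFourierTransform v μ F)
    (i : LevelIndex v) : (levelFamily v μ i).map (F.toLinearEquiv : L2 v μ →ₗ[ℂ] L2 v μ) =
      levelFamily v μ (i.1, i.1 + diffExponent v - i.2) :=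
  map_levelSpace_fourier (hasAddConductor_circleAddChar v) hμ hF

theorem surjective_inversionIndex :
    Function.Surjective fun i : LevelIndex v ↦ ((i.1, -i.2) : LevelIndex v) :=
  fun i ↦ ⟨(i.1, -i.2), by simp⟩

theorem surjective_dilationIndex (m : ℤ) :
    Function.Surjective fun i : LevelIndex v ↦ ((i.1, i.2 - m) : LevelIndex v) :=
  fun i ↦ ⟨(i.1, i.2 + m), by simp⟩

theorem map_levelFamily_inversion {I : L2 v μ ≃ₗᵢ[ℂ] L2 v μ} (hI : IsInversion v μ I)
    (i : LevelIndex v) : (levelFamily v μ i).map (I.toLinearEquiv : L2 v μ →ₗ[ℂ] L2 v μ) =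
      levelFamily v μ (i.1, -i.2) :=
  map_levelSpace_inversion hI i.one_le

theorem map_levelFamily_dilation (hR : IsDilation v μ R) {u : (v.adicCompletion K)ˣ} {m : ℤ}
    (hu : ‖(u : v.adicCompletion K)‖ = (resCard v : ℝ) ^ m) (i : LevelIndex v) :
    (levelFamily v μ i).map ((R u).toLinearEquiv : L2 v μ →ₗ[ℂ] L2 v μ) =
      levelFamily v μ (i.1, i.2 - m) :=
  map_levelSpace_dilation (hR u) hu

theorem opB_eq_diagOp (hμ : IsSelfDual v μ) (hF : IsFourierTransform v μ F) (hR : IsDilation v μ R)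
    (hb : ∀ k, (b k : L2 v μ) ∈ (levelFamily v μ (idx k)).topologicalClosure) :
    opB F (cuspidal v μ R) = diagOp b fun k ↦
      (((idx k).1 + diffExponent v - (idx k).2 : ℤ) : ℝ) * Real.log (resCard v) := by
  rw [opB, opA_eq_diagOp hR hb]
  exact (isOrthogonalTotal_cuspidal hR).conj_diagOp hb surjective_fourierIndex
    (map_levelFamily_fourier hμ hF) (a := fun i ↦ (i.2 : ℝ) * Real.log (resCard v))
    (a' := fun i ↦ ((i.1 + diffExponent v - i.2 : ℤ) : ℝ) * Real.log (resCard v))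
    fun i ↦ by simp

/-- The eigenvalues j log q and (f+δ-j) log q add up to a number that does not depend on j. -/
theorem conductorOp_eq_diagOp (hμ : IsSelfDual v μ) (hF : IsFourierTransform v μ F)
    (hR : IsDilation v μ R)
    (hb : ∀ k, (b k : L2 v μ) ∈ (levelFamily v μ (idx k)).topologicalClosure) :
    conductorOp F (cuspidal v μ R) = diagOp b fun k ↦ conductorValue v (idx k).1 := by
  rw [conductorOp, opA_eq_diagOp hR hb, opB_eq_diagOp hμ hF hR hb]
  refine closure_add_diagOp b _ _ fun k ↦ ?_
  unfold conductorValue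
  push_cast
  ring

variable (v) in
theorem log_resCard_pos : 0 < Real.log (resCard v) := Real.log_pos (one_lt_resCard v)

variable (v) in
theorem conductorValue_nonneg (f : ℕ) : 0 ≤ conductorValue v f := by
  have h1 : (0 : ℝ) ≤ diffExponent v := by exact_mod_cast diffExponent_nonneg v
  have h2 := (log_resCard_pos v).le
  unfold conductorValue
  positivity

variable (v) in
theorem conductorValue_injective : Function.Injective (conductorValue v) := fun f f' h ↦ by
  unfold conductorValue at h
  have := mul_right_cancel₀ (log_resCard_pos v).ne' h
  exact_mod_cast add_right_cancel this

/-- The integral multiples of a positive number that differ from `z` stay away from `z`. -/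
theorem exists_le_norm_sub_zmultiples {L : ℝ} (hL : 0 < L) (z : ℂ) :
    ∃ ε > 0, ∀ n : ℤ, z ≠ ((n * L : ℝ) : ℂ) → ε ≤ ‖z - ((n * L : ℝ) : ℂ)‖ := by
  have he : Topology.IsClosedEmbedding fun n : ℤ ↦ ((n * L : ℝ) : ℂ) :=
    Complex.isometry_ofReal.isClosedEmbedding.comp
      ((Homeomorph.mulRight₀ L hL.ne').isClosedEmbedding.comp Int.isClosedEmbedding_coe_real)
  have hc := he.isClosedMap {n : ℤ | z ≠ ((n * L : ℝ) : ℂ)} (isClosed_discrete _)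
  have hz : z ∉ (fun n : ℤ ↦ ((n * L : ℝ) : ℂ)) '' {n : ℤ | z ≠ ((n * L : ℝ) : ℂ)} := by
    rintro ⟨n, hn, rfl⟩
    exact hn rfl
  obtain ⟨ε, hε, h⟩ := Metric.isOpen_iff.1 hc.isOpen_compl z hz
  refine ⟨ε, hε, fun n hn ↦ ?_⟩
  by_contra! hlt
  refine h (?_ : ((n * L : ℝ) : ℂ) ∈ _) ⟨n, hn, rfl⟩
  rwa [Metric.mem_ball, dist_comm, dist_eq_norm]

theorem unboundedSpectrum_conductor (hR : IsDilation v μ R)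
    (hb : ∀ k, (b k : L2 v μ) ∈ (levelFamily v μ (idx k)).topologicalClosure) :
    unboundedSpectrum (diagOp b fun k ↦ conductorValue v (idx k).1) =
      {z : ℂ | ∃ f : ℕ, minExponent v ≤ f ∧ z = (conductorValue v f : ℂ)} := by
  rw [unboundedSpectrum_diagOp]
  · ext z
    constructor
    · rintro ⟨k, hk⟩
      exact ⟨_, (idx k).1.2, hk⟩
    · rintro ⟨f, hf, rfl⟩
      obtain ⟨k, hk⟩ := ((isOrthogonalTotal_cuspidal hR).exists_idx_eq_iff hb (i := (⟨f, hf⟩, 0))).2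
        (levelSpace_ne_bot_of_minExponent_le v μ hf 0)
      exact ⟨k, by rw [hk]⟩
  · intro z hz
    -- All eigenvalues are integral multiples of log q, so they cannot accumulate.
    obtain ⟨ε, hε, h⟩ := exists_le_norm_sub_zmultiples (log_resCard_pos v) z
    refine ⟨ε, hε, fun k ↦ ?_⟩
    have := h ((idx k).1 + diffExponent v)
    have e : (((idx k).1 + diffExponent v : ℤ) : ℝ) * Real.log (resCard v) =
        conductorValue v (idx k).1 := by unfold conductorValue; push_cast; rfl
    rw [e] at this
    exact this (hz k)

theorem map_unboundedEigenspace_conductor (hR : IsDilation v μ R)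
    (hb : ∀ k, (b k : L2 v μ) ∈ (levelFamily v μ (idx k)).topologicalClosure) {f : ℕ}
    (hf : minExponent v ≤ f) :
    (unboundedEigenspace (diagOp b fun k ↦ conductorValue v (idx k).1) (conductorValue v f)).map
      (cuspidal v μ R).subtype =
        (Submodule.span ℂ (conductorFunctions v μ f)).topologicalClosure := by
  rw [span_conductorFunctions v μ ((one_le_minExponent v).trans hf),
    (isOrthogonalTotal_cuspidal hR).map_unboundedEigenspace hb (fun i ↦ conductorValue v i.1)]
  congr 1
  refine le_antisymm (iSup_le fun i ↦ ?_) (iSup_le fun j ↦ ?_)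
  · have hi := i.2
    norm_cast at hi
    have := conductorValue_injective v hi
    have e : levelFamily v μ i = levelSpace μ f i.1.2 := by rw [levelFamily, ← this]
    rw [e]
    exact le_iSup (fun j ↦ levelSpace μ f j) i.1.2
  · exact le_iSup (fun i : {i : LevelIndex v // (conductorValue v f : ℂ) = conductorValue v i.1} ↦
      levelFamily v μ i) ⟨(⟨f, hf⟩, j), rfl⟩

theorem unboundedEigenspace_conductor_ne_bot (hR : IsDilation v μ R)
    (hb : ∀ k, (b k : L2 v μ) ∈ (levelFamily v μ (idx k)).topologicalClosure) {f : ℕ}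
    (hf : minExponent v ≤ f) :
    unboundedEigenspace (diagOp b fun k ↦ conductorValue v (idx k).1) (conductorValue v f) ≠ ⊥ := by
  intro h
  have h1 := map_unboundedEigenspace_conductor hR hb hf
  rw [h, Submodule.map_bot, span_conductorFunctions v μ ((one_le_minExponent v).trans hf)] at h1
  refine levelSpace_ne_bot_of_minExponent_le v μ hf 0 (le_bot_iff.1 ?_)
  rw [h1]
  exact (le_iSup (fun j ↦ levelSpace μ f j) 0).trans (Submodule.le_topologicalClosure _)

theorem topologicalClosure_iSup_eigenspace_conductor :
    (⨆ f : {f : ℕ // minExponent v ≤ f},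
      unboundedEigenspace (diagOp b fun k ↦ conductorValue v (idx k).1)
        (conductorValue v f)).topologicalClosure = ⊤ := by
  rw [← top_le_iff, ← b.dense_span]
  refine Submodule.topologicalClosure_mono (Submodule.span_le.2 ?_)
  rintro _ ⟨k, rfl⟩
  refine Submodule.mem_iSup_of_mem (idx k).1 ((mem_unboundedEigenspace_diagOp b _).2 fun i hi ↦ ?_)
  rw [HilbertBasis.inner_eq_ite, if_neg]
  rintro rfl
  exact hi rfl

end Assembly

end

end ConductorOperator

/-! ### The main theorem -/

theorem mainTheorem4 {K : Type*} [Field K] [NumberField K] (v : HeightOneSpectrum (𝓞 K))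
    [MeasurableSpace (v.adicCompletion K)] [BorelSpace (v.adicCompletion K)]
    (μ : Measure (v.adicCompletion K)) [μ.IsAddHaarMeasure]
    (hμ : ConductorOperator.IsSelfDual v μ) :
    IsGreatest (ConductorOperator.traceIntegralExponents v) (ConductorOperator.diffExponent v) ∧
    (∃! F, ConductorOperator.IsFourierTransform v μ F) ∧
    (∃! I, ConductorOperator.IsInversion v μ I) ∧
    (∃! R, ConductorOperator.IsDilation v μ R) ∧
    ∀ (F I : ConductorOperator.L2 v μ ≃ₗᵢ[ℂ] ConductorOperator.L2 v μ)
      (R : (v.adicCompletion K)ˣ → (ConductorOperator.L2 v μ ≃ₗᵢ[ℂ] ConductorOperator.L2 v μ)),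
      ConductorOperator.IsFourierTransform v μ F → ConductorOperator.IsInversion v μ I →
      ConductorOperator.IsDilation v μ R →
      let L₀ : Submodule ℂ (ConductorOperator.L2 v μ) := ConductorOperator.cuspidal v μ R
      let A : L₀ →ₗ.[ℂ] L₀ := ConductorOperator.opA L₀
      let B : L₀ →ₗ.[ℂ] L₀ := ConductorOperator.opB F L₀
      let H : L₀ →ₗ.[ℂ] L₀ := ConductorOperator.conductorOp F L₀
      -- `H` is self-adjoint and positive
      (IsSelfAdjoint H ∧ ∀ φ : H.domain, 0 ≤ RCLike.re (inner ℂ (φ : L₀) (H φ))) ∧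
      -- `H` commutes with the Fourier transform, the inversion, the dilations and `A`, `B`
      ConductorOperator.CommutesWithUnitary H F ∧
      ConductorOperator.CommutesWithUnitary H I ∧
      (∀ u, ConductorOperator.CommutesWithUnitary H (R u)) ∧
      ConductorOperator.UnboundedCommute H A ∧
      ConductorOperator.UnboundedCommute H B ∧
      ConductorOperator.UnboundedCommute A B ∧
      -- the spectrum of `H`
      ConductorOperator.unboundedSpectrum H =
        {z : ℂ | ∃ f : ℕ, ConductorOperator.minExponent v ≤ f ∧
          z = (ConductorOperator.conductorValue v f : ℂ)} ∧
      -- the eigenspaces of `H`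
      (∀ f : ℕ, ConductorOperator.minExponent v ≤ f →
        ConductorOperator.unboundedEigenspace H (ConductorOperator.conductorValue v f) ≠ ⊥ ∧
        (ConductorOperator.unboundedEigenspace H
            (ConductorOperator.conductorValue v f)).map L₀.subtype =
          (Submodule.span ℂ (ConductorOperator.conductorFunctions v μ f)).topologicalClosure) ∧
      -- the eigenvectors span a dense subspace of `L₀`
      (⨆ f : {f : ℕ // ConductorOperator.minExponent v ≤ f},
        ConductorOperator.unboundedEigenspace H
          (ConductorOperator.conductorValue v f)).topologicalClosure = ⊤ := by
  refine ⟨ConductorOperator.isGreatest_diffExponent v, ConductorOperator.existsUnique_isFourier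
    (ConductorOperator.hasAddConductor_circleAddChar v) hμ,
    ConductorOperator.existsUnique_inversion μ, ?_, fun F I R hF hI hR ↦ ?_⟩
  · choose R hR hR' using ConductorOperator.existsUnique_dilation μ
    exact ⟨R, hR, fun R' h ↦ funext fun u ↦ hR' u (R' u) (h u)⟩
  intro L₀ A B H
  have ht : ConductorOperator.IsOrthogonalTotal L₀ (ConductorOperator.levelFamily v μ) :=
    ConductorOperator.isOrthogonalTotal_cuspidal hR
  -- A single adapted basis diagonalizes A, B and H at once; every remaining claim concerns their
  -- eigenvalues or the permutation of the level spaces.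
  obtain ⟨κ, b, idx, hb⟩ := ht.exists_hilbertBasis
  have hA : A = _ := ConductorOperator.opA_eq_diagOp hR hb
  have hB : B = _ := ConductorOperator.opB_eq_diagOp hμ hF hR hb
  have hH : H = _ := ConductorOperator.conductorOp_eq_diagOp hμ hF hR hb
  rw [hA, hB, hH]
  refine ⟨⟨ConductorOperator.isSelfAdjoint_diagOp b _, ConductorOperator.re_inner_diagOp_nonneg b _
    fun k ↦ ConductorOperator.conductorValue_nonneg v _⟩, ⟨?_, ?_⟩, ⟨?_, ?_⟩, fun u ↦ ?_,
    ConductorOperator.unboundedCommute_diagOp b _ _,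
    ConductorOperator.unboundedCommute_diagOp b _ _,
    ConductorOperator.unboundedCommute_diagOp b _ _,
    ConductorOperator.unboundedSpectrum_conductor hR hb, fun f hf ↦
      ⟨ConductorOperator.unboundedEigenspace_conductor_ne_bot hR hb hf,
        ConductorOperator.map_unboundedEigenspace_conductor hR hb hf⟩,
    ConductorOperator.topologicalClosure_iSup_eigenspace_conductor⟩
  · exact ht.map_eq ConductorOperator.surjective_fourierIndex
      (ConductorOperator.map_levelFamily_fourier hμ hF)
  · exact ht.conj_diagOp hb ConductorOperator.surjective_fourierIndex
      (ConductorOperator.map_levelFamily_fourier hμ hF)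
      (a := fun i ↦ ConductorOperator.conductorValue v i.1)
      (a' := fun i ↦ ConductorOperator.conductorValue v i.1) fun i ↦ rfl
  · exact ht.map_eq ConductorOperator.surjective_inversionIndex
      (ConductorOperator.map_levelFamily_inversion hI)
  · exact ht.conj_diagOp hb ConductorOperator.surjective_inversionIndex
      (ConductorOperator.map_levelFamily_inversion hI)
      (a := fun i ↦ ConductorOperator.conductorValue v i.1)
      (a' := fun i ↦ ConductorOperator.conductorValue v i.1) fun i ↦ rfl
  · obtain ⟨m, hm⟩ := ConductorOperator.NormalizedLocalField.norm_eq_zpow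
      (u : v.adicCompletion K) u.ne_zero
    exact ⟨ht.map_eq (ConductorOperator.surjective_dilationIndex m)
      (ConductorOperator.map_levelFamily_dilation hR hm),
      ht.conj_diagOp hb (ConductorOperator.surjective_dilationIndex m)
        (ConductorOperator.map_levelFamily_dilation hR hm)
        (a := fun i ↦ ConductorOperator.conductorValue v i.1)
        (a' := fun i ↦ ConductorOperator.conductorValue v i.1) fun i ↦ rfl⟩
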